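/- Let $A$ be a finite alphabet, $A^*$ the set of words over $A$, $A^+$ the set of non-empty words, and let $\langle A \mid R\rangle$ be a finite semigroup presentation, i.e. $R\subseteq A^+\times A^+$ is finite. Write $u\equiv v$ if $v$ can be obtained from $u$ by finitely many steps, each replacing a factor $x$ by $y$, where $(x,y)\in R$ or $(y,x)\in R$. A relation word is a word that is one side of a relation in $R$; a piece is a word that occurs as a factor of two different relation words, or in two different (possibly overlapping) places of the same relation word; the presentation satisfies $C(4)$ if no relation word is a product of fewer than four pieces. A deterministic 2-tape automaton over $A$ has a finite state set $Q=Q_1\sqcup Q_2$, an initial state, a set of terminal states and partial functions $\delta_i:Q_i\times(A\cup\{\$\})\to Q$ $(i=1,2)$; in a state $p\in Q_i$ it removes the first letter $a$ from tape $i$ and moves to $\delta_i(p,a)$ (if defined). It accepts $(u,v)\in A^*\times A^*$ if, started in the initial state with $u\$$ and $v\$$ on the tapes, it can reach a terminal state with both tapes empty. A relation $S\subseteq A^*\times A^*$ is deterministic rational if it is the set of pairs accepted by such an automaton, and reverse deterministic rational if $\{(u^R,v^R) : (u,v)\in S\}$ is deterministic rational, where $w^R$ is the word $w$ written backwards. If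 $\langle A\mid R\rangle$ is a finite semigroup presentation satisfying $C(4)$, then the relation $$\{(u,v)\in A^+\times A^+ : u\equiv v\}$$ is deterministic rational and reverse deterministic rational. Moreover, there are algorithms which, given any finite semigroup presentation satisfying $C(4)$, compute deterministic 2-tape automata accepting this relation and its reverse $\{(u^R,v^R) : (u,v)\in A^+\times A^+,\ u\equiv v\}$, respectively. -/

import Mathlib

/-- A finite semigroup presentation `⟨A ∣ R⟩`: a finite set of pairs of nonempty words over `A`.
Words over `A` are lists, the free semigroup `A⁺` being the set of nonempty lists.
(Finiteness of the alphabet is assumed where presentations are used.) -/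
structure SemigroupPresentation (A : Type*) where
  rels : Set (List A × List A)
  finite_rels : rels.Finite
  ne_nil : ∀ r ∈ rels, r.1 ≠ [] ∧ r.2 ≠ []

namespace SemigroupPresentation

variable {A : Type*} (P : SemigroupPresentation A)

/-- `u` and `v` are one-step equivalent: `u = a x b`, `v = a y b` with `(x, y)` or `(y, x)` a
relation and `a`, `b` possibly empty. -/
def OneStep (u v : List A) : Prop :=
  ∃ a b x y : List A, ((x, y) ∈ P.rels ∨ (y, x) ∈ P.rels) ∧ u = a ++ x ++ b ∧ v = a ++ y ++ b

/-- `u ≡ v`: there is a finite sequence of one-step equivalences from `u` to `v`. -/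
def Equivalent (u v : List A) : Prop :=
  Relation.ReflTransGen P.OneStep u v

/-- The relation `{(u, v) ∈ A⁺ × A⁺ ∣ u ≡ v}`. -/
def wordProblem : Set (List A × List A) :=
  {w | w.1 ≠ [] ∧ w.2 ≠ [] ∧ P.Equivalent w.1 w.2}

/-- A relation word is a side of a relation. -/
def IsRelationWord (w : List A) : Prop :=
  ∃ v, (w, v) ∈ P.rels ∨ (v, w) ∈ P.rels

/-- A piece is a word which occurs as a factor of two different relation words, or in two different
(possibly overlapping) places of the same relation word. -/
def IsPiece (p : List A) : Prop :=
  ∃ a b a' b' : List A, P.IsRelationWord (a ++ p ++ b) ∧ P.IsRelationWord (a' ++ p ++ b') ∧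
    (a ++ p ++ b ≠ a' ++ p ++ b' ∨ a.length ≠ a'.length)

/-- The small overlap condition `C(m)`: no relation word is a product of strictly fewer than `m`
pieces. -/
def SmallOverlap (m : ℕ) : Prop :=
  ∀ w, P.IsRelationWord w →
    ¬ ∃ l : List (List A), l.length < m ∧ (∀ p ∈ l, P.IsPiece p) ∧ l.flatten = w

end SemigroupPresentation

/-- A deterministic 2-tape automaton over the alphabets `A₁`, `A₂`. The state set is the
disjoint union `Q₁ ⊕ Q₂`; states in `Qᵢ` read from tape `i`. The alphabet `Aᵢ ∪ {$}` is
`Option Aᵢ`, with `none` the end-marker `$`. The transition functions are partial. -/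
structure DetTwoTapeAutomaton (A₁ A₂ Q₁ Q₂ : Type*) where
  init : Q₁ ⊕ Q₂
  terminal : Set (Q₁ ⊕ Q₂)
  δ₁ : Q₁ → Option A₁ → Option (Q₁ ⊕ Q₂)
  δ₂ : Q₂ → Option A₂ → Option (Q₁ ⊕ Q₂)

namespace DetTwoTapeAutomaton

variable {A₁ A₂ Q₁ Q₂ : Type*} (M : DetTwoTapeAutomaton A₁ A₂ Q₁ Q₂)

/-- One move: the first letter of the tape belonging to the current state is consumed. -/
inductive Step : List (Option A₁) × List (Option A₂) × (Q₁ ⊕ Q₂) →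
    List (Option A₁) × List (Option A₂) × (Q₁ ⊕ Q₂) → Prop
  | tape₁ (a : Option A₁) (u : List (Option A₁)) (v : List (Option A₂)) (p : Q₁) (q : Q₁ ⊕ Q₂)
      (h : M.δ₁ p a = some q) : Step (a :: u, v, Sum.inl p) (u, v, q)
  | tape₂ (b : Option A₂) (u : List (Option A₁)) (v : List (Option A₂)) (p : Q₂) (q : Q₁ ⊕ Q₂)
      (h : M.δ₂ p b = some q) : Step (u, b :: v, Sum.inr p) (u, v, q)

/-- The word `w $`. -/
def endMarked {A : Type*} (w : List A) : List (Option A) :=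
  w.map some ++ [none]

/-- The relation accepted by `M`: all `(u, v)` such that `(u $, v $, init)` leads in finitely many
moves to `(ε, ε, t)` with `t` terminal. -/
def accepted : Set (List A₁ × List A₂) :=
  {w | ∃ t ∈ M.terminal,
    Relation.ReflTransGen M.Step (endMarked w.1, endMarked w.2, M.init) ([], [], t)}

end DetTwoTapeAutomaton

/-- A deterministic rational relation: one accepted by a deterministic 2-tape automaton with
finitely many states. -/
def IsDetRational {A₁ A₂ : Type*} (R : Set (List A₁ × List A₂)) : Prop :=
  ∃ (k₁ k₂ : ℕ) (M : DetTwoTapeAutomaton A₁ A₂ (Fin k₁) (Fin k₂)), M.accepted = R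

/-- The relation `{(uᴿ, vᴿ) ∣ (u, v) ∈ R}`. -/
def reverseRel {A₁ A₂ : Type*} (R : Set (List A₁ × List A₂)) : Set (List A₁ × List A₂) :=
  (fun w => (w.1.reverse, w.2.reverse)) '' R

/-- A reverse deterministic rational relation. -/
def IsRevDetRational {A₁ A₂ : Type*} (R : Set (List A₁ × List A₂)) : Prop :=
  IsDetRational (reverseRel R)

/-- Finite data presenting a semigroup presentation over the alphabet `Fin n`:
the number `n` and a list of the relations. -/
abbrev PresentationCode : Type :=
  ℕ × List (List ℕ × List ℕ)

/-- `c` lists the data of the presentation `P` over `Fin n`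
(in any order, possibly with repetitions). -/
def PresentationCode.Describes (c : PresentationCode) {n : ℕ}
    (P : SemigroupPresentation (Fin n)) : Prop :=
  c.1 = n ∧ {r | r ∈ c.2} = (fun r => (r.1.map Fin.val, r.2.map Fin.val)) '' P.rels

/-- Finite data presenting a deterministic 2-tape automaton with state set `Fin k₁ ⊕ Fin k₂`:
the numbers `k₁`, `k₂`, the initial state, the list of terminal states, and for each tape
the transition table as a list of triples (source, letter or `$`, target). -/
abbrev AutomatonCode : Type :=
  (ℕ × ℕ) × (ℕ ⊕ ℕ) × List (ℕ ⊕ ℕ) ×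
    List (ℕ × Option ℕ × (ℕ ⊕ ℕ)) × List (ℕ × Option ℕ × (ℕ ⊕ ℕ))

/-- The number of a state. -/
def stateCode {k₁ k₂ : ℕ} (q : Fin k₁ ⊕ Fin k₂) : ℕ ⊕ ℕ :=
  Sum.map Fin.val Fin.val q

/-- `c` lists the complete data of the automaton `M`; in particular `c` determines `M`. -/
def AutomatonCode.Describes (c : AutomatonCode) {n₁ n₂ k₁ k₂ : ℕ}
    (M : DetTwoTapeAutomaton (Fin n₁) (Fin n₂) (Fin k₁) (Fin k₂)) : Prop :=
  c.1 = (k₁, k₂) ∧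
  c.2.1 = stateCode M.init ∧
  (∀ q, stateCode q ∈ c.2.2.1 ↔ q ∈ M.terminal) ∧
  (∀ p a q, (p.val, a.map Fin.val, stateCode q) ∈ c.2.2.2.1 ↔ M.δ₁ p a = some q) ∧
  (∀ p a q, (p.val, a.map Fin.val, stateCode q) ∈ c.2.2.2.2 ↔ M.δ₂ p a = some q)

/-- The partial function `F` computes, from a `C(4)` semigroup presentation `P`, a deterministic
2-tape automaton which accepts the relation `T P`. -/
def ComputesAutomata (F : PresentationCode →. AutomatonCode)
    (T : ∀ {n : ℕ}, SemigroupPresentation (Fin n) → Set (List (Fin n) × List (Fin n))) : Prop :=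
  ∀ (n : ℕ) (P : SemigroupPresentation (Fin n)) (c : PresentationCode),
    c.Describes P → P.SmallOverlap 4 →
      ∃ d ∈ F c, ∃ (k₁ k₂ : ℕ) (M : DetTwoTapeAutomaton (Fin n) (Fin n) (Fin k₁) (Fin k₂)),
        AutomatonCode.Describes d M ∧ M.accepted = T P

/-!
# Deterministic two-tape automata for `C(4)` presentations

Let `suf R` be the longest suffix of a relation word `R` which is a piece, and let `stem R` be the
rest of `R`. Under `C(4)` the stem is not a product of two pieces, so stems of relation words at the
beginnings of words, or of words `z ++ s` with a piece `z`, are unique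
(`SmallOverlap.stem_unique`). The overlap lemma `SmallOverlap.not_equivalent` says that a relation
word which starts properly inside `stem R`, in a word in which `stem R` can be completed to `R` by
rewriting, can never be completed itself. Hence rewriting of such a "live" word leaves the stem at
its beginning intact until the complete relation word is replaced by another one
(`SmallOverlap.oneStep_stem`, `SmallOverlap.equivalent_stems`), while the first letter of a word
which is not live never changes (`Equivalent.cons_of_not_live`).

This yields a left-to-right decision procedure. The question `Residual u v p`, whether `u` and `v`
are equivalent and some word equivalent to them begins with the piece `p`, reduces to a question of
the same kind about shorter words; the cases are distinguished by the stems with which `u` and `v`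
begin and by whether these are completed to relation words (`SmallOverlap.residual_reduceStep`).
If `K` bounds the lengths of the relation words, the step depends only on prefixes of length `2 * K`
(`reduceStep_append`), and it replaces a prefix of each word by at most a piece. A piece at the
beginning of a word which begins with a stem is a proper prefix of this stem, so a suitable weight of
the unprocessed words decreases (`SmallOverlap.weighs_of_shortens`).

The automaton keeps the unprocessed parts of the two words, and the word `p`, in its state. It reads
from the first tape until the buffer of this tape is full, then from the second tape until both
buffers are full, and then reduces until one of them is not full any more. Buffers stay bounded, so
there are finitely many states (`Setting.finite_isState`). The end-marker is treated as an
additional letter which occurs in no relation.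

The step function is primitive recursive in the list of relations (`primrec_next`): pieces and
linked relation words are found by bounded search. An algorithm therefore enumerates finite lists of
states until it finds one which contains the initial and the terminal state and is closed under
transitions, and outputs the automaton of this list (`computesAutomata_computeAutomaton`). The
condition `C(4)` is invariant under reversal of all relation words, which gives the statements about
the reversed relation (`wordProblem_reverse`).
-/

namespace SemigroupPresentation

/-! ### Relation words, pieces and stems -/

variable {A : Type*} {P : SemigroupPresentation A}

theorem IsRelationWord.ne_nil {w : List A} (h : P.IsRelationWord w) : w ≠ [] := by
  obtain ⟨v, h | h⟩ := h
  · exact (P.ne_nil _ h).1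
  · exact (P.ne_nil _ h).2

theorem IsPiece.of_infix {p q : List A} (hp : P.IsPiece p) (h : q <:+: p) : P.IsPiece q := by
  obtain ⟨c, d, rfl⟩ := h
  obtain ⟨a, b, a', b', h1, h2, h3⟩ := hp
  refine ⟨a ++ c, d ++ b, a' ++ c, d ++ b', by simpa using h1, by simpa using h2, ?_⟩
  rcases h3 with h3 | h3
  · left; simpa using h3
  · right; simpa using h3

theorem IsPiece.exists_isRelationWord {p : List A} (hp : P.IsPiece p) :
    ∃ a b, P.IsRelationWord (a ++ p ++ b) := by
  obtain ⟨a, b, -, -, h, -⟩ := hp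
  exact ⟨a, b, h⟩

theorem isPiece_of_eq {R S p a b a' b' : List A} (hR : P.IsRelationWord R)
    (hS : P.IsRelationWord S) (eR : R = a ++ p ++ b) (eS : S = a' ++ p ++ b')
    (h : R ≠ S ∨ a.length ≠ a'.length) : P.IsPiece p := by
  subst eR eS
  exact ⟨a, b, a', b', hR, hS, h⟩

theorem IsRelationWord.isPiece_nil {w : List A} (h : P.IsRelationWord w) : P.IsPiece [] := by
  refine isPiece_of_eq (a := []) (b := w) (a' := w) (b' := []) h h (by simp) (by simp) ?_
  right
  have := h.ne_nil
  intro h'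
  exact this (List.length_eq_zero_iff.1 h'.symm)

open Classical in
/-- The longest suffix of `x` which satisfies `p` (it is empty if there is none). -/
noncomputable def longestSuffix (p : List A → Prop) (x : List A) : List A :=
  x.drop (x.length - Nat.findGreatest (fun k => p (x.drop (x.length - k))) x.length)

theorem longestSuffix_suffix (p : List A → Prop) (x : List A) : longestSuffix p x <:+ x :=
  List.drop_suffix _ _

open Classical in
theorem longestSuffix_spec {p : List A → Prop} (x : List A) (h : p []) :
    p (longestSuffix p x) :=
  Nat.findGreatest_spec (P := fun k => p (x.drop (x.length - k)))
    (Nat.zero_le x.length) (by simpa using h)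

theorem length_le_longestSuffix {p : List A → Prop} {x q : List A} (hq : p q) (h : q <:+ x) :
    q.length ≤ (longestSuffix p x).length := by
  classical
  have h1 : q.length ≤ Nat.findGreatest (fun k => p (x.drop (x.length - k))) x.length :=
    Nat.le_findGreatest h.length_le (by rwa [← List.suffix_iff_eq_drop.1 h])
  have h2 : Nat.findGreatest (fun k => p (x.drop (x.length - k))) x.length ≤ x.length :=
    Nat.findGreatest_le _
  simp only [longestSuffix, List.length_drop]
  omega

/-- The longest suffix of `R` which is a piece. -/
noncomputable def suf (P : SemigroupPresentation A) (R : List A) : List A :=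
  longestSuffix P.IsPiece R

/-- The word `R` with its longest piece suffix removed. -/
noncomputable def stem (P : SemigroupPresentation A) (R : List A) : List A :=
  R.take (R.length - (P.suf R).length)

theorem suf_suffix (R : List A) : P.suf R <:+ R := longestSuffix_suffix _ _

theorem stem_append_suf (R : List A) : P.stem R ++ P.suf R = R := by
  conv_rhs => rw [← List.take_append_drop (R.length - (P.suf R).length) R]
  rw [← List.suffix_iff_eq_drop.1 (suf_suffix R)]
  rfl

/-- Used to exhibit pieces: a factorization of a stem extends to one of the relation word. -/
theorem eq_append_suf {R x : List A} (h : x = P.stem R) : R = x ++ P.suf R := by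
  rw [h, stem_append_suf]

theorem stem_prefix (R : List A) : P.stem R <+: R := List.take_prefix _ _

theorem IsRelationWord.isPiece_suf {R : List A} (h : P.IsRelationWord R) :
    P.IsPiece (P.suf R) :=
  longestSuffix_spec R h.isPiece_nil

theorem IsPiece.length_le_suf {R q : List A} (hq : P.IsPiece q) (h : q <:+ R) :
    q.length ≤ (P.suf R).length :=
  length_le_longestSuffix hq h

/-- Under `C(4)` the stem of a relation word is not a product of two pieces. -/
theorem SmallOverlap.not_isPiece {R c f : List A} (h4 : P.SmallOverlap 4)
    (hR : P.IsRelationWord R) (hc : P.IsPiece c) (h : c ++ f = P.stem R) : ¬ P.IsPiece f := by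
  intro hf
  refine h4 R hR ⟨[c, f, P.suf R], by simp, ?_, ?_⟩
  · intro p hp
    simp only [List.mem_cons, List.not_mem_nil, or_false] at hp
    rcases hp with rfl | rfl | rfl
    exacts [hc, hf, hR.isPiece_suf]
  · simp [← List.append_assoc, h, stem_append_suf]

theorem SmallOverlap.not_isPiece_stem {R : List A} (h4 : P.SmallOverlap 4)
    (hR : P.IsRelationWord R) : ¬ P.IsPiece (P.stem R) :=
  h4.not_isPiece hR hR.isPiece_nil rfl

theorem SmallOverlap.not_isPiece_self {R : List A} (h4 : P.SmallOverlap 4)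
    (hR : P.IsRelationWord R) : ¬ P.IsPiece R := fun h =>
  h4.not_isPiece_stem hR (h.of_infix (stem_prefix R).isInfix)

/-- A relation word is a factor of a relation word only trivially. -/
theorem SmallOverlap.eq_nil_of_append {S T a b : List A} (h4 : P.SmallOverlap 4)
    (hS : P.IsRelationWord S) (hT : P.IsRelationWord T) (h : S = a ++ T ++ b) : a = [] := by
  by_contra ha
  refine h4.not_isPiece_self hT (isPiece_of_eq (a' := []) (b' := []) hS hT h (by simp) ?_)
  right
  simpa using ha

/-- A piece which is a prefix of a word beginning with `stem R` is a prefix of `stem R`. -/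
theorem SmallOverlap.prefix_stem {R z u : List A} (h4 : P.SmallOverlap 4)
    (hR : P.IsRelationWord R) (hz : P.IsPiece z) (h : P.stem R <+: u) (hu : z <+: u) :
    z <+: P.stem R := by
  rcases List.prefix_or_prefix_of_prefix h hu with h' | h'
  · exact absurd (hz.of_infix h'.isInfix) (h4.not_isPiece_stem hR)
  · exact h'

/-- If two words `z ++ s` and `z' ++ s`, with `z` and `z'` pieces, begin with stems of relation
words, then these occurrences of stems are the same. -/
theorem SmallOverlap.stem_unique {R S z z' s : List A} (h4 : P.SmallOverlap 4)
    (hR : P.IsRelationWord R) (hS : P.IsRelationWord S) (hz : P.IsPiece z) (hz' : P.IsPiece z')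
    (h : P.stem R <+: z ++ s) (h' : P.stem S <+: z' ++ s) : R = S ∧ z = z' := by
  obtain ⟨x, hx⟩ := h4.prefix_stem hR hz h (List.prefix_append _ _)
  obtain ⟨x', hx'⟩ := h4.prefix_stem hS hz' h' (List.prefix_append _ _)
  have h1 : x <+: s := by rwa [← hx, List.prefix_append_right_inj] at h
  have h2 : x' <+: s := by rwa [← hx', List.prefix_append_right_inj] at h'
  have key : R = S ∧ z.length = z'.length := by
    by_contra hne
    rw [not_and_or] at hne
    rcases List.prefix_or_prefix_of_prefix h1 h2 with ⟨y, rfl⟩ | ⟨y, rfl⟩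
    · exact h4.not_isPiece hR hz hx (isPiece_of_eq (b := P.suf R) (b' := y ++ P.suf S) hR hS
        (eq_append_suf hx) (by simpa using eq_append_suf hx') hne)
    · exact h4.not_isPiece hS hz' hx' (isPiece_of_eq (b := y ++ P.suf R) (b' := P.suf S) hR hS
        (by simpa using eq_append_suf hx) (eq_append_suf hx') hne)
  refine ⟨key.1, ?_⟩
  have h3 : z <+: P.stem R := ⟨x, hx⟩
  have h4' : z' <+: P.stem R := ⟨x', by rw [hx', key.1]⟩
  exact List.IsPrefix.eq_of_length (List.prefix_of_prefix_length_le h3 h4' key.2.le) key.2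

/-- At most one stem of a relation word is a prefix of a given word. -/
theorem SmallOverlap.head_unique {R S u : List A} (h4 : P.SmallOverlap 4)
    (hR : P.IsRelationWord R) (hS : P.IsRelationWord S)
    (h : P.stem R <+: u) (h' : P.stem S <+: u) : R = S :=
  (h4.stem_unique (z := []) (z' := []) hR hS hR.isPiece_nil hR.isPiece_nil h h').1

/-! ### The equivalence generated by a presentation -/

theorem OneStep.symm {u v : List A} (h : P.OneStep u v) : P.OneStep v u := by
  obtain ⟨a, b, x, y, h, rfl, rfl⟩ := h
  exact ⟨a, b, y, x, h.symm, rfl, rfl⟩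

theorem OneStep.append_left {u v : List A} (c : List A) (h : P.OneStep u v) :
    P.OneStep (c ++ u) (c ++ v) := by
  obtain ⟨a, b, x, y, h, rfl, rfl⟩ := h
  exact ⟨c ++ a, b, x, y, h, by simp, by simp⟩

theorem OneStep.append_right {u v : List A} (h : P.OneStep u v) (c : List A) :
    P.OneStep (u ++ c) (v ++ c) := by
  obtain ⟨a, b, x, y, h, rfl, rfl⟩ := h
  exact ⟨a, b ++ c, x, y, h, by simp, by simp⟩

theorem OneStep.equivalent {u v : List A} (h : P.OneStep u v) : P.Equivalent u v :=
  Relation.ReflTransGen.single h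

theorem Equivalent.refl (u : List A) : P.Equivalent u u := Relation.ReflTransGen.refl

theorem Equivalent.symm {u v : List A} (h : P.Equivalent u v) : P.Equivalent v u := by
  induction h with
  | refl => exact .refl _
  | tail _ h ih => exact Relation.ReflTransGen.head h.symm ih

theorem Equivalent.trans {u v w : List A} (h : P.Equivalent u v) (h' : P.Equivalent v w) :
    P.Equivalent u w := Relation.ReflTransGen.trans h h'

theorem Equivalent.append_left {u v : List A} (c : List A) (h : P.Equivalent u v) :
    P.Equivalent (c ++ u) (c ++ v) :=
  Relation.ReflTransGen.lift (c ++ ·) (fun _ _ h => OneStep.append_left c h) _ _ h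

theorem Equivalent.append_right {u v : List A} (h : P.Equivalent u v) (c : List A) :
    P.Equivalent (u ++ c) (v ++ c) :=
  Relation.ReflTransGen.lift (· ++ c) (fun _ _ h => OneStep.append_right h c) _ _ h

/-- `DerivesIn P n u v`: the word `v` is obtained from `u` by `n` replacements. -/
inductive DerivesIn (P : SemigroupPresentation A) (u : List A) : ℕ → List A → Prop
  | refl : DerivesIn P u 0 u
  | tail {n v w} : DerivesIn P u n v → P.OneStep v w → DerivesIn P u (n + 1) w

theorem DerivesIn.head {n : ℕ} {u v w : List A} (h : P.OneStep u v) (h' : P.DerivesIn v n w) :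
    P.DerivesIn u (n + 1) w := by
  induction h' with
  | refl => exact .tail .refl h
  | tail _ h ih => exact .tail ih h

theorem DerivesIn.symm {n : ℕ} {u v : List A} (h : P.DerivesIn u n v) : P.DerivesIn v n u := by
  induction h with
  | refl => exact .refl
  | tail _ h ih => exact .head h.symm ih

theorem Equivalent.derivesIn {u v : List A} (h : P.Equivalent u v) : ∃ n, P.DerivesIn u n v := by
  induction h with
  | refl => exact ⟨0, .refl⟩
  | tail _ h ih => obtain ⟨n, hn⟩ := ih; exact ⟨n + 1, .tail hn h⟩

theorem OneStep.exists_word {u v : List A} (h : P.OneStep u v) :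
    ∃ a b x y, P.IsRelationWord x ∧ P.IsRelationWord y ∧ ((x, y) ∈ P.rels ∨ (y, x) ∈ P.rels) ∧
      u = a ++ x ++ b ∧ v = a ++ y ++ b := by
  obtain ⟨a, b, x, y, h, rfl, rfl⟩ := h
  exact ⟨a, b, x, y, ⟨y, h⟩, ⟨x, h.symm⟩, h, rfl, rfl⟩

/-- A replacement of the relation word `T` in `x ++ w` takes place inside `w`, or at the
beginning of a factor `o ++ w` with `o` a nonempty suffix of `x` and part of `T`,
or inside `x`. -/
theorem eq_append_cases {x w a T b : List A} (h : x ++ w = a ++ T ++ b) :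
    (∃ a', a = x ++ a' ∧ w = a' ++ T ++ b) ∨
    (∃ o f, o ≠ [] ∧ x = a ++ o ∧ T = o ++ f ∧ w = f ++ b) ∨
    (∃ o, x = a ++ T ++ o) := by
  rw [List.append_assoc, List.append_eq_append_iff] at h
  rcases h with ⟨a', rfl, h⟩ | ⟨o, rfl, h⟩
  · exact .inl ⟨a', rfl, by simpa using h⟩
  · rw [List.append_eq_append_iff] at h
    rcases h with ⟨o', rfl, h⟩ | ⟨f, rfl, h⟩
    · exact .inr (.inr ⟨o', by simp⟩)
    · by_cases ho : o = []
      · subst ho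
        exact .inl ⟨[], by simp, by simpa using h⟩
      · exact .inr (.inl ⟨o, f, ho, rfl, rfl, h⟩)

/-- The main overlap lemma. If a relation word `T = e ++ f` starts properly inside the stem
`d ++ e` of `R`, then the remainder of `T` cannot be turned into the remainder of `R`. -/
theorem SmallOverlap.not_derivesIn {R T d e f s t : List A} {n : ℕ} (h4 : P.SmallOverlap 4)
    (hR : P.IsRelationWord R) (hT : P.IsRelationWord T) (hd : d ≠ []) (he : e ≠ [])
    (hRe : P.stem R = d ++ e) (hTe : T = e ++ f) :
    ¬ P.DerivesIn (f ++ t) n (P.suf R ++ s) := by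
  induction n using Nat.strong_induction_on generalizing R T d e f s t with
  | _ n ih =>
  intro hder
  have hRde : R = d ++ e ++ P.suf R := by rw [← hRe, stem_append_suf]
  have hdl : d.length ≠ 0 := fun h => hd (List.length_eq_zero_iff.1 h)
  have pe : P.IsPiece e := isPiece_of_eq (a' := []) (b' := f) hR hT hRde (by simpa using hTe)
    (.inr (by simpa using hdl))
  obtain ⟨x, hx⟩ := h4.prefix_stem hT pe (stem_prefix T) ⟨f, hTe.symm⟩
  have hf : f = x ++ P.suf T := by
    have := stem_append_suf (P := P) T
    rw [← hx, hTe, List.append_assoc, List.append_cancel_left_eq] at this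
    rw [← hTe] at this
    exact this.symm
  have hel : e.length ≠ 0 := fun h => he (List.length_eq_zero_iff.1 h)
  have key : ∀ m w, m ≤ n → P.DerivesIn (f ++ t) m w →
      ∃ w', w = x ++ w' ∧ P.DerivesIn (P.suf T ++ t) m w' := by
    intro m w hm hw
    induction hw with
    | refl => exact ⟨_, by rw [hf, List.append_assoc], .refl⟩
    | @tail m v w hv hs ihm =>
      obtain ⟨v', rfl, hv'⟩ := ihm (by omega)
      obtain ⟨a, b, T', y, hT', -, hr, hu, rfl⟩ := hs.exists_word
      rcases eq_append_cases hu with ⟨a', rfl, rfl⟩ | ⟨o, f', ho, hxo, hTo, rfl⟩ | ⟨o, ho⟩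
      · exact ⟨a' ++ y ++ b, by simp, .tail hv' ⟨a', b, T', y, hr, rfl, rfl⟩⟩
      · exact absurd hv'.symm (ih m (by omega) hT hT' (d := e ++ a) (by simp [he]) ho
          (by rw [← hx, hxo]; simp) hTo)
      · have := h4.eq_nil_of_append (a := e ++ a) (b := o ++ P.suf T) hT hT'
          (by rw [ho] at hx; simpa using eq_append_suf hx)
        simp [he] at this
  obtain ⟨w', hw', -⟩ := key n _ le_rfl hder
  have hpre : P.stem T <+: e ++ P.suf R ++ s := by
    rw [List.append_assoc, hw', ← hx]; simp
  rcases List.prefix_or_prefix_of_prefix hpre (List.prefix_append _ _) with ⟨y, h⟩ | ⟨y, h⟩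
  · refine h4.not_isPiece_stem hT (isPiece_of_eq (a := d) (b := y) (a' := []) (b' := P.suf T)
      hR hT ?_ (by simp [stem_append_suf]) (.inr (by simpa using hdl)))
    rw [List.append_assoc, h]; simpa using hRde
  · have : P.IsPiece (e ++ P.suf R) := isPiece_of_eq (a := d) (b := []) (a' := [])
      (b' := y ++ P.suf T) hR hT (by simpa using hRde)
      (by simpa using eq_append_suf h) (.inr (by simpa using hdl))
    have := this.length_le_suf (R := R) ⟨d, by simpa using hRde.symm⟩
    simp at this
    exact he this

theorem SmallOverlap.not_equivalent {R T d e f s t : List A} (h4 : P.SmallOverlap 4)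
    (hR : P.IsRelationWord R) (hT : P.IsRelationWord T) (hd : d ≠ []) (he : e ≠ [])
    (hRe : P.stem R = d ++ e) (hTe : T = e ++ f) :
    ¬ P.Equivalent (f ++ t) (P.suf R ++ s) := fun h => by
  obtain ⟨n, hn⟩ := h.derivesIn
  exact h4.not_derivesIn hR hT hd he hRe hTe hn

end SemigroupPresentation

namespace SemigroupPresentation

/-! ### Live words and their equivalence -/

variable {A : Type*} {P : SemigroupPresentation A}

/-- Two words are adjacent if they are the two sides of a relation. -/
def Adj (P : SemigroupPresentation A) (x y : List A) : Prop :=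
  (x, y) ∈ P.rels ∨ (y, x) ∈ P.rels

/-- Two words are linked if a sequence of relations leads from one to the other. -/
def Linked (P : SemigroupPresentation A) (x y : List A) : Prop :=
  Relation.ReflTransGen P.Adj x y

theorem Linked.refl (x : List A) : P.Linked x x := Relation.ReflTransGen.refl

theorem Linked.symm {x y : List A} (h : P.Linked x y) : P.Linked y x := by
  induction h with
  | refl => exact .refl _
  | tail _ h ih => exact Relation.ReflTransGen.head h.symm ih

theorem Linked.trans {x y z : List A} (h : P.Linked x y) (h' : P.Linked y z) : P.Linked x z :=
  Relation.ReflTransGen.trans h h'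

theorem Linked.isRelationWord {x y : List A} (h : P.Linked x y) (hx : P.IsRelationWord x) :
    P.IsRelationWord y := by
  induction h with
  | refl => exact hx
  | tail _ h _ => exact ⟨_, h.symm⟩

theorem Linked.equivalent {x y : List A} (h : P.Linked x y) : P.Equivalent x y := by
  induction h with
  | refl => exact .refl _
  | @tail y z _ h ih =>
    exact ih.trans (OneStep.equivalent ⟨[], [], y, z, h, by simp, by simp⟩)

/-- A word is live if some word equivalent to it begins with a relation word. -/
def Live (P : SemigroupPresentation A) (u : List A) : Prop :=
  ∃ R s, P.IsRelationWord R ∧ P.Equivalent u (R ++ s)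

theorem Live.congr {u v : List A} (h : P.Live u) (huv : P.Equivalent u v) : P.Live v := by
  obtain ⟨R, s, hR, h⟩ := h
  exact ⟨R, s, hR, huv.symm.trans h⟩

theorem live_append {R : List A} (hR : P.IsRelationWord R) (s : List A) : P.Live (R ++ s) :=
  ⟨R, s, hR, .refl _⟩

/-- Equivalent words after `suf Q` are equivalent after every relation word linked to `Q`. -/
theorem Linked.equivalent_append {R Q s t : List A} (h : P.Linked R Q)
    (hst : P.Equivalent (P.suf Q ++ s) (P.suf Q ++ t)) :
    P.Equivalent (R ++ s) (R ++ t) := by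
  have h1 := hst.append_left (P.stem Q)
  rw [← List.append_assoc, ← List.append_assoc, stem_append_suf] at h1
  exact (h.equivalent.append_right s).trans (h1.trans (h.equivalent.append_right t).symm)

/-- A replacement in a live word beginning with `stem R` does not touch this stem unless it
replaces an occurrence of `R` at the very beginning. -/
theorem SmallOverlap.oneStep_stem {R u' s w : List A} (h4 : P.SmallOverlap 4)
    (hR : P.IsRelationWord R) (hlive : P.Equivalent u' (P.suf R ++ s))
    (h : P.OneStep (P.stem R ++ u') w) :
    (∃ w', w = P.stem R ++ w' ∧ P.OneStep u' w') ∨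
    (∃ t Q, P.Adj R Q ∧ u' = P.suf R ++ t ∧ w = Q ++ t) := by
  obtain ⟨a, b, T, y, hT, -, hr, hu, rfl⟩ := h.exists_word
  rcases List.eq_nil_or_concat a with rfl | ⟨a₀, l, hal⟩
  · right
    simp only [List.nil_append] at hu ⊢
    have hRT : R = T := h4.head_unique hR hT (u := P.stem R ++ u') (List.prefix_append _ _)
      (by rw [hu]; exact (stem_prefix T).trans (List.prefix_append _ _))
    subst hRT
    refine ⟨b, y, hr, ?_, rfl⟩
    refine List.append_cancel_left (as := P.stem R) ?_
    rw [hu, ← List.append_assoc, stem_append_suf]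
  · have ha : a ≠ [] := by simp [hal]
    rcases eq_append_cases hu with ⟨a', rfl, rfl⟩ | ⟨o, f, ho, hxo, hTo, rfl⟩ | ⟨o, ho⟩
    · exact .inl ⟨a' ++ y ++ b, by simp, a', b, T, y, hr, rfl, rfl⟩
    · exact absurd hlive (h4.not_equivalent hR hT ha ho hxo hTo)
    · exact absurd (h4.eq_nil_of_append hR hT (b := o ++ P.suf R)
        (by simpa using eq_append_suf ho.symm)) ha

/-- Every word equivalent to a word beginning with a relation word begins with the stem of a linked
relation word, whose remainder can be restored by rewriting behind this stem. -/
theorem SmallOverlap.exists_stem {R s w : List A} (h4 : P.SmallOverlap 4)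
    (hR : P.IsRelationWord R) (h : P.Equivalent (R ++ s) w) :
    ∃ Q w' t, P.Linked R Q ∧ w = P.stem Q ++ w' ∧ P.Equivalent w' (P.suf Q ++ t) := by
  induction h with
  | refl => exact ⟨R, P.suf R ++ s, s, .refl _, by rw [← List.append_assoc, stem_append_suf],
      .refl _⟩
  | tail _ h ih =>
    obtain ⟨Q, w', t, hQ, rfl, hw'⟩ := ih
    rcases h4.oneStep_stem (hQ.isRelationWord hR) hw' h with ⟨w'', rfl, h'⟩ | ⟨t', Q', hadj, -, rfl⟩
    · exact ⟨Q, w'', t, hQ, rfl, h'.equivalent.symm.trans hw'⟩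
    · exact ⟨Q', P.suf Q' ++ t', t', Relation.ReflTransGen.tail hQ hadj,
        by rw [← List.append_assoc, stem_append_suf], .refl _⟩

theorem SmallOverlap.exists_stem_of_live {u : List A} (h4 : P.SmallOverlap 4) (h : P.Live u) :
    ∃ R u' s, P.IsRelationWord R ∧ u = P.stem R ++ u' ∧ P.Equivalent u' (P.suf R ++ s) := by
  obtain ⟨R, s, hR, h⟩ := h
  obtain ⟨Q, w', t, hQ, rfl, hw'⟩ := h4.exists_stem hR h.symm
  exact ⟨Q, w', t, hQ.isRelationWord hR, rfl, hw'⟩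

/-- The remainder of a relation word can be restored behind its stem in a live word. -/
theorem SmallOverlap.equivalent_of_live {R u' : List A} (h4 : P.SmallOverlap 4)
    (hR : P.IsRelationWord R) (h : P.Live (P.stem R ++ u')) :
    ∃ s, P.Equivalent u' (P.suf R ++ s) := by
  obtain ⟨Q, w', t, hQ, h1, h2⟩ := h4.exists_stem_of_live h
  have : R = Q := h4.head_unique hR hQ (u := P.stem R ++ u') (List.prefix_append _ _)
    (by rw [h1]; exact List.prefix_append _ _)
  subst this
  rw [List.append_cancel_left_eq] at h1
  exact ⟨t, h1 ▸ h2⟩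

/-- The first letter of a word which is not live takes no part in any derivation. -/
theorem Equivalent.cons_of_not_live {a : A} {u w : List A} (h : P.Equivalent (a :: u) w)
    (hu : ¬ P.Live (a :: u)) : ∃ u', w = a :: u' ∧ P.Equivalent u u' := by
  induction h with
  | refl => exact ⟨u, rfl, .refl _⟩
  | tail h₀ h ih =>
    obtain ⟨u', rfl, h'⟩ := ih
    obtain ⟨c, b, T, y, hT, -, hr, he, rfl⟩ := h.exists_word
    cases c with
    | nil => exact absurd ⟨T, b, hT, by rw [he] at h₀; exact h₀⟩ hu
    | cons c₀ c =>
      simp only [List.cons_append, List.cons.injEq] at he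
      obtain ⟨rfl, rfl⟩ := he
      exact ⟨c ++ y ++ b, by simp, h'.trans (OneStep.equivalent ⟨c, b, T, y, hr, rfl, rfl⟩)⟩

theorem Equivalent.eq_nil {w : List A} (h : P.Equivalent [] w) : w = [] := by
  induction h with
  | refl => rfl
  | tail _ h ih =>
    subst ih
    obtain ⟨c, b, T, y, hT, -, hr, he, rfl⟩ := h.exists_word
    have := hT.ne_nil
    simp at he
    exact absurd he.2.1 this

/-- Equivalent words which differ have a common prefix after which they are equivalent and
live. -/
theorem Equivalent.divergence {u v : List A} (h : P.Equivalent u v) :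
    u = v ∨ ∃ c u₁ v₁, u = c ++ u₁ ∧ v = c ++ v₁ ∧ P.Equivalent u₁ v₁ ∧ P.Live u₁ := by
  induction u generalizing v with
  | nil => exact .inl h.eq_nil.symm
  | cons a u ih =>
    by_cases hl : P.Live (a :: u)
    · exact .inr ⟨[], _, _, rfl, rfl, h, hl⟩
    · obtain ⟨v', rfl, h'⟩ := h.cons_of_not_live hl
      rcases ih h' with rfl | ⟨c, u₁, v₁, rfl, rfl, h1, h2⟩
      · exact .inl rfl
      · exact .inr ⟨a :: c, u₁, v₁, rfl, rfl, h1, h2⟩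

/-- Either the common prefix `z` can be cancelled, or a derivation involves a nonempty suffix `z₂`
of `z`. -/
theorem Equivalent.of_append {z s t : List A} (h : P.Equivalent (z ++ s) (z ++ t)) :
    P.Equivalent s t ∨ ∃ z₁ z₂, z = z₁ ++ z₂ ∧ z₂ ≠ [] ∧ P.Live (z₂ ++ s) ∧
      P.Equivalent (z₂ ++ s) (z₂ ++ t) := by
  rcases h.divergence with h | ⟨c, u₁, v₁, hu, hv, h1, h2⟩
  · rw [List.append_cancel_left_eq] at h
    exact .inl (h ▸ .refl _)
  · rw [List.append_eq_append_iff] at hu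
    rcases hu with ⟨c', rfl, rfl⟩ | ⟨z₂, rfl, rfl⟩
    · rw [List.append_assoc, List.append_cancel_left_eq] at hv
      exact .inl (hv ▸ h1.append_left c')
    · rw [List.append_assoc, List.append_cancel_left_eq] at hv
      subst hv
      by_cases hz : z₂ = []
      · subst hz
        exact .inl h1
      · exact .inr ⟨c, z₂, rfl, hz, h2, h1⟩

/-- A word `u` which is equivalent to `z ++ s` but does not begin with `z` begins with a proper
prefix of `z`, and the remaining suffix of `z` is live in front of `s`. -/
theorem Equivalent.of_not_prefix {u z s : List A} (h : P.Equivalent u (z ++ s))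
    (hz : ¬ z <+: u) : ∃ z₁ z₂ u', z = z₁ ++ z₂ ∧ z₂ ≠ [] ∧ u = z₁ ++ u' ∧
      P.Equivalent u' (z₂ ++ s) ∧ P.Live (z₂ ++ s) := by
  rcases h.divergence with rfl | ⟨c, u₁, v₁, rfl, hv, h1, h2⟩
  · exact absurd (List.prefix_append _ _) hz
  · rw [List.append_eq_append_iff] at hv
    rcases hv with ⟨c', rfl, rfl⟩ | ⟨z₂, rfl, rfl⟩
    · exact absurd ⟨c' ++ u₁, by simp⟩ hz
    · refine ⟨c, z₂, u₁, rfl, ?_, rfl, h1, h2.congr h1⟩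
      rintro rfl
      exact hz ⟨u₁, by simp⟩

/-- At most one piece `z` makes `z ++ s` live. -/
theorem SmallOverlap.live_unique {z z' s : List A} (h4 : P.SmallOverlap 4) (hz : P.IsPiece z)
    (hz' : P.IsPiece z') (h : P.Live (z ++ s)) (h' : P.Live (z' ++ s)) : z = z' := by
  obtain ⟨R, u, _, hR, hu, -⟩ := h4.exists_stem_of_live h
  obtain ⟨S, v, _, hS, hv, -⟩ := h4.exists_stem_of_live h'
  exact (h4.stem_unique (s := s) hR hS hz hz' ⟨u, hu.symm⟩ ⟨v, hv.symm⟩).2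

/-- `P.Join R s t`: the words `z ++ s` and `z ++ t` are equivalent for some suffix `z` of some
`suf Q`, where `Q` is linked to `R`. -/
def Join (P : SemigroupPresentation A) (R s t : List A) : Prop :=
  P.Equivalent s t ∨ ∃ z Q, P.Linked R Q ∧ z ≠ [] ∧ z <:+ P.suf Q ∧ P.Live (z ++ s) ∧
    P.Equivalent (z ++ s) (z ++ t)

theorem Linked.isPiece {R Q z : List A} (h : P.Linked R Q) (hR : P.IsRelationWord R)
    (hz : z <:+ P.suf Q) : P.IsPiece z :=
  (h.isRelationWord hR).isPiece_suf.of_infix hz.isInfix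

/-- The relation `P.Join R` absorbs a further change behind `suf Q`. The place at which this change
begins inside `suf Q` agrees with the place recorded in `P.Join R s t`. -/
theorem SmallOverlap.join_tail {R Q s t t' : List A} (h4 : P.SmallOverlap 4)
    (hR : P.IsRelationWord R) (h : P.Join R s t) (hQ : P.Linked R Q)
    (ht : P.Equivalent (P.suf Q ++ t) (P.suf Q ++ t')) : P.Join R s t' := by
  rcases ht.of_append with ht | ⟨z₁, z₂, hz, hne, hlive, ht⟩
  · rcases h with h | ⟨z, Q', hQ', hne, hz, hlive, h⟩
    · exact .inl (h.trans ht)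
    · exact .inr ⟨z, Q', hQ', hne, hz, hlive, h.trans (ht.append_left z)⟩
  · rcases h with h | ⟨z, Q', hQ', hne, hz', hlive', h⟩
    · have := h.append_left z₂
      exact .inr ⟨z₂, Q, hQ, hne, ⟨z₁, hz.symm⟩, hlive.congr this.symm, this.trans ht⟩
    · have : z = z₂ := h4.live_unique (hQ'.isPiece hR hz') (hQ.isPiece hR ⟨z₁, hz.symm⟩)
        (hlive'.congr h) hlive
      subst this
      exact .inr ⟨z, Q', hQ', hne, hz', hlive', h.trans ht⟩

/-- If `suf Q ++ s` is live from within `suf Q`, then this happens at a unique place. -/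
theorem SmallOverlap.join_of_live {R z Q s t : List A} (h4 : P.SmallOverlap 4)
    (hR : P.IsRelationWord R) (h : P.Join R s t) (hQ : P.Linked R Q) (hz : z <:+ P.suf Q)
    (hlive : P.Live (z ++ s)) : P.Equivalent (z ++ s) (z ++ t) := by
  rcases h with h | ⟨z', Q', hQ', -, hz', hlive', h⟩
  · exact h.append_left z
  · have := h4.live_unique (hQ'.isPiece hR hz') (hQ.isPiece hR hz) hlive' hlive
    subst this
    exact h

/-- The words equivalent to a live word beginning with `stem R`. -/
theorem SmallOverlap.equivalent_stem {R u' s₀ w : List A} (h4 : P.SmallOverlap 4)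
    (hR : P.IsRelationWord R) (hlive : P.Equivalent u' (P.suf R ++ s₀))
    (h : P.Equivalent (P.stem R ++ u') w) :
    ∃ Q w', P.Linked R Q ∧ w = P.stem Q ++ w' ∧
      ((R = Q ∧ P.Equivalent u' w') ∨
        ∃ s t, P.Equivalent u' (P.suf R ++ s) ∧ P.Equivalent w' (P.suf Q ++ t) ∧
          P.Join R s t) := by
  induction h with
  | refl => exact ⟨R, u', .refl _, rfl, .inl ⟨rfl, .refl _⟩⟩
  | tail _ h ih =>
    obtain ⟨Q, w', hQ, rfl, hw'⟩ := ih
    have hlive' : ∃ t, P.Equivalent w' (P.suf Q ++ t) := by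
      rcases hw' with ⟨rfl, hw'⟩ | ⟨s, t, -, h, -⟩
      · exact ⟨_, hw'.symm.trans hlive⟩
      · exact ⟨t, h⟩
    obtain ⟨t₀, ht₀⟩ := hlive'
    rcases h4.oneStep_stem (hQ.isRelationWord hR) ht₀ h with
      ⟨w'', rfl, h'⟩ | ⟨t', Q', hadj, rfl, rfl⟩
    · refine ⟨Q, w'', hQ, rfl, ?_⟩
      rcases hw' with ⟨rfl, hw'⟩ | ⟨s, t, h1, h2, h3⟩
      · exact .inl ⟨rfl, hw'.trans h'.equivalent⟩
      · exact .inr ⟨s, t, h1, h'.equivalent.symm.trans h2, h3⟩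
    · refine ⟨Q', P.suf Q' ++ t', Relation.ReflTransGen.tail hQ hadj,
        by rw [← List.append_assoc, stem_append_suf], .inr ?_⟩
      rcases hw' with ⟨rfl, hw'⟩ | ⟨s, t, h1, h2, h3⟩
      · exact ⟨t', t', hw', .refl _, .inl (.refl _)⟩
      · exact ⟨s, t', h1, .refl _, h4.join_tail hR h3 hQ h2.symm⟩

/-- The version of `SmallOverlap.equivalent_stem` for two given stems. -/
theorem SmallOverlap.equivalent_stems {R Q u' v' : List A} (h4 : P.SmallOverlap 4)
    (hR : P.IsRelationWord R) (hQ : P.IsRelationWord Q) (hlive : P.Live (P.stem R ++ u'))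
    (h : P.Equivalent (P.stem R ++ u') (P.stem Q ++ v')) :
    P.Linked R Q ∧ ((R = Q ∧ P.Equivalent u' v') ∨
        ∃ s t, P.Equivalent u' (P.suf R ++ s) ∧ P.Equivalent v' (P.suf Q ++ t) ∧
          P.Join R s t) := by
  obtain ⟨s₀, hs₀⟩ := h4.equivalent_of_live hR hlive
  obtain ⟨Q', w', hQ', he, h'⟩ := h4.equivalent_stem hR hs₀ h
  have : Q = Q' := h4.head_unique hQ (hQ'.isRelationWord hR) (u := P.stem Q ++ v')
    (List.prefix_append _ _) (by rw [he]; exact List.prefix_append _ _)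
  subst this
  rw [List.append_cancel_left_eq] at he
  subst he
  exact ⟨hQ', h'⟩

/-- A stem at the beginning of `c ++ u₁` and one at the beginning of the live word `u₁` cannot
overlap in a piece. -/
theorem SmallOverlap.eq_nil_of_live {R c u₁ : List A} (h4 : P.SmallOverlap 4)
    (hR : P.IsRelationWord R) (h : P.stem R <+: c ++ u₁) (hc : P.IsPiece c)
    (hlive : P.Live u₁) : c = [] := by
  obtain ⟨S, v, _, hS, hv, -⟩ := h4.exists_stem_of_live hlive
  exact (h4.stem_unique (z' := []) hR hS hc hR.isPiece_nil h
    (hv ▸ List.prefix_append _ _)).2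

/-- Equivalent words which begin with the stems of different relation words are live. -/
theorem SmallOverlap.live_of_stem_ne {R S u v : List A} (h4 : P.SmallOverlap 4)
    (hR : P.IsRelationWord R) (hS : P.IsRelationWord S) (hu : P.stem R <+: u)
    (hv : P.stem S <+: v) (hne : R ≠ S) (h : P.Equivalent u v) : P.Live u := by
  rcases h.divergence with rfl | ⟨c, u₁, v₁, rfl, rfl, h1, h2⟩
  · exact absurd (h4.head_unique hR hS hu hv) hne
  · suffices c = [] by subst this; exact h2
    refine h4.eq_nil_of_live hR hu ?_ h2
    rcases List.prefix_or_prefix_of_prefix hu (List.prefix_append _ _) with h' | ⟨x, h'⟩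
    · exact absurd (h4.head_unique hR hS (h'.trans (List.prefix_append _ _)) hv) hne
    rcases List.prefix_or_prefix_of_prefix hv (List.prefix_append _ _) with h'' | ⟨y, h''⟩
    · exact absurd (h4.head_unique hR hS hu (h''.trans (List.prefix_append _ _))) hne
    · exact isPiece_of_eq (a := []) (a' := []) (b := x ++ P.suf R) (b' := y ++ P.suf S) hR hS
        (by simpa using eq_append_suf h') (by simpa using eq_append_suf h'') (.inl hne)

/-- If one of two equivalent live words `stem R ++ u'`, `stem R ++ v'` does not begin with `R`,
then the stem can be cancelled. -/
theorem SmallOverlap.cancel_stem {R u' v' : List A} (h4 : P.SmallOverlap 4)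
    (hR : P.IsRelationWord R) (hlive : P.Live (P.stem R ++ u'))
    (h : P.Equivalent (P.stem R ++ u') (P.stem R ++ v')) (hne : ¬ P.suf R <+: u') :
    P.Equivalent u' v' := by
  obtain ⟨-, ⟨-, h'⟩ | ⟨s, t, h1, h2, h3⟩⟩ := h4.equivalent_stems hR hR hlive h
  · exact h'
  · obtain ⟨z₁, z₂, u'', hz, hz₂, rfl, h5, h6⟩ := h1.of_not_prefix hne
    have := h4.join_of_live hR h3 (.refl R) ⟨z₁, hz.symm⟩ h6
    have := this.append_left z₁
    rw [← List.append_assoc, ← List.append_assoc, ← hz] at this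
    exact h1.trans (this.trans h2.symm)

end SemigroupPresentation

namespace SemigroupPresentation

/-! ### Residual questions -/

variable {A : Type*} {P : SemigroupPresentation A}

theorem SmallOverlap.join_trans {R s t t' : List A} (h4 : P.SmallOverlap 4)
    (hR : P.IsRelationWord R) (h : P.Join R s t) (h' : P.Join R t t') : P.Join R s t' := by
  rcases h' with h' | ⟨z, Q, hQ, -, ⟨y, hy⟩, -, h'⟩
  · exact h4.join_tail hR h (.refl R) (h'.append_left _)
  · refine h4.join_tail hR h hQ ?_
    rw [← hy, List.append_assoc, List.append_assoc]
    exact h'.append_left y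

/-- `P.Residual u v p`: the words `u` and `v` are equivalent, and some word equivalent to them
begins with `p`. The condition on `p` records that a stem which has already been removed is to be
completed to a relation word. -/
def Residual (P : SemigroupPresentation A) (u v p : List A) : Prop :=
  P.Equivalent u v ∧ ∃ w, P.Equivalent u (p ++ w)

theorem Residual.symm {u v p : List A} (h : P.Residual u v p) : P.Residual v u p :=
  ⟨h.1.symm, h.2.imp fun _ h' => h.1.symm.trans h'⟩

theorem residual_nil {u v : List A} : P.Residual u v [] ↔ P.Equivalent u v :=
  ⟨fun h => h.1, fun h => ⟨h, u, .refl _⟩⟩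

/-- If `u` is not live, then its first letter is fixed by all derivations and can be removed. -/
theorem residual_cancel_of_not_live {u v p : List A} (hu : u ≠ []) (h : ¬ P.Live u) :
    P.Residual u v p ↔ u.head? = v.head? ∧ (p = [] ∨ p.head? = u.head?) ∧
      P.Residual u.tail v.tail p.tail := by
  obtain ⟨a, u, rfl⟩ := List.exists_cons_of_ne_nil hu
  constructor
  · rintro ⟨h1, w, h2⟩
    obtain ⟨v, rfl, h3⟩ := h1.cons_of_not_live h
    obtain ⟨u', he, h4⟩ := h2.cons_of_not_live h
    refine ⟨rfl, ?_, h3, ?_⟩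
    · cases p with
      | nil => exact .inl rfl
      | cons b p => simp at he; simp [he.1]
    · cases p with
      | nil => exact ⟨u, .refl _⟩
      | cons b p => simp at he; obtain ⟨rfl, rfl⟩ := he; exact ⟨w, h4⟩
  · rintro ⟨h1, h2, h3, w, h4⟩
    cases v with
    | nil => simp at h1
    | cons b v =>
      simp only [List.head?_cons, Option.some.injEq] at h1
      subst h1
      refine ⟨h3.append_left [a], ?_⟩
      rcases h2 with rfl | h2
      · exact ⟨a :: u, .refl _⟩
      · cases p with
        | nil => simp at h2
        | cons b p =>
          simp only [List.head?_cons, Option.some.injEq] at h2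
          subst h2
          exact ⟨w, h4.append_left [b]⟩

theorem residual_cancel_of_not_live_right {u v p : List A} (hu : v ≠ []) (h : ¬ P.Live v) :
    P.Residual u v p ↔ u.head? = v.head? ∧ (p = [] ∨ p.head? = u.head?) ∧
      P.Residual u.tail v.tail p.tail := by
  have h1 : ∀ u v p, P.Residual u v p ↔ P.Residual v u p := fun u v p =>
    ⟨Residual.symm, Residual.symm⟩
  rw [h1, residual_cancel_of_not_live hu h, h1 u.tail]
  constructor
  · rintro ⟨h1, h2, h3⟩; exact ⟨h1.symm, h1 ▸ h2, h3⟩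
  · rintro ⟨h1, h2, h3⟩; exact ⟨h1.symm, h1 ▸ h2, h3⟩

/-- The word `p` is a prefix of a relation word linked to `R`. -/
def LinkedPrefix (P : SemigroupPresentation A) (R p : List A) : Prop :=
  ∃ Q, P.Linked R Q ∧ p <+: Q

theorem LinkedPrefix.exists_equivalent {R p s : List A} (h : P.LinkedPrefix R p) :
    ∃ w, P.Equivalent (R ++ s) (p ++ w) := by
  obtain ⟨Q, hQ, x, rfl⟩ := h
  exact ⟨x ++ s, by simpa using hQ.equivalent.append_right s⟩

/-- A piece with which some word equivalent to the live word `stem R ++ u'` begins is a prefix of a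
relation word linked to `R`. -/
theorem SmallOverlap.linkedPrefix {R p u' w : List A} (h4 : P.SmallOverlap 4)
    (hR : P.IsRelationWord R) (hp : P.IsPiece p) (hlive : P.Live (P.stem R ++ u'))
    (h : P.Equivalent (P.stem R ++ u') (p ++ w)) : P.LinkedPrefix R p := by
  obtain ⟨s, hs⟩ := h4.equivalent_of_live hR hlive
  obtain ⟨Q, w', hQ, he, -⟩ := h4.equivalent_stem hR hs h
  exact ⟨Q, hQ, (h4.prefix_stem (u := p ++ w) (hQ.isRelationWord hR) hp ⟨w', he.symm⟩
    (List.prefix_append _ _)).trans (stem_prefix Q)⟩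

/-- The word `u` begins with the stem of a relation word. -/
def HasStem (P : SemigroupPresentation A) (u : List A) : Prop :=
  ∃ R, P.IsRelationWord R ∧ P.stem R <+: u

theorem SmallOverlap.hasStem {u : List A} (h4 : P.SmallOverlap 4) (h : P.Live u) :
    P.HasStem u := by
  obtain ⟨R, u', -, hR, h, -⟩ := h4.exists_stem_of_live h
  exact ⟨R, hR, u', h.symm⟩

/-- The word `z` is the nonempty suffix of some `suf Q`, with `Q` linked to `R`, for which
`z ++ s` begins with a stem, or it is empty if there is no such suffix. -/
def IsActive (P : SemigroupPresentation A) (R s z : List A) : Prop :=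
  (z = [] ∧ ∀ y Q, P.Linked R Q → y ≠ [] → y <:+ P.suf Q → ¬ P.HasStem (y ++ s)) ∨
  ∃ Q, P.Linked R Q ∧ z ≠ [] ∧ z <:+ P.suf Q ∧ P.HasStem (z ++ s)

/-- The active suffix `z` turns the disjunction in `P.Join R s t` into a single equivalence. -/
theorem SmallOverlap.equivalent_of_join {R s t z : List A} (h4 : P.SmallOverlap 4)
    (hR : P.IsRelationWord R) (hz : P.IsActive R s z) (h : P.Join R s t) :
    P.Equivalent (z ++ s) (z ++ t) := by
  rcases h with h | ⟨y, Q, hQ, hne, hy, hlive, h⟩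
  · exact h.append_left z
  rcases hz with ⟨rfl, hz⟩ | ⟨Q', hQ', -, hz', S, hS, hz⟩
  · exact absurd (h4.hasStem hlive) (hz y Q hQ hne hy)
  · obtain ⟨T, hT, hT'⟩ := h4.hasStem hlive
    have := (h4.stem_unique hS hT (hQ'.isPiece hR hz') (hQ.isPiece hR hy) hz hT').2
    subst this
    exact h

/-- Both words begin with complete relation words. -/
theorem SmallOverlap.residual_full {R S s t p z : List A} (h4 : P.SmallOverlap 4)
    (hR : P.IsRelationWord R) (hS : P.IsRelationWord S) (hp : P.IsPiece p)
    (hz : P.IsActive R s z) :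
    P.Residual (R ++ s) (S ++ t) p ↔
      P.Linked R S ∧ P.LinkedPrefix R p ∧ P.Residual (z ++ s) (z ++ t) [] := by
  rw [residual_nil]
  have eR : R ++ s = P.stem R ++ (P.suf R ++ s) := by rw [← List.append_assoc, stem_append_suf]
  have eS : S ++ t = P.stem S ++ (P.suf S ++ t) := by rw [← List.append_assoc, stem_append_suf]
  constructor
  · rintro ⟨h1, w, h2⟩
    have hlive := live_append hR s
    rw [eR] at h1 h2 hlive
    rw [eS] at h1
    obtain ⟨hRS, h3⟩ := h4.equivalent_stems hR hS hlive h1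
    refine ⟨hRS, h4.linkedPrefix hR hp hlive h2, h4.equivalent_of_join hR hz ?_⟩
    rcases h3 with ⟨rfl, h3⟩ | ⟨s', t', h5, h6, h7⟩
    · exact h4.join_tail hR (.inl (.refl s)) (.refl R) h3
    · exact h4.join_tail hR (h4.join_trans hR
        (h4.join_tail hR (.inl (.refl s)) (.refl R) h5) h7) hRS h6.symm
  · rintro ⟨hRS, h1, h2⟩
    refine ⟨?_, h1.exists_equivalent⟩
    have h3 : P.Equivalent (R ++ s) (R ++ t) := by
      rcases hz with ⟨rfl, -⟩ | ⟨Q, hQ, -, ⟨y, hy⟩, -⟩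
      · exact h2.append_left R
      · refine hQ.equivalent_append ?_
        rw [← hy, List.append_assoc, List.append_assoc]
        exact h2.append_left y
    exact h3.trans (hRS.equivalent.append_right t)

/-- The first word begins with a relation word `R`, the second one only with a stem. -/
theorem SmallOverlap.residual_left {R S s v' p : List A} (h4 : P.SmallOverlap 4)
    (hR : P.IsRelationWord R) (hS : P.IsRelationWord S) (hp : P.IsPiece p)
    (hv : ¬ P.suf S <+: v') :
    P.Residual (R ++ s) (P.stem S ++ v') p ↔
      P.Linked R S ∧ P.LinkedPrefix R p ∧ P.Residual (P.suf S ++ s) v' [] := by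
  rw [residual_nil]
  have eR : R ++ s = P.stem R ++ (P.suf R ++ s) := by rw [← List.append_assoc, stem_append_suf]
  have eS : S ++ s = P.stem S ++ (P.suf S ++ s) := by rw [← List.append_assoc, stem_append_suf]
  constructor
  · rintro ⟨h1, w, h2⟩
    have hlive := live_append hR s
    have hlive' := hlive.congr h1
    rw [eR] at hlive h2
    have hRS := (h4.equivalent_stems hR hS hlive (eR ▸ h1)).1
    refine ⟨hRS, h4.linkedPrefix hR hp hlive h2, (h4.cancel_stem hS hlive' ?_ hv).symm⟩
    rw [← eS]
    exact h1.symm.trans (hRS.equivalent.append_right s)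
  · rintro ⟨hRS, h1, h2⟩
    refine ⟨(hRS.equivalent.append_right s).trans ?_, h1.exists_equivalent⟩
    rw [eS]
    exact h2.append_left _

/-- In a word which begins with a stem but is not live, no derivation changes a piece at the
beginning. -/
theorem SmallOverlap.prefix_of_not_live {R u p w : List A} (h4 : P.SmallOverlap 4)
    (hR : P.IsRelationWord R) (hu : P.stem R <+: u) (hp : P.IsPiece p)
    (h : P.Equivalent u (p ++ w)) (hlive : ¬ P.Live u) : p <+: u := by
  rcases h.divergence with rfl | ⟨c, u₁, v₁, rfl, he, h1, h2⟩
  · exact List.prefix_append _ _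
  · rcases List.prefix_or_prefix_of_prefix (List.prefix_append p w) ⟨v₁, he.symm⟩ with h' | h'
    · exact h'.trans (List.prefix_append _ _)
    · have := h4.eq_nil_of_live hR hu (hp.of_infix h'.isInfix) h2
      subst this
      exact absurd h2 hlive

/-- Neither word begins with a relation word, but both begin with stems. Here `z` is the longest
common suffix of `suf R = x ++ z` and `suf S = y ++ z`. -/
theorem SmallOverlap.residual_stems {R S u' v' p x y z : List A} (h4 : P.SmallOverlap 4)
    (hR : P.IsRelationWord R) (hS : P.IsRelationWord S) (hp : P.IsPiece p)
    (hu : ¬ P.suf R <+: u') (hv : ¬ P.suf S <+: v')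
    (hne : R ≠ S ∨ ¬ p <+: P.stem R ++ u')
    (hx : P.suf R = x ++ z) (hy : P.suf S = y ++ z)
    (hz : ∀ z', z' <:+ P.suf R → z' <:+ P.suf S → z' <:+ z) :
    P.Residual (P.stem R ++ u') (P.stem S ++ v') p ↔
      P.Linked R S ∧ P.LinkedPrefix R p ∧
        ∃ u'' v'', u' = x ++ u'' ∧ v' = y ++ v'' ∧ P.Residual u'' v'' z := by
  constructor
  · rintro ⟨h1, w, h2⟩
    have hlive : P.Live (P.stem R ++ u') := by
      by_cases h : R = S
      · by_contra hl
        exact (hne.resolve_left (not_not.2 h))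
          (h4.prefix_of_not_live hR (List.prefix_append _ _) hp h2 hl)
      · exact h4.live_of_stem_ne hR hS (List.prefix_append _ _) (List.prefix_append _ _) h h1
    obtain ⟨hRS, h3⟩ := h4.equivalent_stems hR hS hlive h1
    refine ⟨hRS, h4.linkedPrefix hR hp hlive h2, ?_⟩
    rcases h3 with ⟨rfl, h3⟩ | ⟨s, t, h5, h6, h7⟩
    · have hzR : z = P.suf R := List.IsSuffix.eq_of_length_le ⟨x, hx.symm⟩
        (hz _ List.suffix_rfl List.suffix_rfl).length_le
      subst hzR
      have hx' : x = [] := by simpa using hx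
      have hy' : y = [] := by simpa using hy
      subst hx' hy'
      exact ⟨u', v', rfl, rfl, h3, h4.equivalent_of_live hR hlive⟩
    · obtain ⟨a₁, a₂, u₁, ha, -, rfl, h8, h9⟩ := h5.of_not_prefix hu
      obtain ⟨b₁, b₂, v₁, hb, -, rfl, h10, h11⟩ := h6.of_not_prefix hv
      have h12 := h4.join_of_live hR h7 (.refl R) ⟨a₁, ha.symm⟩ h9
      have : a₂ = b₂ := h4.live_unique ((Linked.refl R).isPiece hR ⟨a₁, ha.symm⟩)
        (hRS.isPiece hR ⟨b₁, hb.symm⟩) (h9.congr h12) h11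
      subst this
      obtain ⟨c, rfl⟩ := hz a₂ ⟨a₁, ha.symm⟩ ⟨b₁, hb.symm⟩
      rw [ha, ← List.append_assoc, List.append_left_inj] at hx
      rw [hb, ← List.append_assoc, List.append_left_inj] at hy
      subst hx hy
      refine ⟨c ++ u₁, c ++ v₁, by simp, by simp, ?_, s, ?_⟩
      · exact (h8.trans (h12.trans h10.symm)).append_left c
      · simpa using h8.append_left c
  · rintro ⟨hRS, h1, u'', v'', rfl, rfl, h2, s, h3⟩
    have hu'' : P.Equivalent (P.stem R ++ (x ++ u'')) (R ++ s) := by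
      have := h3.append_left (P.stem R ++ x)
      rwa [← List.append_assoc (P.stem R ++ x), List.append_assoc _ x z, ← hx,
        stem_append_suf, List.append_assoc] at this
    have hv'' : P.Equivalent (P.stem S ++ (y ++ v'')) (S ++ s) := by
      have := (h2.symm.trans h3).append_left (P.stem S ++ y)
      rwa [← List.append_assoc (P.stem S ++ y), List.append_assoc _ y z, ← hy,
        stem_append_suf, List.append_assoc] at this
    obtain ⟨w, hw⟩ := h1.exists_equivalent (s := s)
    exact ⟨hu''.trans ((hRS.equivalent.append_right s).trans hv''.symm), w, hu''.trans hw⟩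

/-- Both words begin with the stem of the same relation word `R`, but not with `R`. -/
theorem SmallOverlap.residual_same {R u' v' p : List A} (h4 : P.SmallOverlap 4)
    (hR : P.IsRelationWord R) (hu : ¬ P.suf R <+: u')
    (hp : p <+: P.stem R ++ u') :
    P.Residual (P.stem R ++ u') (P.stem R ++ v') p ↔
      (P.stem R ++ u').head? = (P.stem R ++ v').head? ∧
      (p = [] ∨ p.head? = (P.stem R ++ u').head?) ∧
      P.Residual (P.stem R ++ u').tail (P.stem R ++ v').tail p.tail := by
  obtain ⟨a, x, hx⟩ : ∃ a x, P.stem R = a :: x := List.exists_cons_of_ne_nil fun h =>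
    h4.not_isPiece_stem hR (h ▸ hR.isPiece_nil)
  by_cases hlive : P.Live (P.stem R ++ u')
  · have hp' : ∃ q, x ++ u' = p.tail ++ q := by
      obtain ⟨q, hq⟩ := hp
      cases p with
      | nil => exact ⟨x ++ u', rfl⟩
      | cons b p => rw [hx] at hq; simp at hq; exact ⟨q, hq.2.symm⟩
    obtain ⟨q, hq⟩ := hp'
    constructor
    · rintro ⟨h1, -⟩
      have h2 := h4.cancel_stem hR hlive h1 hu
      refine ⟨by simp [hx], ?_, ?_⟩
      · obtain ⟨q, hq⟩ := hp
        cases p with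
        | nil => exact .inl rfl
        | cons b p => rw [← hq]; simp
      · rw [hx]
        exact ⟨h2.append_left x, q, by simp only [List.cons_append, List.tail_cons, hq]; exact .refl _⟩
    · rintro ⟨-, -, h, -⟩
      rw [hx] at h ⊢
      obtain ⟨q', hq'⟩ := hp
      exact ⟨h.append_left [a], q', by rw [hq', hx]; exact .refl _⟩
  · exact residual_cancel_of_not_live (by simp [hx]) hlive

end SemigroupPresentation

namespace SemigroupPresentation

variable {A : Type*} {P : SemigroupPresentation A} {W : List (List A)}

/-! ### The reduction step -/

theorem find?_congr_of_mem {B : Type*} {l : List B} {p q : B → Bool} (h : ∀ a ∈ l, p a = q a) :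
    l.find? p = l.find? q := by
  rw [← List.head?_filter, ← List.head?_filter, List.filter_congr h]

open Classical in
/-- A relation word whose stem is a prefix of `u`, taken from the list `W`. -/
noncomputable def headWord (P : SemigroupPresentation A) (W : List (List A)) (u : List A) :
    Option (List A) :=
  W.find? fun R => P.stem R <+: u

open Classical in
/-- All nonempty suffixes of the words `suf Q` with `Q` linked to `R`. -/
noncomputable def linkedSuffixes (P : SemigroupPresentation A) (W : List (List A)) (R : List A) :
    List (List A) :=
  (W.filter fun Q => P.Linked R Q).flatMap fun Q =>
    (List.range (P.suf Q).length).map fun i => (P.suf Q).drop i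

/-- The word `z` for which `P.IsActive R s z` holds. It is `[]`, the default value, if no member of
`linkedSuffixes` is found. -/
noncomputable def activeSuffix (P : SemigroupPresentation A) (W : List (List A)) (R s : List A) :
    List A :=
  ((P.linkedSuffixes W R).find? fun z => (P.headWord W (z ++ s)).isSome).getD []

/-- The longest common suffix of two words. -/
noncomputable def commonSuffix (x y : List A) : List A :=
  longestSuffix (· <:+ y) x

open Classical in
/-- Removal of the first letters of `u`, `v` and `p`, if they agree. -/
noncomputable def cancelStep (u v p : List A) : Option (List A × List A × List A) :=
  if u.head? = v.head? ∧ (p = [] ∨ p.head? = u.head?) then some (u.tail, v.tail, p.tail) else none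

open Classical in
/-- The reduction step for words `u` and `v` which begin with the stems of `R` and `S`. -/
noncomputable def stemStep (P : SemigroupPresentation A) (W : List (List A))
    (R S u v p : List A) : Option (List A × List A × List A) :=
  if ¬ R <+: u ∧ ¬ S <+: v ∧ R = S ∧ p <+: u then cancelStep u v p
  else if P.Linked R S ∧ P.LinkedPrefix R p then
    if R <+: u then
      if S <+: v then
        some (P.activeSuffix W R (u.drop R.length) ++ u.drop R.length,
          P.activeSuffix W R (u.drop R.length) ++ v.drop S.length, [])
      else some (P.suf S ++ u.drop R.length, v.drop (P.stem S).length, [])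
    else if S <+: v then some (u.drop (P.stem R).length, P.suf R ++ v.drop S.length, [])
    else if R.take (R.length - (commonSuffix (P.suf R) (P.suf S)).length) <+: u ∧
        S.take (S.length - (commonSuffix (P.suf R) (P.suf S)).length) <+: v then
      some (u.drop (R.length - (commonSuffix (P.suf R) (P.suf S)).length),
        v.drop (S.length - (commonSuffix (P.suf R) (P.suf S)).length),
        commonSuffix (P.suf R) (P.suf S))
    else none
  else none

/-- The reduction step: it replaces a question `P.Residual u v p` by an equivalent one about
shorter words, or answers it in the negative. -/
noncomputable def reduceStep (P : SemigroupPresentation A) (W : List (List A))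
    (q : List A × List A × List A) : Option (List A × List A × List A) :=
  ((P.headWord W q.1).bind fun R => (P.headWord W q.2.1).map fun S => (R, S)).elim
    (cancelStep q.1 q.2.1 q.2.2) fun RS => P.stemStep W RS.1 RS.2 q.1 q.2.1 q.2.2

theorem headWord_eq_some {u R : List A} (hW : ∀ w, w ∈ W ↔ P.IsRelationWord w)
    (h : P.headWord W u = some R) : P.IsRelationWord R ∧ P.stem R <+: u := by
  refine ⟨(hW R).1 (List.mem_of_find?_eq_some h), ?_⟩
  simpa using List.find?_some h

theorem headWord_isSome {u : List A} (hW : ∀ w, w ∈ W ↔ P.IsRelationWord w) :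
    (P.headWord W u).isSome ↔ P.HasStem u := by
  simp [headWord, HasStem, hW]

theorem mem_linkedSuffixes {R z : List A} (hW : ∀ w, w ∈ W ↔ P.IsRelationWord w)
    (hR : P.IsRelationWord R) :
    z ∈ P.linkedSuffixes W R ↔ ∃ Q, P.Linked R Q ∧ z ≠ [] ∧ z <:+ P.suf Q := by
  simp only [linkedSuffixes, List.mem_flatMap, List.mem_filter, decide_eq_true_eq, List.mem_map,
    List.mem_range]
  constructor
  · rintro ⟨Q, ⟨-, hQ⟩, i, hi, rfl⟩
    exact ⟨Q, hQ, by simpa using hi, List.drop_suffix _ _⟩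
  · rintro ⟨Q, hQ, hz, y, hy⟩
    refine ⟨Q, ⟨(hW Q).2 (hQ.isRelationWord hR), hQ⟩, y.length, ?_, ?_⟩
    · rw [← hy, List.length_append]
      have := List.length_pos_of_ne_nil hz
      omega
    · rw [← hy, List.drop_left]

theorem isActive_activeSuffix {R : List A} (hW : ∀ w, w ∈ W ↔ P.IsRelationWord w)
    (hR : P.IsRelationWord R) (s : List A) : P.IsActive R s (P.activeSuffix W R s) := by
  unfold activeSuffix
  cases h : (P.linkedSuffixes W R).find? fun z => (P.headWord W (z ++ s)).isSome with
  | none =>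
    left
    rw [List.find?_eq_none] at h
    refine ⟨rfl, fun y Q hQ hne hy hs => ?_⟩
    exact h y ((mem_linkedSuffixes hW hR).2 ⟨Q, hQ, hne, hy⟩) ((headWord_isSome hW).2 hs)
  | some z =>
    right
    obtain ⟨Q, hQ, hne, hz⟩ := (mem_linkedSuffixes hW hR).1 (List.mem_of_find?_eq_some h)
    exact ⟨Q, hQ, hne, hz, (headWord_isSome hW).1
      (List.find?_some (p := fun z => (P.headWord W (z ++ s)).isSome) h)⟩

theorem isPiece_activeSuffix {R : List A} (hW : ∀ w, w ∈ W ↔ P.IsRelationWord w)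
    (hR : P.IsRelationWord R) (s : List A) : P.IsPiece (P.activeSuffix W R s) := by
  rcases isActive_activeSuffix hW hR s with ⟨h, -⟩ | ⟨Q, hQ, -, hz, -⟩
  · rw [h]; exact hR.isPiece_nil
  · exact hQ.isPiece hR hz

theorem commonSuffix_left (x y : List A) : commonSuffix x y <:+ x := longestSuffix_suffix _ _

theorem commonSuffix_right (x y : List A) : commonSuffix x y <:+ y :=
  longestSuffix_spec (p := (· <:+ y)) x List.nil_suffix

theorem suffix_commonSuffix {x y z : List A} (hx : z <:+ x) (hy : z <:+ y) :
    z <:+ commonSuffix x y :=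
  List.suffix_of_suffix_length_le hx (commonSuffix_left x y)
    (length_le_longestSuffix (p := (· <:+ y)) hy hx)

theorem Linked.linkedPrefix_iff {R S p : List A} (h : P.Linked R S) :
    P.LinkedPrefix R p ↔ P.LinkedPrefix S p :=
  ⟨fun ⟨Q, hQ, hp⟩ => ⟨Q, h.symm.trans hQ, hp⟩, fun ⟨Q, hQ, hp⟩ => ⟨Q, h.trans hQ, hp⟩⟩

theorem take_sub_length {R x z : List A} (h : P.suf R = x ++ z) :
    R.take (R.length - z.length) = P.stem R ++ x := by
  have : R = P.stem R ++ x ++ z := by rw [List.append_assoc, ← h, stem_append_suf]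
  conv_lhs => rw [this]
  rw [List.take_left']
  have := congrArg List.length this
  simp only [List.length_append] at this ⊢
  omega

theorem suf_prefix_iff {R u' : List A} : P.suf R <+: u' ↔ R <+: P.stem R ++ u' := by
  rw [← List.prefix_append_right_inj (P.stem R), stem_append_suf]

theorem residual_cancelStep {u v p : List A}
    (h : P.Residual u v p ↔ u.head? = v.head? ∧ (p = [] ∨ p.head? = u.head?) ∧
      P.Residual u.tail v.tail p.tail) :
    P.Residual u v p ↔ ∃ q, cancelStep u v p = some q ∧ P.Residual q.1 q.2.1 q.2.2 := by
  rw [h, ← and_assoc, cancelStep]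
  split_ifs with hc
  · rw [and_iff_right hc]
    simp only [Option.some.injEq, exists_eq_left']
  · simp only [hc, false_and, exists_false]

/-- The step `stemStep` is correct: each branch of its definition is one of the cases
`residual_same`, `residual_full`, `residual_left` and `residual_stems`. -/
theorem SmallOverlap.residual_stemStep {R S u v p : List A} (h4 : P.SmallOverlap 4)
    (hW : ∀ w, w ∈ W ↔ P.IsRelationWord w) (hR : P.IsRelationWord R)
    (hS : P.IsRelationWord S) (hu : P.stem R <+: u) (hv : P.stem S <+: v) (hp : P.IsPiece p) :
    P.Residual u v p ↔
      ∃ q, P.stemStep W R S u v p = some q ∧ P.Residual q.1 q.2.1 q.2.2 := by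
  obtain ⟨u', rfl⟩ := hu
  obtain ⟨v', rfl⟩ := hv
  unfold stemStep
  have hstems (h1 : ¬ R <+: P.stem R ++ u') (h2 : ¬ S <+: P.stem S ++ v')
      (h3 : ¬ (¬ R <+: P.stem R ++ u' ∧ ¬ S <+: P.stem S ++ v' ∧ R = S ∧
        p <+: P.stem R ++ u')) :
      P.Residual (P.stem R ++ u') (P.stem S ++ v') p ↔ P.Linked R S ∧ P.LinkedPrefix R p ∧
        ∃ u'' v'', P.stem R ++ u' = R.take (R.length -
            (commonSuffix (P.suf R) (P.suf S)).length) ++ u'' ∧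
          P.stem S ++ v' = S.take (S.length -
            (commonSuffix (P.suf R) (P.suf S)).length) ++ v'' ∧
          P.Residual u'' v'' (commonSuffix (P.suf R) (P.suf S)) := by
    have hne : R ≠ S ∨ ¬ p <+: P.stem R ++ u' := by
      by_contra hc
      push Not at hc
      exact h3 ⟨h1, h2, hc⟩
    obtain ⟨x, hx⟩ := commonSuffix_left (P.suf R) (P.suf S)
    obtain ⟨y, hy⟩ := commonSuffix_right (P.suf R) (P.suf S)
    rw [h4.residual_stems hR hS hp (by rwa [suf_prefix_iff]) (by rwa [suf_prefix_iff])
      hne hx.symm hy.symm (fun _ => suffix_commonSuffix), take_sub_length hx.symm,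
      take_sub_length hy.symm]
    simp only [List.append_assoc, List.append_cancel_left_eq]
  split_ifs with h1 h2 h3 h5 h6 h7
  · obtain ⟨h1, h2, rfl, h3⟩ := h1
    exact residual_cancelStep (h4.residual_same hR (by rwa [suf_prefix_iff]) h3)
  · obtain ⟨s, hs⟩ := h3
    obtain ⟨t, ht⟩ := h5
    rw [← hs, ← ht, h4.residual_full hR hS hp (isActive_activeSuffix hW hR s)]
    simp [h2.1, h2.2]
  · obtain ⟨s, hs⟩ := h3
    rw [← hs, h4.residual_left hR hS hp (by rwa [suf_prefix_iff])]
    simp [h2.1, h2.2]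
  · obtain ⟨t, ht⟩ := h6
    have hsymm : ∀ u v p, P.Residual u v p ↔ P.Residual v u p := fun u v p =>
      ⟨Residual.symm, Residual.symm⟩
    rw [← ht, hsymm, h4.residual_left hS hR hp (by rwa [suf_prefix_iff]), hsymm]
    simp [h2.1.symm, h2.1.linkedPrefix_iff.1 h2.2]
  · obtain ⟨⟨u'', hu⟩, v'', hv⟩ := h7
    have hlR : (R.take (R.length - (commonSuffix (P.suf R) (P.suf S)).length)).length =
      R.length - (commonSuffix (P.suf R) (P.suf S)).length := by simp
    have hlS : (S.take (S.length - (commonSuffix (P.suf R) (P.suf S)).length)).length =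
      S.length - (commonSuffix (P.suf R) (P.suf S)).length := by simp
    rw [hstems h3 h6 h1, ← hu, ← hv, List.drop_left' hlR, List.drop_left' hlS]
    simp [h2.1, h2.2]
  · rw [hstems h3 h6 h1]
    simp only [false_and, exists_false, iff_false]
    rintro ⟨-, -, u'', v'', hu, hv, -⟩
    exact h7 ⟨⟨u'', hu.symm⟩, v'', hv.symm⟩
  · -- the relation words are not linked, or the prefix `p` cannot be reached
    simp only [false_and, exists_false, iff_false]
    intro hres
    apply h2
    by_cases hRu : R <+: P.stem R ++ u'
    · obtain ⟨s, hs⟩ := hRu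
      have hlive := live_append hR s
      rw [hs] at hlive
      exact ⟨(h4.equivalent_stems hR hS hlive hres.1).1, h4.linkedPrefix hR hp hlive
        hres.2.choose_spec⟩
    · by_cases hSv : S <+: P.stem S ++ v'
      · obtain ⟨s, hs⟩ := hSv
        have hlive := live_append hS s
        rw [hs] at hlive
        have hlive := hlive.congr hres.1.symm
        exact ⟨(h4.equivalent_stems hR hS hlive hres.1).1, h4.linkedPrefix hR hp hlive
          hres.2.choose_spec⟩
      · have := (hstems hRu hSv h1).1 hres
        exact ⟨this.1, this.2.1⟩

/-- The reduction step is correct. -/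
theorem SmallOverlap.residual_reduceStep {u v p : List A} (h4 : P.SmallOverlap 4)
    (hW : ∀ w, w ∈ W ↔ P.IsRelationWord w) (hu : u ≠ []) (hp : p = [] ∨ P.IsPiece p) :
    P.Residual u v p ↔
      ∃ q, P.reduceStep W (u, v, p) = some q ∧ P.Residual q.1 q.2.1 q.2.2 := by
  unfold reduceStep
  dsimp only
  cases hR : P.headWord W u with
  | none =>
    refine residual_cancelStep (residual_cancel_of_not_live hu fun h => ?_)
    have := (headWord_isSome hW).2 (h4.hasStem h)
    simp [hR] at this
  | some R =>
    cases hS : P.headWord W v with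
    | none =>
      by_cases hv : v = []
      · subst hv
        simp only [Option.bind_some, Option.map_none, Option.elim_none, cancelStep]
        rw [if_neg (by simp [hu])]
        simp only [reduceCtorEq, false_and, exists_false, iff_false]
        exact fun h => hu h.1.symm.eq_nil
      · refine residual_cancelStep (residual_cancel_of_not_live_right hv fun h => ?_)
        have := (headWord_isSome hW).2 (h4.hasStem h)
        simp [hS] at this
    | some S =>
      obtain ⟨h1, h2⟩ := headWord_eq_some hW hR
      obtain ⟨h3, h5⟩ := headWord_eq_some hW hS
      refine h4.residual_stemStep hW h1 h3 h2 h5 (hp.elim (fun h => ?_) id)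
      rw [h]; exact h1.isPiece_nil

end SemigroupPresentation

namespace SemigroupPresentation

variable {A : Type*} {P : SemigroupPresentation A} {W : List (List A)}

/-! ### Locality and termination of the reduction step -/

/-- The word `u` determines which words of length at most `N` are prefixes of `u ++ s`. -/
def Determines (N : ℕ) (u s : List A) : Prop :=
  ∀ w : List A, w.length ≤ N → (w <+: u ++ s ↔ w <+: u)

theorem Determines.of_le {N : ℕ} {u : List A} (h : N ≤ u.length) (s : List A) :
    Determines N u s := fun _ hw =>
  ⟨fun h' => List.prefix_of_prefix_length_le h' (List.prefix_append _ _) (hw.trans h),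
    fun h' => h'.trans (List.prefix_append _ _)⟩

theorem Determines.of_eq_nil (N : ℕ) (u : List A) : Determines N u [] := fun _ _ => by simp

theorem Determines.append {N M : ℕ} {R u s : List A} (h : Determines N (R ++ u) s)
    (hM : R.length + M ≤ N) (z : List A) : Determines M (z ++ u) s := by
  intro w hw
  refine ⟨fun h' => ?_, fun h' => h'.trans (List.prefix_append _ _)⟩
  rw [List.append_assoc] at h'
  rcases List.prefix_or_prefix_of_prefix h' (List.prefix_append _ _) with hz | ⟨y, rfl⟩
  · exact hz.trans (List.prefix_append _ _)
  · rw [List.prefix_append_right_inj] at h' ⊢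
    rw [List.length_append] at hw
    have := (h (R ++ y) (by rw [List.length_append]; omega)).1
      (by rwa [List.append_assoc, List.prefix_append_right_inj])
    rwa [List.prefix_append_right_inj] at this

/-- Appending words to the first two components of a state. -/
def appendTails (s t : List A) (q : List A × List A × List A) : List A × List A × List A :=
  (q.1 ++ s, q.2.1 ++ t, q.2.2)

theorem drop_append_of_prefix {w u s : List A} (h : w <+: u) :
    (u ++ s).drop w.length = u.drop w.length ++ s :=
  List.drop_append_of_le_length h.length_le

theorem cancelStep_append {u v : List A} (hu : u ≠ []) (hv : v ≠ []) (p s t : List A) :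
    cancelStep (u ++ s) (v ++ t) p = (cancelStep u v p).map (appendTails s t) := by
  obtain ⟨a, u, rfl⟩ := List.exists_cons_of_ne_nil hu
  obtain ⟨b, v, rfl⟩ := List.exists_cons_of_ne_nil hv
  unfold cancelStep
  by_cases h : (a :: u).head? = (b :: v).head? ∧ (p = [] ∨ p.head? = (a :: u).head?)
  · rw [if_pos h, if_pos (by simpa using h)]; rfl
  · rw [if_neg h, if_neg (by simpa using h)]; rfl

theorem length_stem_le (R : List A) : (P.stem R).length ≤ R.length := (stem_prefix R).length_le

theorem headWord_append {K : ℕ} {u s : List A} (hW : ∀ w, w ∈ W ↔ P.IsRelationWord w)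
    (hK : ∀ w, P.IsRelationWord w → w.length ≤ K) (h : Determines K u s) :
    P.headWord W (u ++ s) = P.headWord W u := by
  refine find?_congr_of_mem fun R hR => ?_
  have := h (P.stem R) ((length_stem_le R).trans (hK R ((hW R).1 hR)))
  simp [this]

theorem activeSuffix_append {K : ℕ} {R u s : List A} (hW : ∀ w, w ∈ W ↔ P.IsRelationWord w)
    (hK : ∀ w, P.IsRelationWord w → w.length ≤ K) (h : ∀ z, Determines K (z ++ u) s) :
    P.activeSuffix W R (u ++ s) = P.activeSuffix W R u := by
  unfold activeSuffix
  congr 1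
  refine find?_congr_of_mem fun z _ => ?_
  rw [← List.append_assoc, headWord_append hW hK (h z)]

theorem IsPiece.length_le {K : ℕ} {p : List A} (hp : P.IsPiece p)
    (hK : ∀ w, P.IsRelationWord w → w.length ≤ K) : p.length ≤ K := by
  obtain ⟨a, b, h⟩ := hp.exists_isRelationWord
  have := hK _ h
  simp only [List.length_append] at this
  omega

open Classical in
theorem stemStep_append {K : ℕ} {R S u v p s t : List A}
    (hW : ∀ w, w ∈ W ↔ P.IsRelationWord w) (hK : ∀ w, P.IsRelationWord w → w.length ≤ K)
    (hR : P.IsRelationWord R) (hS : P.IsRelationWord S) (hu : P.stem R <+: u)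
    (hv : P.stem S <+: v) (hu₀ : u ≠ []) (hv₀ : v ≠ []) (hp : P.IsPiece p)
    (hs : Determines (2 * K) u s) (ht : Determines (2 * K) v t) :
    P.stemStep W R S (u ++ s) (v ++ t) p =
      (P.stemStep W R S u v p).map (appendTails s t) := by
  have hRK := hK R hR
  have hSK := hK S hS
  have hpK := hp.length_le hK
  have iR := hs R (by omega)
  have iS := ht S (by omega)
  have ip := hs p (by omega)
  have iR' := hs (R.take (R.length - (commonSuffix (P.suf R) (P.suf S)).length))
    (by rw [List.length_take]; omega)
  have iS' := ht (S.take (S.length - (commonSuffix (P.suf R) (P.suf S)).length))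
    (by rw [List.length_take]; omega)
  have dR := drop_append_of_prefix (s := s) hu
  have dS := drop_append_of_prefix (s := t) hv
  unfold stemStep
  simp only [iR, iS, ip, iR', iS', dR, dS]
  split_ifs with h1 h2 h3 h5 h6 h7
  · exact cancelStep_append hu₀ hv₀ p s t
  · have hz : P.activeSuffix W R (u.drop R.length ++ s) =
        P.activeSuffix W R (u.drop R.length) := by
      refine activeSuffix_append hW hK fun z => ?_
      obtain ⟨u', rfl⟩ := h3
      rw [List.drop_left]
      exact hs.append (by omega) z
    rw [drop_append_of_prefix h3, drop_append_of_prefix h5, hz]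
    simp [appendTails]
  · rw [drop_append_of_prefix h3]
    simp [appendTails]
  · rw [drop_append_of_prefix h6]
    simp [appendTails]
  · have h8 := drop_append_of_prefix (s := s) h7.1
    have h9 := drop_append_of_prefix (s := t) h7.2
    rw [List.length_take, min_eq_left (Nat.sub_le _ _)] at h8 h9
    rw [h8, h9]
    simp [appendTails]
  · rfl
  · rfl

/-- The reduction step depends only on a bounded prefix of the words. -/
theorem reduceStep_append {K : ℕ} {u v p s t : List A}
    (hW : ∀ w, w ∈ W ↔ P.IsRelationWord w) (hK : ∀ w, P.IsRelationWord w → w.length ≤ K)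
    (hu : u ≠ []) (hv : v ≠ []) (hp : p = [] ∨ P.IsPiece p)
    (hs : Determines (2 * K) u s) (ht : Determines (2 * K) v t) :
    P.reduceStep W (u ++ s, v ++ t, p) = (P.reduceStep W (u, v, p)).map (appendTails s t) := by
  unfold reduceStep
  dsimp only
  rw [headWord_append hW hK (fun w hw => hs w (by omega)),
    headWord_append hW hK (fun w hw => ht w (by omega))]
  cases hR : P.headWord W u with
  | none => exact cancelStep_append hu hv p s t
  | some R =>
    cases hS : P.headWord W v with
    | none => exact cancelStep_append hu hv p s t
    | some S =>
      obtain ⟨h1, h2⟩ := headWord_eq_some hW hR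
      obtain ⟨h3, h5⟩ := headWord_eq_some hW hS
      exact stemStep_append hW hK h1 h3 h2 h5 hu hv
        (hp.elim (fun h => h ▸ h1.isPiece_nil) id) hs ht

/-- The word `x'` arises from `x` by removal of one letter, or by replacing a prefix which
lies between the stem of a relation word and this relation word by a piece. -/
def Shortens (P : SemigroupPresentation A) (x x' : List A) : Prop :=
  (x ≠ [] ∧ x' = x.tail) ∨
  ∃ z w R, P.IsRelationWord R ∧ P.stem R <+: w ∧ w <+: R ∧ w <+: x ∧ P.IsPiece z ∧
    x' = z ++ x.drop w.length

theorem shortens_cancelStep {u v p : List A} {q : List A × List A × List A} (hu : u ≠ [])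
    (hp : p = [] ∨ P.IsPiece p) (h : cancelStep u v p = some q) :
    P.Shortens u q.1 ∧ P.Shortens v q.2.1 ∧ (q.2.2 = [] ∨ P.IsPiece q.2.2) := by
  unfold cancelStep at h
  split_ifs at h with hc
  rw [Option.some.injEq] at h
  subst h
  refine ⟨.inl ⟨hu, rfl⟩, .inl ⟨?_, rfl⟩, ?_⟩
  · rintro rfl
    simp [hu] at hc
  · rcases hp with rfl | hp
    · exact .inl rfl
    · exact .inr (hp.of_infix (List.tail_suffix p).isInfix)

theorem shortens_reduceStep {u v p : List A} {q : List A × List A × List A}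
    (hW : ∀ w, w ∈ W ↔ P.IsRelationWord w) (hu : u ≠ []) (hp : p = [] ∨ P.IsPiece p)
    (h : P.reduceStep W (u, v, p) = some q) :
    P.Shortens u q.1 ∧ P.Shortens v q.2.1 ∧ (q.2.2 = [] ∨ P.IsPiece q.2.2) := by
  unfold reduceStep at h
  dsimp only at h
  cases hR : P.headWord W u with
  | none => rw [hR] at h; exact shortens_cancelStep hu hp h
  | some R =>
    cases hS : P.headWord W v with
    | none => rw [hR, hS] at h; exact shortens_cancelStep hu hp h
    | some S =>
      rw [hR, hS] at h
      obtain ⟨h1, h2⟩ := headWord_eq_some hW hR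
      obtain ⟨h3, h5⟩ := headWord_eq_some hW hS
      simp only [Option.bind_some, Option.map_some, Option.elim_some, stemStep] at h
      split_ifs at h with _ _ h6 h7 h7 h8
      · exact shortens_cancelStep hu hp h
      all_goals
        rw [Option.some.injEq] at h
        subst h
        dsimp only
      · exact ⟨.inr ⟨_, R, R, h1, stem_prefix R, List.prefix_rfl, h6,
          isPiece_activeSuffix hW h1 _, rfl⟩, .inr ⟨_, S, S, h3, stem_prefix S, List.prefix_rfl,
          h7, isPiece_activeSuffix hW h1 _, rfl⟩, .inl rfl⟩
      · exact ⟨.inr ⟨_, R, R, h1, stem_prefix R, List.prefix_rfl, h6, h3.isPiece_suf, rfl⟩,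
          .inr ⟨[], _, S, h3, List.prefix_rfl, stem_prefix S, h5, h1.isPiece_nil, rfl⟩, .inl rfl⟩
      · exact ⟨.inr ⟨[], _, R, h1, List.prefix_rfl, stem_prefix R, h2, h1.isPiece_nil, rfl⟩,
          .inr ⟨_, S, S, h3, stem_prefix S, List.prefix_rfl, h7, h1.isPiece_suf, rfl⟩, .inl rfl⟩
      · obtain ⟨x, hx⟩ := commonSuffix_left (P.suf R) (P.suf S)
        obtain ⟨y, hy⟩ := commonSuffix_right (P.suf R) (P.suf S)
        refine ⟨.inr ⟨[], R.take (R.length - (commonSuffix (P.suf R) (P.suf S)).length), R, h1,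
            ?_, List.take_prefix _ _, h8.1, h1.isPiece_nil, ?_⟩,
          .inr ⟨[], S.take (S.length - (commonSuffix (P.suf R) (P.suf S)).length), S, h3,
            ?_, List.take_prefix _ _, h8.2, h1.isPiece_nil, ?_⟩,
          .inr (h1.isPiece_suf.of_infix (commonSuffix_left _ _).isInfix)⟩
        · rw [take_sub_length hx.symm]; exact List.prefix_append _ _
        · simp
        · rw [take_sub_length hy.symm]; exact List.prefix_append _ _
        · simp

/-- The word `x` consists of a piece `m`, kept in memory, and a word `r` of length at most `L`,
and `r.length * (K + 1) + m.length ≤ n`. Since pieces have length at most `K`, this weight decreases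
when `r` loses a letter and `m` is replaced by another piece. -/
def Weighs (P : SemigroupPresentation A) (K L n : ℕ) (x : List A) : Prop :=
  ∃ m r, x = m ++ r ∧ (m = [] ∨ P.IsPiece m) ∧ r.length ≤ L ∧ r.length * (K + 1) + m.length ≤ n

theorem Weighs.of_length_le {K L n : ℕ} {x : List A} (hL : x.length ≤ L)
    (hn : L * (K + 1) ≤ n) : P.Weighs K L n x :=
  ⟨[], x, rfl, .inl rfl, hL, by
    have := Nat.mul_le_mul_right (K + 1) hL
    simp only [List.length_nil]; omega⟩

theorem Weighs.concat {K L n : ℕ} {x : List A} (h : P.Weighs K L n x) (hx : x.length < L)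
    (a : A) : P.Weighs K L (n + (K + 1)) (x ++ [a]) := by
  obtain ⟨m, r, rfl, h2, h3, h4⟩ := h
  rw [List.length_append] at hx
  refine ⟨m, r ++ [a], by simp, h2, by simp; omega, ?_⟩
  rw [List.length_append, List.length_singleton, add_mul]
  omega

theorem Weighs.length_le {K L n : ℕ} {x : List A} (h : P.Weighs K L n x)
    (hK : ∀ w, P.IsRelationWord w → w.length ≤ K) : x.length ≤ K + L := by
  obtain ⟨m, r, rfl, h2, h3, h4⟩ := h
  rw [List.length_append]
  rcases h2 with rfl | h2
  · simp; omega
  · have := h2.length_le hK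
    omega

theorem Weighs.le_max {K L n : ℕ} {x : List A} (h : P.Weighs K L n x)
    (hK : ∀ w, P.IsRelationWord w → w.length ≤ K) : P.Weighs K L (L * (K + 1) + K) x := by
  obtain ⟨m, r, rfl, h2, h3, h4⟩ := h
  refine ⟨m, r, rfl, h2, h3, ?_⟩
  have h5 := Nat.mul_le_mul_right (K + 1) h3
  rcases h2 with rfl | h2
  · simp; omega
  · have := h2.length_le hK
    omega

/-- The reduction terminates: a step which removes a stem removes at least one letter behind the
piece in memory, as this piece is a proper prefix of the stem. -/
theorem SmallOverlap.weighs_of_shortens {K L n : ℕ} {x x' : List A} (h4 : P.SmallOverlap 4)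
    (hK : ∀ w, P.IsRelationWord w → w.length ≤ K)
    (h : P.Weighs K L n x) (h' : P.Shortens x x') : ∃ k, k < n ∧ P.Weighs K L k x' := by
  obtain ⟨m, r, rfl, hm, hr, hn⟩ := h
  rcases h' with ⟨hne, rfl⟩ | ⟨z, w, R, hR, hRw, -, hwx, hz, rfl⟩
  · cases m with
    | nil =>
      obtain ⟨a, r, rfl⟩ := List.exists_cons_of_ne_nil hne
      simp only [List.length_cons, List.length_nil, add_mul] at hr hn
      exact ⟨r.length * (K + 1) + 0, by omega, [], r, rfl, .inl rfl, by omega, le_rfl⟩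
    | cons a m =>
      simp only [List.length_cons] at hn
      refine ⟨_, by omega, m, r, rfl, ?_, hr, le_rfl⟩
      exact hm.elim (by simp) fun h => .inr (h.of_infix (List.suffix_cons a m).isInfix)
  · have hRx := hRw.trans hwx
    have hl := hRw.length_le
    generalize w.length = l at *
    have hml : m.length < (P.stem R).length := by
      have hm' : P.IsPiece m := hm.elim (fun h => h ▸ hR.isPiece_nil) id
      obtain ⟨y, hy⟩ := h4.prefix_stem hR hm' hRx (List.prefix_append _ _)
      rw [← hy, List.length_append]
      have : y ≠ [] := by
        rintro rfl
        rw [List.append_nil] at hy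
        exact h4.not_isPiece_stem hR (hy ▸ hm')
      have := List.length_pos_of_ne_nil this
      omega
    have hzK := hz.length_le hK
    have hd : (m ++ r).drop l = r.drop (l - m.length) := by
      rw [List.drop_append, List.drop_eq_nil_of_le (by omega), List.nil_append]
    rw [hd]
    have hr0 : 0 < r.length := by
      have := hRx.length_le
      rw [List.length_append] at this
      omega
    have h1 : (r.drop (l - m.length)).length + 1 ≤ r.length := by
      rw [List.length_drop]; omega
    have h2 := Nat.mul_le_mul_right (K + 1) h1
    rw [add_mul] at h2
    exact ⟨_, by omega, z, _, rfl, .inr hz, by omega, le_rfl⟩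

end SemigroupPresentation

namespace SemigroupPresentation

/-! ### The transition function on buffered words -/

variable {B : Type*} {P : SemigroupPresentation (Option B)} {W : List (List (Option B))} {K : ℕ}

/-- A state: unprocessed parts of the two words, and a word which must be a prefix of some
equivalent word. -/
abbrev Buffers (B : Type*) : Type _ :=
  List (Option B) × List (Option B) × List (Option B)

/-- A buffer is full if it has length at least `L` or contains the end-marker. -/
def IsFull (L : ℕ) (x : List (Option B)) : Prop :=
  L ≤ x.length ∨ none ∈ x

open Classical in
/-- The reduction step, applied only when both buffers are full. Full buffers of length
`L = 2 * K + 1`, where `K` bounds the lengths of the relation words, determine this step: it looks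
at a relation word and at the stem behind it. -/
noncomputable def fullStep (P : SemigroupPresentation (Option B)) (W : List (List (Option B)))
    (L : ℕ) (q : Buffers B) : Option (Buffers B) :=
  if IsFull L q.1 ∧ IsFull L q.2.1 then P.reduceStep W q else some q

/-- Repeated reduction. -/
noncomputable def normalize (P : SemigroupPresentation (Option B)) (W : List (List (Option B)))
    (L N : ℕ) (q : Buffers B) : Option (Buffers B) :=
  (fun o => o.bind (P.fullStep W L))^[N] (some q)

/-- The largest weight of a buffer: `2 * K + 1` letters of weight `K + 1` behind a piece of length at
most `K`. More reductions in a row are impossible. -/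
def maxWeight (K : ℕ) : ℕ :=
  (2 * K + 1) * (K + 1) + K

open Classical in
/-- The transition function. The state `none` is the initial state, which does not accept the
end-marker: the empty word does not belong to `A⁺`. -/
noncomputable def transition (P : SemigroupPresentation (Option B))
    (W : List (List (Option B))) (K : ℕ) (o : Option (Buffers B)) (a : Option B) :
    Option (Buffers B) :=
  o.elim (if a = none then none else P.normalize W (2 * K + 1) (maxWeight K + 1) ([a], [], []))
    fun q =>
      if IsFull (2 * K + 1) q.1 then
        P.normalize W (2 * K + 1) (maxWeight K + 1) (q.1, q.2.1 ++ [a], q.2.2)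
      else P.normalize W (2 * K + 1) (maxWeight K + 1) (q.1 ++ [a], q.2.1, q.2.2)

/-- The standing assumptions: `P` satisfies `C(4)`, `W` lists its relation words, these have length
at most `K` and do not contain the end-marker. -/
structure Setting (P : SemigroupPresentation (Option B)) (W : List (List (Option B)))
    (K : ℕ) : Prop where
  smallOverlap : P.SmallOverlap 4
  mem_iff : ∀ w, w ∈ W ↔ P.IsRelationWord w
  length_le : ∀ w, P.IsRelationWord w → w.length ≤ K
  none_notMem : ∀ w, P.IsRelationWord w → none ∉ w

/-- The words end with the end-marker, if nonempty, and contain no other end-marker. -/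
def IsEnded (w : List (Option B)) : Prop :=
  w = [] ∨ ∃ u : List (Option B), none ∉ u ∧ w = u ++ [none]

theorem IsEnded.tail {w : List (Option B)} (h : IsEnded w) : IsEnded w.tail := by
  rcases h with rfl | ⟨u, hu, rfl⟩
  · exact .inl rfl
  · cases u with
    | nil => exact .inl rfl
    | cons a u => exact .inr ⟨u, fun h => hu (List.mem_cons_of_mem _ h), rfl⟩

theorem IsEnded.eq_nil {x s : List (Option B)} (h : IsEnded (x ++ s)) (hx : none ∈ x) :
    s = [] := by
  rcases h with h | ⟨u, hu, h⟩
  · exact (List.append_eq_nil_iff.1 h).2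
  · rcases List.eq_nil_or_concat s with rfl | ⟨s', a, rfl⟩
    · rfl
    · rw [List.concat_eq_append, ← List.append_assoc] at h
      have := (List.append_inj' h rfl).1
      exact absurd (by rw [← this]; simp [hx]) hu

theorem IsEnded.isFull {x : List (Option B)} (h : IsEnded x) (hx : x ≠ []) (L : ℕ) :
    IsFull L x := by
  rcases h with rfl | ⟨u, -, rfl⟩
  · exact absurd rfl hx
  · exact .inr (by simp)

theorem IsEnded.append_of_append {w y z : List (Option B)} (h : IsEnded (w ++ y))
    (hw : none ∉ w) (hw' : w ≠ []) (hz : none ∉ z) : IsEnded (z ++ y) := by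
  rcases h with h | ⟨u, hu, h⟩
  · exact absurd (List.append_eq_nil_iff.1 h).1 hw'
  · rw [List.append_eq_append_iff] at h
    rcases h with ⟨v, rfl, rfl⟩ | ⟨v, rfl, h⟩
    · refine .inr ⟨z ++ v, ?_, by simp⟩
      simp only [List.mem_append, not_or] at hu ⊢
      exact ⟨hz, hu.2⟩
    · cases v with
      | nil =>
        simp only [List.nil_append] at h
        subst h
        exact .inr ⟨z, hz, rfl⟩
      | cons a v =>
        simp only [List.cons_append, List.cons.injEq] at h
        exact absurd (by simp [← h.1]) hw

/-- A reduced word still ends with the end-marker, as relation words do not contain it. -/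
theorem Setting.isEnded_of_shortens {x x' s : List (Option B)} (hP : P.Setting W K)
    (h : IsEnded (x ++ s)) (hx : P.Shortens x x') : IsEnded (x' ++ s) := by
  rcases hx with ⟨hne, rfl⟩ | ⟨z, w, R, hR, hRw, hwR, ⟨y, rfl⟩, hz, rfl⟩
  · rw [← List.tail_append_of_ne_nil hne]
    exact h.tail
  · rw [List.drop_left, List.append_assoc]
    rw [List.append_assoc] at h
    refine h.append_of_append (fun h => hP.none_notMem R hR (hwR.subset h)) ?_ ?_
    · rintro rfl
      rw [List.prefix_nil] at hRw
      exact hP.smallOverlap.not_isPiece_stem hR (hRw ▸ hR.isPiece_nil)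
    · obtain ⟨a, b, hab⟩ := hz.exists_isRelationWord
      intro h
      exact hP.none_notMem _ hab (by simp [h])

/-- The bounds on the buffers: the letters come from `T`, the weights are bounded, the third word
is a piece. -/
structure Bounded (P : SemigroupPresentation (Option B)) (K : ℕ) (T : Set (Option B)) (n : ℕ)
    (q : Buffers B) : Prop where
  left : P.Weighs K (2 * K + 1) n q.1
  right : ∃ n', P.Weighs K (2 * K + 1) n' q.2.1
  piece : q.2.2 = [] ∨ P.IsPiece q.2.2
  mem_left : ∀ a ∈ q.1, a ∈ T
  mem_right : ∀ a ∈ q.2.1, a ∈ T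

theorem Shortens.forall_mem {x x' : List (Option B)} {T : Set (Option B)}
    (h : P.Shortens x x') (hT : ∀ w, P.IsRelationWord w → ∀ a ∈ w, a ∈ T)
    (hx : ∀ a ∈ x, a ∈ T) : ∀ a ∈ x', a ∈ T := by
  rcases h with ⟨-, rfl⟩ | ⟨z, w, R, -, -, -, -, hz, rfl⟩
  · exact fun a ha => hx a (List.mem_of_mem_tail ha)
  · intro a ha
    rcases List.mem_append.1 ha with ha | ha
    · obtain ⟨b, c, h⟩ := hz.exists_isRelationWord
      exact hT _ h a (by simp [ha])
    · exact hx a (List.mem_of_mem_drop ha)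

theorem IsFull.ne_nil {x : List (Option B)} (h : IsFull (2 * K + 1) x) : x ≠ [] := by
  rintro rfl
  rcases h with h | h <;> simp at h

/-- A reduction step decreases the weight of the first buffer. -/
theorem Bounded.reduceStep {T : Set (Option B)} {n : ℕ} {q q' : Buffers B} (hP : P.Setting W K)
    (hT : ∀ w, P.IsRelationWord w → ∀ a ∈ w, a ∈ T) (h : P.Bounded K T n q)
    (hq : IsFull (2 * K + 1) q.1) (h' : P.reduceStep W q = some q') :
    ∃ k, k < n ∧ P.Bounded K T k q' := by
  obtain ⟨h1, h2, h3⟩ := shortens_reduceStep hP.mem_iff hq.ne_nil h.piece h'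
  obtain ⟨k, hk, hk'⟩ := hP.smallOverlap.weighs_of_shortens hP.length_le h.left h1
  obtain ⟨n', hn'⟩ := h.right
  obtain ⟨k', -, hk''⟩ := hP.smallOverlap.weighs_of_shortens hP.length_le hn' h2
  exact ⟨k, hk, hk', ⟨k', hk''⟩, h3, h1.forall_mem hT h.mem_left, h2.forall_mem hT h.mem_right⟩

theorem normalize_succ {L N : ℕ} {q : Buffers B} :
    P.normalize W L (N + 1) q = (P.fullStep W L q).bind (P.normalize W L N) := by
  have h : ∀ N, (fun o => o.bind (P.fullStep W L))^[N] none = none := by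
    intro N
    induction N with
    | zero => rfl
    | succ N ih => rw [Function.iterate_succ_apply, Option.bind_none, ih]
  unfold normalize
  rw [Function.iterate_succ_apply, Option.bind_some]
  cases P.fullStep W L q with
  | none => exact h N
  | some q' => rfl

theorem normalize_of_not_isFull {L N : ℕ} {q : Buffers B}
    (h : ¬ (IsFull L q.1 ∧ IsFull L q.2.1)) : P.normalize W L N q = some q := by
  induction N with
  | zero => rfl
  | succ N ih => rw [normalize_succ, fullStep, if_neg h, Option.bind_some, ih]

theorem Bounded.normalize {T : Set (Option B)} {n N : ℕ} {q q' : Buffers B}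
    (hP : P.Setting W K) (hT : ∀ w, P.IsRelationWord w → ∀ a ∈ w, a ∈ T)
    (h : P.Bounded K T n q) (hN : n < N) (h' : P.normalize W (2 * K + 1) N q = some q') :
    (∃ k, k ≤ n ∧ P.Bounded K T k q') ∧ ¬ (IsFull (2 * K + 1) q'.1 ∧ IsFull (2 * K + 1) q'.2.1) := by
  induction N generalizing n q with
  | zero => omega
  | succ N ih =>
    by_cases hq : IsFull (2 * K + 1) q.1 ∧ IsFull (2 * K + 1) q.2.1
    · rw [normalize_succ, fullStep, if_pos hq] at h'
      obtain ⟨q₁, h1, h2⟩ := Option.bind_eq_some_iff.1 h'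
      obtain ⟨k, hk, hb⟩ := h.reduceStep hP hT hq.1 h1
      obtain ⟨⟨k', hk', hb'⟩, h3⟩ := ih hb (by omega) h2
      exact ⟨⟨k', by omega, hb'⟩, h3⟩
    · rw [normalize_of_not_isFull hq, Option.some.injEq] at h'
      subst h'
      exact ⟨⟨n, le_rfl, h⟩, hq⟩

/-- `P.Accepting q s t`: with the buffers `q` and the remaining inputs `s` and `t`, the original
question has a positive answer. -/
def Accepting (P : SemigroupPresentation (Option B)) (q : Buffers B) (s t : List (Option B)) :
    Prop :=
  P.Residual (q.1 ++ s) (q.2.1 ++ t) q.2.2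

/-- The inputs `s` and `t`, preceded by the contents of the buffers, are correctly end-marked. -/
def Compatible (q : Buffers B) (s t : List (Option B)) : Prop :=
  IsEnded (q.1 ++ s) ∧ IsEnded (q.2.1 ++ t)

theorem IsEnded.determines {x s : List (Option B)} (h : IsEnded (x ++ s))
    (hx : IsFull (2 * K + 1) x) : Determines (2 * K) x s := by
  rcases hx with hx | hx
  · exact .of_le (by omega) s
  · rw [h.eq_nil hx]
    exact .of_eq_nil _ _

theorem Compatible.reduceStep {T : Set (Option B)} {n : ℕ} {q q' : Buffers B}
    {s t : List (Option B)} (hP : P.Setting W K) (h : P.Bounded K T n q) (hc : Compatible q s t)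
    (hq : IsFull (2 * K + 1) q.1) (h' : P.reduceStep W q = some q') : Compatible q' s t := by
  obtain ⟨h1, h2, -⟩ := shortens_reduceStep hP.mem_iff hq.ne_nil h.piece h'
  exact ⟨hP.isEnded_of_shortens hc.1 h1, hP.isEnded_of_shortens hc.2 h2⟩

/-- Whether the question has a positive answer does not change if a reduction step is applied to
full buffers, since these determine the step. -/
theorem Setting.accepting_reduceStep {T : Set (Option B)} {n : ℕ} {q : Buffers B}
    {s t : List (Option B)} (hP : P.Setting W K) (h : P.Bounded K T n q) (hc : Compatible q s t)
    (hq : IsFull (2 * K + 1) q.1) (hq' : IsFull (2 * K + 1) q.2.1) :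
    P.Accepting q s t ↔ ∃ q', P.reduceStep W q = some q' ∧ P.Accepting q' s t := by
  unfold Accepting
  rw [hP.smallOverlap.residual_reduceStep hP.mem_iff (by simp [hq.ne_nil]) h.piece,
    reduceStep_append hP.mem_iff hP.length_le hq.ne_nil hq'.ne_nil h.piece
      (hc.1.determines hq) (hc.2.determines hq')]
  simp only [Option.map_eq_some_iff, Prod.mk.eta]
  constructor
  · rintro ⟨_, ⟨q', h1, rfl⟩, h2⟩
    exact ⟨q', h1, h2⟩
  · rintro ⟨q', h1, h2⟩
    exact ⟨_, ⟨q', h1, rfl⟩, h2⟩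

/-- Repeated reduction of the buffers keeps the inputs correctly end-marked, and does not change
the answer. -/
theorem Setting.accepting_normalize {T : Set (Option B)} {n N : ℕ} {q : Buffers B}
    {s t : List (Option B)} (hP : P.Setting W K)
    (hT : ∀ w, P.IsRelationWord w → ∀ a ∈ w, a ∈ T) (h : P.Bounded K T n q)
    (hc : Compatible q s t) :
    (∀ q', P.normalize W (2 * K + 1) N q = some q' → Compatible q' s t) ∧
      (P.Accepting q s t ↔
        ∃ q', P.normalize W (2 * K + 1) N q = some q' ∧ P.Accepting q' s t) := by
  induction N generalizing n q with
  | zero =>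
    exact ⟨fun q' h => by cases h; exact hc,
      fun h => ⟨q, rfl, h⟩, fun ⟨_, h, h'⟩ => by cases h; exact h'⟩
  | succ N ih =>
    by_cases hq : IsFull (2 * K + 1) q.1 ∧ IsFull (2 * K + 1) q.2.1
    · rw [hP.accepting_reduceStep h hc hq.1 hq.2, normalize_succ, fullStep, if_pos hq]
      cases hr : P.reduceStep W q with
      | none => simp
      | some q₁ =>
        obtain ⟨k, -, hb⟩ := h.reduceStep hP hT hq.1 hr
        simp only [Option.some.injEq, exists_eq_left', Option.bind_some]
        exact ih hb (hc.reduceStep hP h hq.1 hr)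
    · rw [normalize_of_not_isFull hq]
      simp [hc]

/-- The invariant of the automaton: bounded buffers which are not both full. -/
def IsState (P : SemigroupPresentation (Option B)) (K : ℕ) (T : Set (Option B))
    (q : Buffers B) : Prop :=
  P.Bounded K T (maxWeight K) q ∧ ¬ (IsFull (2 * K + 1) q.1 ∧ IsFull (2 * K + 1) q.2.1)

theorem Bounded.max {T : Set (Option B)} {n : ℕ} {q : Buffers B} (hP : P.Setting W K)
    (h : P.Bounded K T n q) : P.Bounded K T (maxWeight K) q :=
  ⟨h.left.le_max hP.length_le, h.right, h.piece, h.mem_left, h.mem_right⟩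

theorem Bounded.isState_normalize {T : Set (Option B)} {n : ℕ} {q q' : Buffers B}
    (hP : P.Setting W K) (hT : ∀ w, P.IsRelationWord w → ∀ a ∈ w, a ∈ T)
    (h : P.Bounded K T n q)
    (h' : P.normalize W (2 * K + 1) (maxWeight K + 1) q = some q') : P.IsState K T q' := by
  obtain ⟨⟨k, -, h1⟩, h2⟩ := (h.max hP).normalize hP hT (Nat.lt_succ_self _) h'
  exact ⟨h1.max hP, h2⟩

theorem length_lt_of_not_isFull {L : ℕ} {x : List (Option B)} (h : ¬ IsFull L x) :
    x.length < L := by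
  by_contra hc
  exact h (.inl (by omega))

theorem bounded_init {T : Set (Option B)} {a : Option B} (ha : a ∈ T) :
    P.Bounded K T ((2 * K + 1) * (K + 1)) ([a], [], []) :=
  ⟨.of_length_le (by simp) le_rfl, ⟨_, .of_length_le (by simp) le_rfl⟩, .inl rfl,
    by simpa using ha, by simp⟩

theorem IsState.bounded_left {T : Set (Option B)} {q : Buffers B} {a : Option B}
    (h : P.IsState K T q) (ha : a ∈ T) (hq : ¬ IsFull (2 * K + 1) q.1) :
    P.Bounded K T (maxWeight K + (K + 1)) (q.1 ++ [a], q.2.1, q.2.2) := by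
  refine ⟨h.1.left.concat (length_lt_of_not_isFull hq) a, h.1.right, h.1.piece, ?_,
    h.1.mem_right⟩
  intro b hb
  rcases List.mem_append.1 hb with hb | hb
  · exact h.1.mem_left b hb
  · rw [List.mem_singleton.1 hb]; exact ha

theorem IsState.bounded_right {T : Set (Option B)} {q : Buffers B} {a : Option B}
    (h : P.IsState K T q) (ha : a ∈ T) (hq : IsFull (2 * K + 1) q.1) :
    P.Bounded K T (maxWeight K) (q.1, q.2.1 ++ [a], q.2.2) := by
  have hq' : ¬ IsFull (2 * K + 1) q.2.1 := fun h' => h.2 ⟨hq, h'⟩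
  obtain ⟨n, hn⟩ := h.1.right
  refine ⟨h.1.left, ⟨_, hn.concat (length_lt_of_not_isFull hq') a⟩, h.1.piece,
    h.1.mem_left, ?_⟩
  intro b hb
  rcases List.mem_append.1 hb with hb | hb
  · exact h.1.mem_right b hb
  · rw [List.mem_singleton.1 hb]; exact ha

theorem Setting.isState_transition {T : Set (Option B)} {o : Option (Buffers B)}
    {a : Option B} {q' : Buffers B} (hP : P.Setting W K)
    (hT : ∀ w, P.IsRelationWord w → ∀ a ∈ w, a ∈ T) (ha : a ∈ T)
    (h : ∀ q, o = some q → P.IsState K T q) (h' : P.transition W K o a = some q') :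
    P.IsState K T q' := by
  unfold transition at h'
  cases o with
  | none =>
    simp only [Option.elim_none] at h'
    split_ifs at h'
    exact (bounded_init ha).isState_normalize hP hT h'
  | some q =>
    simp only [Option.elim_some] at h'
    split_ifs at h' with hq
    · exact ((h q rfl).bounded_right ha hq).isState_normalize hP hT h'
    · exact ((h q rfl).bounded_left ha hq).isState_normalize hP hT h'

/-- A letter is read from the first input. -/
theorem Setting.accepting_cons_left {T : Set (Option B)} {q : Buffers B} {a : Option B}
    {s t : List (Option B)} (hP : P.Setting W K)
    (hT : ∀ w, P.IsRelationWord w → ∀ a ∈ w, a ∈ T) (ha : a ∈ T) (h : P.IsState K T q)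
    (hq : ¬ IsFull (2 * K + 1) q.1) (hc : Compatible q (a :: s) t) :
    (∀ q', P.transition W K (some q) a = some q' → Compatible q' s t) ∧
      (P.Accepting q (a :: s) t ↔
        ∃ q', P.transition W K (some q) a = some q' ∧ P.Accepting q' s t) := by
  have hc' : Compatible (q.1 ++ [a], q.2.1, q.2.2) s t := by simpa [Compatible] using hc
  have := hP.accepting_normalize (N := maxWeight K + 1) hT (h.bounded_left ha hq) hc'
  rw [transition, Option.elim_some, if_neg hq, ← this.2]
  exact ⟨this.1, by simp [Accepting]⟩

/-- A letter is read from the second input. -/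
theorem Setting.accepting_cons_right {T : Set (Option B)} {q : Buffers B} {a : Option B}
    {s t : List (Option B)} (hP : P.Setting W K)
    (hT : ∀ w, P.IsRelationWord w → ∀ a ∈ w, a ∈ T) (ha : a ∈ T) (h : P.IsState K T q)
    (hq : IsFull (2 * K + 1) q.1) (hc : Compatible q s (a :: t)) :
    (∀ q', P.transition W K (some q) a = some q' → Compatible q' s t) ∧
      (P.Accepting q s (a :: t) ↔
        ∃ q', P.transition W K (some q) a = some q' ∧ P.Accepting q' s t) := by
  have hc' : Compatible (q.1, q.2.1 ++ [a], q.2.2) s t := by simpa [Compatible] using hc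
  have := hP.accepting_normalize (N := maxWeight K + 1) hT (h.bounded_right ha hq) hc'
  rw [transition, Option.elim_some, if_pos hq, ← this.2]
  exact ⟨this.1, by simp [Accepting]⟩

/-- The first letter is read in the initial state. -/
theorem Setting.equivalent_cons {T : Set (Option B)} {a : B}
    {s t : List (Option B)} (hP : P.Setting W K)
    (hT : ∀ w, P.IsRelationWord w → ∀ a ∈ w, a ∈ T) (ha : some a ∈ T)
    (hs : IsEnded (some a :: s)) (ht : IsEnded t) :
    (∀ q', P.transition W K none (some a) = some q' → Compatible q' s t) ∧
      (P.Equivalent (some a :: s) t ↔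
        ∃ q', P.transition W K none (some a) = some q' ∧ P.Accepting q' s t) := by
  have := hP.accepting_normalize (N := maxWeight K + 1) (s := s) (t := t) hT
    (bounded_init ha) ⟨by simpa using hs, by simpa using ht⟩
  rw [transition, Option.elim_none, if_neg (by simp), ← this.2]
  exact ⟨this.1, by simp [Accepting, residual_nil]⟩

/-- When the first input is used up and its buffer is not full, this buffer is empty. -/
theorem accepting_nil_left {q : Buffers B} {t : List (Option B)}
    (hq : ¬ IsFull (2 * K + 1) q.1) (hc : Compatible q [] t) :
    P.Accepting q [] t ↔ q = ([], [], []) ∧ t = [] := by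
  obtain ⟨x, y, p⟩ := q
  have hx : x = [] := by
    by_contra hx
    have := hc.1
    simp only [List.append_nil] at this
    exact hq (this.isFull hx _)
  subst hx
  simp only [Accepting, List.append_nil, Prod.mk.injEq, true_and]
  constructor
  · rintro ⟨h1, w, h2⟩
    have h3 := List.append_eq_nil_iff.1 h1.eq_nil
    exact ⟨⟨h3.1, (List.append_eq_nil_iff.1 h2.eq_nil).1⟩, h3.2⟩
  · rintro ⟨⟨rfl, rfl⟩, rfl⟩
    exact ⟨.refl _, [], .refl _⟩

/-- When the second input is used up and its buffer is not full, while the first buffer is full,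
the second word is empty and the first one is not. -/
theorem not_accepting_nil_right {q : Buffers B} {s : List (Option B)}
    (hq : IsFull (2 * K + 1) q.1) (hq' : ¬ IsFull (2 * K + 1) q.2.1) (hc : Compatible q s []) :
    ¬ P.Accepting q s [] := by
  obtain ⟨x, y, p⟩ := q
  have hy : y = [] := by
    by_contra hy
    have := hc.2
    simp only [List.append_nil] at this
    exact hq' (this.isFull hy _)
  subst hy
  rintro ⟨h, -⟩
  exact hq.ne_nil (List.append_eq_nil_iff.1 h.symm.eq_nil).1

theorem finite_setOf_length_le {α : Type*} {T : Set α} (hT : T.Finite) (n : ℕ) :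
    {l : List α | l.length ≤ n ∧ ∀ a ∈ l, a ∈ T}.Finite := by
  induction n with
  | zero => exact (Set.finite_singleton []).subset fun l hl => List.length_eq_zero_iff.1 (by
      have := hl.1; omega)
  | succ n ih =>
    refine ((hT.image2 List.cons ih).insert []).subset fun l hl => ?_
    cases l with
    | nil => exact .inl rfl
    | cons a l =>
      refine .inr ⟨a, hl.2 a (by simp), l, ⟨by simpa using hl.1, fun b hb => hl.2 b ?_⟩, rfl⟩
      simp [hb]

/-- There are only finitely many states. -/
theorem Setting.finite_isState {T : Set (Option B)} (hP : P.Setting W K)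
    (hT : ∀ w, P.IsRelationWord w → ∀ a ∈ w, a ∈ T) (hfin : T.Finite) :
    {q | P.IsState K T q}.Finite := by
  have h := finite_setOf_length_le hfin (K + (2 * K + 1))
  refine (h.prod (h.prod h)).subset ?_
  rintro ⟨x, y, p⟩ ⟨⟨h1, ⟨n, h2⟩, h3, h5, h6⟩, -⟩
  refine ⟨⟨h1.length_le hP.length_le, h5⟩, ⟨h2.length_le hP.length_le, h6⟩, ?_, ?_⟩
  · rcases h3 with h3 | h3
    · dsimp only at h3 ⊢
      rw [h3]
      simp
    · exact (h3.length_le hP.length_le).trans (by omega)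
  · rcases h3 with h3 | h3
    · dsimp only at h3 ⊢
      rw [h3]
      simp
    · obtain ⟨b, c, h⟩ := h3.exists_isRelationWord
      exact fun a ha => hT _ h a (by simp_all)

end SemigroupPresentation

/-! ### The automaton of a finite list of states -/

section ListAutomaton

variable {A B σ : Type*}

open Classical in
/-- The number of a state in a list, tagged with the tape from which the state reads. -/
noncomputable def positionCode (ℓ : List σ) (first : σ → Prop) (o : σ) : ℕ ⊕ ℕ :=
  if first o then Sum.inl (ℓ.idxOf o) else Sum.inr (ℓ.idxOf o)

open Classical in
/-- The state of the automaton which corresponds to a member of the list. -/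
noncomputable def position (ℓ : List σ) (first : σ → Prop) (o : σ) (h : o ∈ ℓ) :
    Fin ℓ.length ⊕ Fin ℓ.length :=
  if first o then Sum.inl ⟨ℓ.idxOf o, List.idxOf_lt_length_of_mem h⟩
  else Sum.inr ⟨ℓ.idxOf o, List.idxOf_lt_length_of_mem h⟩

theorem stateCode_position (ℓ : List σ) (first : σ → Prop) (o : σ) (h : o ∈ ℓ) :
    stateCode (position ℓ first o h) = positionCode ℓ first o := by
  unfold position positionCode stateCode
  split_ifs <;> rfl

theorem position_injective {ℓ : List σ} {first : σ → Prop} {o o' : σ} {h : o ∈ ℓ} {h' : o' ∈ ℓ}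
    (heq : position ℓ first o h = position ℓ first o' h') : o = o' := by
  classical
  unfold position at heq
  split_ifs at heq <;> simp only [Sum.inl.injEq, Sum.inr.injEq, Fin.mk.injEq] at heq <;>
    exact (List.idxOf_inj h).1 heq

open Classical in
/-- The two-tape automaton whose states are the members of the list `ℓ`; the states satisfying
`first` read from the first tape, and `next` is the transition function. Each member of `ℓ` has a
position on either side of `Fin ℓ.length ⊕ Fin ℓ.length`, of which only one is used. -/
noncomputable def listAutomaton (ℓ : List σ) (first : σ → Prop) (next : σ → Option B → Option σ)
    (ι : A → B) (i f : σ) (hi : i ∈ ℓ) (hf : f ∈ ℓ) :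
    DetTwoTapeAutomaton A A (Fin ℓ.length) (Fin ℓ.length) where
  init := position ℓ first i hi
  terminal := {position ℓ first f hf}
  δ₁ p a := (next ℓ[p] (a.map ι)).bind fun o =>
    if h : o ∈ ℓ then some (position ℓ first o h) else none
  δ₂ p a := (next ℓ[p] (a.map ι)).bind fun o =>
    if h : o ∈ ℓ then some (position ℓ first o h) else none

variable {ℓ : List σ} {first : σ → Prop} {next : σ → Option B → Option σ} {ι : A → B} {i f : σ}
  {hi : i ∈ ℓ} {hf : f ∈ ℓ}

/-- Acceptance from a configuration of the list automaton. -/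
def ListAccepts (ℓ : List σ) (first : σ → Prop) (next : σ → Option B → Option σ)
    (ι : A → B) (i f : σ) (hi : i ∈ ℓ) (hf : f ∈ ℓ) (s t : List (Option A)) (o : σ)
    (ho : o ∈ ℓ) : Prop :=
  Relation.ReflTransGen (listAutomaton ℓ first next ι i f hi hf).Step
    (s, t, position ℓ first o ho) ([], [], position ℓ first f hf)

theorem listAccepts_cons_left {s t : List (Option A)} {a : Option A} {o : σ} {ho : o ∈ ℓ}
    (h : first o) (hc : ∀ o', next o (a.map ι) = some o' → o' ∈ ℓ) :
    ListAccepts ℓ first next ι i f hi hf (a :: s) t o ho ↔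
      ∃ o', ∃ h' : next o (a.map ι) = some o',
        ListAccepts ℓ first next ι i f hi hf s t o' (hc o' h') := by
  classical
  have hpos : position ℓ first o ho = Sum.inl ⟨ℓ.idxOf o, List.idxOf_lt_length_of_mem ho⟩ :=
    if_pos h
  have hget : ℓ[(⟨ℓ.idxOf o, List.idxOf_lt_length_of_mem ho⟩ : Fin ℓ.length)] = o :=
    List.getElem_idxOf _
  unfold ListAccepts
  rw [Relation.ReflTransGen.cases_head_iff]
  simp only [Prod.mk.injEq, List.cons_ne_nil, false_and, false_or, hpos]
  constructor
  · rintro ⟨c, hstep, hacc⟩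
    cases hstep with
    | tape₁ a u v p q hq =>
      simp only [listAutomaton, hget] at hq
      obtain ⟨o', h1, h2⟩ := Option.bind_eq_some_iff.1 hq
      rw [dif_pos (hc o' h1), Option.some.injEq] at h2
      subst h2
      exact ⟨o', h1, hacc⟩
  · rintro ⟨o', h', hacc⟩
    refine ⟨_, .tape₁ a s t _ _ ?_, hacc⟩
    simp only [listAutomaton, hget, h', Option.bind_some]
    rw [dif_pos (hc o' h')]

theorem listAccepts_cons_right {s t : List (Option A)} {a : Option A} {o : σ} {ho : o ∈ ℓ}
    (h : ¬ first o) (hc : ∀ o', next o (a.map ι) = some o' → o' ∈ ℓ) :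
    ListAccepts ℓ first next ι i f hi hf s (a :: t) o ho ↔
      ∃ o', ∃ h' : next o (a.map ι) = some o',
        ListAccepts ℓ first next ι i f hi hf s t o' (hc o' h') := by
  classical
  have hpos : position ℓ first o ho = Sum.inr ⟨ℓ.idxOf o, List.idxOf_lt_length_of_mem ho⟩ :=
    if_neg h
  have hget : ℓ[(⟨ℓ.idxOf o, List.idxOf_lt_length_of_mem ho⟩ : Fin ℓ.length)] = o :=
    List.getElem_idxOf _
  unfold ListAccepts
  rw [Relation.ReflTransGen.cases_head_iff]
  simp only [Prod.mk.injEq, List.cons_ne_nil, false_and, and_false, false_or, hpos]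
  constructor
  · rintro ⟨c, hstep, hacc⟩
    cases hstep with
    | tape₂ a u v p q hq =>
      simp only [listAutomaton, hget] at hq
      obtain ⟨o', h1, h2⟩ := Option.bind_eq_some_iff.1 hq
      rw [dif_pos (hc o' h1), Option.some.injEq] at h2
      subst h2
      exact ⟨o', h1, hacc⟩
  · rintro ⟨o', h', hacc⟩
    refine ⟨_, .tape₂ a s t _ _ ?_, hacc⟩
    simp only [listAutomaton, hget, h', Option.bind_some]
    rw [dif_pos (hc o' h')]

theorem listAccepts_nil_left {t : List (Option A)} {o : σ} {ho : o ∈ ℓ} (h : first o) :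
    ListAccepts ℓ first next ι i f hi hf [] t o ho ↔ o = f ∧ t = [] := by
  classical
  unfold ListAccepts
  rw [Relation.ReflTransGen.cases_head_iff]
  constructor
  · rintro (h' | ⟨c, hstep, -⟩)
    · simp only [Prod.mk.injEq, true_and] at h'
      exact ⟨position_injective h'.2, h'.1⟩
    · rw [position, if_pos h] at hstep
      cases hstep
  · rintro ⟨rfl, rfl⟩
    exact .inl rfl

theorem listAccepts_nil_right {s : List (Option A)} {o : σ} {ho : o ∈ ℓ} (h : ¬ first o) :
    ListAccepts ℓ first next ι i f hi hf s [] o ho ↔ o = f ∧ s = [] := by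
  classical
  unfold ListAccepts
  rw [Relation.ReflTransGen.cases_head_iff]
  constructor
  · rintro (h' | ⟨c, hstep, -⟩)
    · simp only [Prod.mk.injEq, true_and] at h'
      exact ⟨position_injective h'.2, h'.1⟩
    · rw [position, if_neg h] at hstep
      cases hstep
  · rintro ⟨rfl, rfl⟩
    exact .inl rfl

end ListAutomaton

namespace SemigroupPresentation

variable {A B : Type*} {P : SemigroupPresentation (Option B)} {W : List (List (Option B))} {K : ℕ}

/-- The initial state and the states whose first buffer is not full read from the first tape. -/
def ReadsFirst (K : ℕ) (o : Option (Buffers B)) : Prop :=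
  ∀ q ∈ o, ¬ IsFull (2 * K + 1) q.1

/-- The transition function on the states of the automaton. -/
noncomputable def next (P : SemigroupPresentation (Option B)) (W : List (List (Option B)))
    (K : ℕ) (o : Option (Buffers B)) (a : Option B) : Option (Option (Buffers B)) :=
  (P.transition W K o a).map some

/-- The list `ℓ` contains the initial and the terminal state, and is closed under transitions
with letters from the image of `ι`. -/
structure IsClosed (P : SemigroupPresentation (Option B)) (W : List (List (Option B)))
    (K : ℕ) (ι : A → B) (ℓ : List (Option (Buffers B))) : Prop where
  init : none ∈ ℓ
  terminal : some ([], [], []) ∈ ℓ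
  next : ∀ o ∈ ℓ, ∀ a : Option A, ∀ o', P.next W K o (a.map ι) = some o' → o' ∈ ℓ

/-- The automaton of a closed list of states. -/
noncomputable def automaton {ι : A → B} {ℓ : List (Option (Buffers B))}
    (h : P.IsClosed W K ι ℓ) : DetTwoTapeAutomaton A A (Fin ℓ.length) (Fin ℓ.length) :=
  listAutomaton ℓ (ReadsFirst K) (P.next W K) ι none (some ([], [], [])) h.init h.terminal

/-- The automaton accepts from a state exactly when the question which the state represents has a
positive answer. -/
theorem Setting.listAccepts_iff {T : Set (Option B)} {ι : A → B} {ℓ : List (Option (Buffers B))}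
    (hP : P.Setting W K) (hT : ∀ w, P.IsRelationWord w → ∀ a ∈ w, a ∈ T)
    (hι : ∀ a : Option A, a.map ι ∈ T) (hℓ : P.IsClosed W K ι ℓ) (n : ℕ) (q : Buffers B)
    (hq : P.IsState K T q) (hqℓ : some q ∈ ℓ) (s t : List (Option A))
    (hn : s.length + t.length = n)
    (hc : Compatible q (s.map (Option.map ι)) (t.map (Option.map ι))) :
    ListAccepts ℓ (ReadsFirst K) (P.next W K) ι none (some ([], [], [])) hℓ.init hℓ.terminal
      s t (some q) hqℓ ↔
      P.Accepting q (s.map (Option.map ι)) (t.map (Option.map ι)) := by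
  induction n generalizing q s t with
  | zero =>
    have hs : s = [] := List.length_eq_zero_iff.1 (by omega)
    have ht : t = [] := List.length_eq_zero_iff.1 (by omega)
    subst hs ht
    by_cases hf : IsFull (2 * K + 1) q.1
    · rw [listAccepts_nil_right (by simpa [ReadsFirst] using hf)]
      have := not_accepting_nil_right (P := P) hf (fun h => hq.2 ⟨hf, h⟩) hc
      simp only [List.map_nil] at this ⊢
      simp only [this, iff_false, and_true, Option.some.injEq]
      rintro rfl
      exact hf.ne_nil rfl
    · rw [listAccepts_nil_left (by simpa [ReadsFirst] using hf)]
      have := accepting_nil_left (P := P) hf hc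
      simp only [List.map_nil] at this ⊢
      rw [this, Option.some.injEq]
  | succ n ih =>
    have hstep (hmem : ∀ a o', P.next W K (some q) (Option.map ι a) = some o' → o' ∈ ℓ)
        (s t : List (Option A)) (hl : s.length + t.length = n) (a : Option A)
        (hc' : ∀ q', P.transition W K (some q) (Option.map ι a) = some q' →
          Compatible q' (s.map (Option.map ι)) (t.map (Option.map ι))) :
        (∃ o', ∃ h' : P.next W K (some q) (Option.map ι a) = some o',
          ListAccepts ℓ (ReadsFirst K) (P.next W K) ι none (some ([], [], [])) hℓ.init
            hℓ.terminal s t o' (hmem a o' h')) ↔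
        ∃ q', P.transition W K (some q) (Option.map ι a) = some q' ∧
          P.Accepting q' (s.map (Option.map ι)) (t.map (Option.map ι)) := by
      have hst {q'} := hP.isState_transition (q' := q') hT (hι a)
        (by rintro _ ⟨⟩; exact hq : ∀ q₁, some q = some q₁ → P.IsState K T q₁)
      constructor
      · rintro ⟨o', h', hacc⟩
        obtain ⟨q', hq', rfl⟩ := Option.map_eq_some_iff.1 h'
        exact ⟨q', hq', (ih q' (hst hq') _ s t hl (hc' q' hq')).1 hacc⟩
      · rintro ⟨q', h', hacc⟩
        exact ⟨some q', by rw [next, h', Option.map_some],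
          (ih q' (hst h') _ s t hl (hc' q' h')).2 hacc⟩
    by_cases hf : IsFull (2 * K + 1) q.1
    · have hR : ¬ ReadsFirst K (some q) := by simpa [ReadsFirst] using hf
      cases t with
      | nil =>
        rw [listAccepts_nil_right hR]
        have := not_accepting_nil_right (P := P) hf (fun h => hq.2 ⟨hf, h⟩) hc
        simp only [List.map_nil, this, iff_false, Option.some.injEq]
        rintro ⟨rfl, -⟩
        exact hf.ne_nil rfl
      | cons a t =>
        obtain ⟨hc', hiff⟩ := hP.accepting_cons_right hT (hι a) hq hf hc
        rw [listAccepts_cons_right hR (hℓ.next _ hqℓ a), List.map_cons, hiff]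
        exact hstep (hℓ.next _ hqℓ) s t (by rw [List.length_cons] at hn; omega) a hc'
    · have hR : ReadsFirst K (some q) := by simpa [ReadsFirst] using hf
      cases s with
      | nil =>
        rw [listAccepts_nil_left hR, List.map_nil, accepting_nil_left (P := P) hf hc,
          Option.some.injEq, List.map_eq_nil_iff]
      | cons a s =>
        obtain ⟨hc', hiff⟩ := hP.accepting_cons_left hT (hι a) hq hf hc
        rw [listAccepts_cons_left hR (hℓ.next _ hqℓ a), List.map_cons, hiff]
        exact hstep (hℓ.next _ hqℓ) s t (by rw [List.length_cons] at hn; omega) a hc'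

theorem isEnded_endMarked (ι : A → B) (u : List A) :
    IsEnded ((DetTwoTapeAutomaton.endMarked u).map (Option.map ι)) := by
  refine .inr ⟨u.map fun a => some (ι a), by simp, ?_⟩
  simp [DetTwoTapeAutomaton.endMarked, Function.comp_def]

/-- The automaton decides equivalence of end-marked words, the first of which is not empty. -/
theorem Setting.accepted_automaton {T : Set (Option B)} {ι : A → B}
    {ℓ : List (Option (Buffers B))} (hP : P.Setting W K)
    (hT : ∀ w, P.IsRelationWord w → ∀ a ∈ w, a ∈ T) (hι : ∀ a : Option A, a.map ι ∈ T)
    (hℓ : P.IsClosed W K ι ℓ) :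
    (automaton hℓ).accepted = {w | w.1 ≠ [] ∧
      P.Equivalent ((DetTwoTapeAutomaton.endMarked w.1).map (Option.map ι))
        ((DetTwoTapeAutomaton.endMarked w.2).map (Option.map ι))} := by
  ext ⟨u, v⟩
  have h : (u, v) ∈ (automaton hℓ).accepted ↔
      ListAccepts ℓ (ReadsFirst K) (P.next W K) ι none (some ([], [], [])) hℓ.init hℓ.terminal
        (DetTwoTapeAutomaton.endMarked u) (DetTwoTapeAutomaton.endMarked v) none hℓ.init := by
    simp only [DetTwoTapeAutomaton.accepted, automaton, ListAccepts, Set.mem_ofPred_eq]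
    constructor
    · rintro ⟨t, rfl, h⟩
      exact h
    · exact fun h => ⟨_, rfl, h⟩
  have hR : ReadsFirst K (none : Option (Buffers B)) := by simp [ReadsFirst]
  rw [h, Set.mem_ofPred_eq]
  cases u with
  | nil =>
    simp only [DetTwoTapeAutomaton.endMarked, List.map_nil, List.nil_append, ne_eq,
      not_true_eq_false, false_and, iff_false]
    rw [listAccepts_cons_left hR (hℓ.next _ hℓ.init none)]
    rintro ⟨o', h', -⟩
    simp [next, transition] at h'
  | cons a u =>
    have hu := isEnded_endMarked ι (a :: u)
    have hcons : DetTwoTapeAutomaton.endMarked (a :: u) =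
      some a :: DetTwoTapeAutomaton.endMarked u := rfl
    rw [hcons, List.map_cons] at hu
    obtain ⟨hc, hiff⟩ := hP.equivalent_cons hT (hι (some a)) hu (isEnded_endMarked ι v)
    have hst {q'} := hP.isState_transition (o := none) (q' := q') hT (hι (some a)) (by simp)
    simp only [hcons, List.map_cons, ne_eq, reduceCtorEq, not_false_eq_true, true_and]
    rw [listAccepts_cons_left hR (hℓ.next _ hℓ.init (some a))]
    refine Iff.trans ?_ hiff.symm
    constructor
    · rintro ⟨o', h', hacc⟩
      obtain ⟨q', hq', rfl⟩ := Option.map_eq_some_iff.1 h'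
      exact ⟨q', hq', (hP.listAccepts_iff hT hι hℓ _ q' (hst hq') _ _ _ rfl (hc q' hq')).1 hacc⟩
    · rintro ⟨q', h', hacc⟩
      exact ⟨some q', congrArg (Option.map some) h',
        (hP.listAccepts_iff hT hι hℓ _ q' (hst h') _ _ _ rfl (hc q' h')).2 hacc⟩

theorem isState_terminal (T : Set (Option B)) : P.IsState K T ([], [], []) := by
  refine ⟨⟨.of_length_le (by simp) (Nat.le_add_right _ _),
    ⟨_, .of_length_le (by simp) le_rfl⟩, .inl rfl, by simp, by simp⟩, ?_⟩
  rintro ⟨h, -⟩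
  exact h.ne_nil rfl

/-- A closed list of states exists, since there are only finitely many states. -/
theorem Setting.exists_isClosed {T : Set (Option B)} {ι : A → B} (hP : P.Setting W K)
    (hT : ∀ w, P.IsRelationWord w → ∀ a ∈ w, a ∈ T) (hι : ∀ a : Option A, a.map ι ∈ T)
    (hfin : T.Finite) : ∃ ℓ, P.IsClosed W K ι ℓ := by
  have h := hP.finite_isState hT hfin
  refine ⟨none :: h.toFinset.toList.map some, by simp, ?_, ?_⟩
  · simp only [List.mem_cons, reduceCtorEq, List.mem_map, false_or]
    exact ⟨_, by simpa using isState_terminal T, rfl⟩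
  · intro o ho a o' h'
    obtain ⟨q', hq', rfl⟩ := Option.map_eq_some_iff.1 h'
    refine List.mem_cons_of_mem _ (List.mem_map_of_mem ?_)
    simp only [Finset.mem_toList, Set.Finite.mem_toFinset, Set.mem_ofPred_eq]
    refine hP.isState_transition hT (hι a) ?_ hq'
    rintro q rfl
    simpa using ho

/-! ### Change of the alphabet -/

section Map

variable {C D : Type*} {Q : SemigroupPresentation C} {P : SemigroupPresentation D} {f : C → D}

/-- The relations of `P` are the images of the relations of `Q` under the renaming `f` of
letters. -/
def IsImage (Q : SemigroupPresentation C) (f : C → D) (P : SemigroupPresentation D) : Prop :=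
  P.rels = (fun r => (r.1.map f, r.2.map f)) '' Q.rels

theorem IsImage.mem_iff (h : IsImage Q f P) (x y : List D) :
    (x, y) ∈ P.rels ↔ ∃ x' y', (x', y') ∈ Q.rels ∧ x'.map f = x ∧ y'.map f = y := by
  rw [h]
  simp

theorem IsImage.isRelationWord_iff (h : IsImage Q f P) (w : List D) :
    P.IsRelationWord w ↔ ∃ w', Q.IsRelationWord w' ∧ w'.map f = w := by
  simp only [IsRelationWord, h.mem_iff]
  constructor
  · rintro ⟨v, ⟨x, y, h, rfl, rfl⟩ | ⟨x, y, h, rfl, rfl⟩⟩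
    · exact ⟨x, ⟨y, .inl h⟩, rfl⟩
    · exact ⟨y, ⟨x, .inr h⟩, rfl⟩
  · rintro ⟨w, ⟨v, h | h⟩, rfl⟩
    · exact ⟨v.map f, .inl ⟨w, v, h, rfl, rfl⟩⟩
    · exact ⟨v.map f, .inr ⟨v, w, h, rfl, rfl⟩⟩

theorem exists_map_eq_append₃ {w : List C} {a p b : List D} (h : w.map f = a ++ p ++ b) :
    ∃ a' p' b', w = a' ++ p' ++ b' ∧ a'.map f = a ∧ p'.map f = p ∧ b'.map f = b := by
  obtain ⟨x, b', rfl, hx, rfl⟩ := List.map_eq_append_iff.1 h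
  obtain ⟨a', p', rfl, rfl, rfl⟩ := List.map_eq_append_iff.1 hx
  exact ⟨a', p', b', rfl, rfl, rfl, rfl⟩

/-- Pieces of the image come from pieces, as the renaming is injective. -/
theorem IsImage.isPiece (h : IsImage Q f P) (hf : f.Injective) {p : List D} (hp : P.IsPiece p) :
    ∃ p', Q.IsPiece p' ∧ p'.map f = p := by
  obtain ⟨a, b, a', b', h1, h2, h3⟩ := hp
  obtain ⟨w, hw, e⟩ := (h.isRelationWord_iff _).1 h1
  obtain ⟨w', hw', e'⟩ := (h.isRelationWord_iff _).1 h2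
  obtain ⟨a, p₁, b, rfl, rfl, rfl, rfl⟩ := exists_map_eq_append₃ e
  obtain ⟨a', p₂, b', rfl, rfl, hp, rfl⟩ := exists_map_eq_append₃ e'
  have := List.map_injective_iff.2 hf hp
  subst this
  refine ⟨p₂, ⟨a, b, a', b', hw, hw', ?_⟩, rfl⟩
  rcases h3 with h3 | h3
  · left
    intro h4
    apply h3
    rw [← e, ← e', h4]
  · right
    simpa using h3

theorem IsImage.smallOverlap (h : IsImage Q f P) (hf : f.Injective) {m : ℕ}
    (hQ : Q.SmallOverlap m) : P.SmallOverlap m := by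
  rintro w hw ⟨l, hl, hp, rfl⟩
  obtain ⟨w', hw', e⟩ := (h.isRelationWord_iff _).1 hw
  have : ∃ l' : List (List C), l'.map (List.map f) = l ∧ ∀ p ∈ l', Q.IsPiece p := by
    clear hl hw e
    induction l with
    | nil => exact ⟨[], rfl, by simp⟩
    | cons p l ih =>
      obtain ⟨l', rfl, hl'⟩ := ih fun p hp' => hp p (List.mem_cons_of_mem _ hp')
      obtain ⟨p', hp', rfl⟩ := h.isPiece hf (hp p List.mem_cons_self)
      refine ⟨p' :: l', rfl, ?_⟩
      simp only [List.mem_cons]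
      rintro q (rfl | hq)
      exacts [hp', hl' q hq]
  obtain ⟨l', rfl, hl'⟩ := this
  refine hQ w' hw' ⟨l', by simpa using hl, hl', ?_⟩
  rw [← List.map_flatten] at e
  exact (List.map_injective_iff.2 hf e).symm

theorem IsImage.equivalent_map (h : IsImage Q f P) {u v : List C} (huv : Q.Equivalent u v) :
    P.Equivalent (u.map f) (v.map f) := by
  induction huv with
  | refl => exact .refl _
  | tail _ hs ih =>
    obtain ⟨a, b, x, y, hr, rfl, rfl⟩ := hs
    refine ih.trans (OneStep.equivalent ⟨a.map f, b.map f, x.map f, y.map f, ?_, by simp, by simp⟩)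
    rw [h.mem_iff, h.mem_iff]
    exact hr.imp (fun h => ⟨x, y, h, rfl, rfl⟩) (fun h => ⟨y, x, h, rfl, rfl⟩)

/-- A letter `d` which does not occur in the relations remains at the end of the word. -/
theorem IsImage.exists_equivalent (h : IsImage Q f P) (hf : f.Injective) {d : D}
    (hd : ∀ c, f c ≠ d) {u : List C} {w : List D} (hw : P.Equivalent (u.map f ++ [d]) w) :
    ∃ v, w = v.map f ++ [d] ∧ Q.Equivalent u v := by
  induction hw with
  | refl => exact ⟨u, rfl, .refl _⟩
  | tail _ hs ih =>
    obtain ⟨v, rfl, hv⟩ := ih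
    obtain ⟨a, b, x, y, hr, he, rfl⟩ := hs
    have hr' : ∃ x' y', ((x', y') ∈ Q.rels ∨ (y', x') ∈ Q.rels) ∧ x'.map f = x ∧
        y'.map f = y := by
      rw [h.mem_iff, h.mem_iff] at hr
      rcases hr with ⟨x', y', h, e1, e2⟩ | ⟨y', x', h, e1, e2⟩
      · exact ⟨x', y', .inl h, e1, e2⟩
      · exact ⟨x', y', .inr h, e2, e1⟩
    obtain ⟨x', y', hr', rfl, rfl⟩ := hr'
    rcases List.eq_nil_or_concat b with rfl | ⟨b', c, rfl⟩
    · have hx : x' ≠ [] := by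
        rcases hr' with h | h
        · exact (Q.ne_nil _ h).1
        · exact (Q.ne_nil _ h).2
      rcases List.eq_nil_or_concat x' with rfl | ⟨x₀, c, rfl⟩
      · exact absurd rfl hx
      · rw [List.append_nil, List.concat_eq_append, List.map_append, ← List.append_assoc] at he
        have := (List.append_inj' he rfl).2
        simp only [List.map_cons, List.map_nil, List.cons.injEq, and_true] at this
        exact absurd this.symm (hd c)
    · rw [List.concat_eq_append, ← List.append_assoc] at he
      obtain ⟨he, hc⟩ := List.append_inj' he rfl
      obtain ⟨a, x₁, b, rfl, rfl, hx, rfl⟩ := exists_map_eq_append₃ he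
      have := List.map_injective_iff.2 hf hx
      subst this
      refine ⟨a ++ y' ++ b, by simp [← hc], ?_⟩
      exact hv.trans (OneStep.equivalent ⟨a, b, x₁, y', hr', rfl, rfl⟩)

theorem IsImage.equivalent_iff (h : IsImage Q f P) (hf : f.Injective) {d : D}
    (hd : ∀ c, f c ≠ d) (u v : List C) :
    P.Equivalent (u.map f ++ [d]) (v.map f ++ [d]) ↔ Q.Equivalent u v := by
  constructor
  · intro h'
    obtain ⟨v', he, hv⟩ := h.exists_equivalent hf hd h'
    have := List.map_injective_iff.2 hf (List.append_inj' he rfl).1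
    rwa [this]
  · exact fun h' => (h.equivalent_map h').append_right [d]

end Map

/-- The word problem of a presentation over an alphabet `A`, from an automaton for its image
under an embedding of `A` into `Option B`. -/
theorem Setting.accepted_eq_wordProblem [Finite A] {Q : SemigroupPresentation A} {ι : A → B}
    {ℓ : List (Option (Buffers B))} (hP : P.Setting W K) (hι : ι.Injective)
    (hQ : IsImage Q (fun a => some (ι a)) P) (hℓ : P.IsClosed W K ι ℓ) :
    (automaton hℓ).accepted = Q.wordProblem := by
  rw [hP.accepted_automaton (T := Set.range (Option.map ι)) _ (fun a => ⟨a, rfl⟩) hℓ]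
  · have hinj : Function.Injective fun a => some (ι a) :=
      (Option.some_injective B).comp hι
    ext ⟨u, v⟩
    have hmap : ∀ u : List A, (DetTwoTapeAutomaton.endMarked u).map (Option.map ι) =
        u.map (fun a => some (ι a)) ++ [none] := fun u => by
      simp [DetTwoTapeAutomaton.endMarked, Function.comp_def]
    simp only [Set.mem_ofPred_eq, wordProblem, hmap]
    rw [hQ.equivalent_iff hinj (by simp)]
    constructor
    · rintro ⟨h1, h2⟩
      refine ⟨h1, ?_, h2⟩
      rintro rfl
      exact h1 h2.symm.eq_nil
    · exact fun h => ⟨h.1, h.2.2⟩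
  · intro w hw a ha
    obtain ⟨w', -, rfl⟩ := (hQ.isRelationWord_iff w).1 hw
    obtain ⟨b, -, rfl⟩ := List.mem_map.1 ha
    exact ⟨some b, rfl⟩

theorem Setting.exists_isClosed_of_isImage [Finite A] {Q : SemigroupPresentation A} {ι : A → B}
    (hP : P.Setting W K) (hQ : IsImage Q (fun a => some (ι a)) P) :
    ∃ ℓ, P.IsClosed W K ι ℓ := by
  refine hP.exists_isClosed (T := Set.range (Option.map ι)) ?_ (fun a => ⟨a, rfl⟩)
    (Set.finite_range _)
  intro w hw a ha
  obtain ⟨w', -, rfl⟩ := (hQ.isRelationWord_iff w).1 hw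
  obtain ⟨b, -, rfl⟩ := List.mem_map.1 ha
  exact ⟨some b, rfl⟩

/-! ### Presentations given by lists of relations -/

section OfList

variable {D : Type*}

/-- The relations of a list both sides of which are nonempty. -/
def properRels (r : List (List D × List D)) : List (List D × List D) :=
  r.filter fun q => !q.1.isEmpty && !q.2.isEmpty

theorem mem_properRels {r : List (List D × List D)} {q : List D × List D} :
    q ∈ properRels r ↔ q ∈ r ∧ q.1 ≠ [] ∧ q.2 ≠ [] := by
  simp [properRels]

/-- The presentation given by a list of relations. Relations with an empty side are ignored. -/
def ofList (r : List (List D × List D)) : SemigroupPresentation D where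
  rels := {q | q ∈ properRels r}
  finite_rels := List.finite_toSet _
  ne_nil _ h := (mem_properRels.1 h).2

/-- The relation words of the presentation given by a list. -/
def wordsOf (r : List (List D × List D)) : List (List D) :=
  (properRels r).map Prod.fst ++ (properRels r).map Prod.snd

theorem mem_wordsOf {r : List (List D × List D)} {w : List D} :
    w ∈ wordsOf r ↔ (ofList r).IsRelationWord w := by
  simp [wordsOf, IsRelationWord, ofList, exists_or]

/-- A bound for the lengths of the relation words. -/
def lengthBound (r : List (List D × List D)) : ℕ :=
  (wordsOf r).flatten.length

theorem length_le_lengthBound {r : List (List D × List D)} {w : List D}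
    (h : (ofList r).IsRelationWord w) : w.length ≤ lengthBound r :=
  (List.sublist_flatten_of_mem (mem_wordsOf.2 h)).length_le

theorem setting_ofList {r : List (List (Option B) × List (Option B))}
    {Q : SemigroupPresentation A} {ι : A → B} (hι : ι.Injective) (h4 : Q.SmallOverlap 4)
    (hQ : IsImage Q (fun a => some (ι a)) (ofList r)) :
    (ofList r).Setting (wordsOf r) (lengthBound r) where
  smallOverlap := hQ.smallOverlap ((Option.some_injective B).comp hι) h4
  mem_iff _ := mem_wordsOf
  length_le _ := length_le_lengthBound
  none_notMem w hw := by
    obtain ⟨w', -, rfl⟩ := (hQ.isRelationWord_iff w).1 hw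
    simp

end OfList

end SemigroupPresentation

/-! ### Primitive recursive bounded search -/

section PrimrecLists

variable {α β σ : Type*} [Primcodable α] [Primcodable β] [Primcodable σ]

theorem PrimrecPred.exists_mem {L : α → List β} {p : α → β → Prop} (hL : Primrec L)
    (hp : PrimrecPred fun x : α × β => p x.1 x.2) : PrimrecPred fun a => ∃ b ∈ L a, p a b := by
  have h : PrimrecRel fun (b : β) (a : α) => p a b :=
    hp.comp (Primrec.pair Primrec.snd Primrec.fst)
  exact h.exists_mem_list.comp hL Primrec.id

theorem PrimrecPred.forall_mem {L : α → List β} {p : α → β → Prop} (hL : Primrec L)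
    (hp : PrimrecPred fun x : α × β => p x.1 x.2) : PrimrecPred fun a => ∀ b ∈ L a, p a b := by
  have h : PrimrecRel fun (b : β) (a : α) => p a b :=
    hp.comp (Primrec.pair Primrec.snd Primrec.fst)
  exact h.forall_mem_list.comp hL Primrec.id

theorem PrimrecPred.mem {L : α → List β} {f : α → β} (hL : Primrec L) (hf : Primrec f) :
    PrimrecPred fun a => f a ∈ L a := by
  refine (PrimrecPred.exists_mem (p := fun a b => b = f a) hL
    (Primrec.eq.comp Primrec.snd (hf.comp Primrec.fst))).of_eq fun a => ?_
  simp

theorem PrimrecPred.imp {p q : α → Prop} (hp : PrimrecPred p) (hq : PrimrecPred q) :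
    PrimrecPred fun a => p a → q a :=
  (hp.not.or hq).of_eq fun _ => imp_iff_not_or.symm

theorem PrimrecPred.to_decide {p : α → Prop} {_ : ∀ a, Decidable (p a)} (hp : PrimrecPred p) :
    Primrec fun a => decide (p a) :=
  primrecPred_iff_primrec_decide.1 hp

/-- A form of `Primrec.ite` in which the decidability instance is found by unification. -/
theorem Primrec.ite_of_primrecPred {c : α → Prop} {_ : ∀ a, Decidable (c a)} {f g : α → σ}
    (hc : PrimrecPred c) (hf : Primrec f) (hg : Primrec g) :
    Primrec fun a => if c a then f a else g a :=
  Primrec.ite hc hf hg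

theorem Primrec.list_filter {L : α → List β} {g : α → β → Bool} (hL : Primrec L)
    (hg : Primrec₂ g) : Primrec fun a => (L a).filter (g a) := by
  have h : PrimrecRel fun (b : β) (a : α) => g a b = true :=
    Primrec.eq.comp (hg.comp Primrec.snd Primrec.fst) (Primrec.const true)
  refine (h.listFilter.comp hL Primrec.id).of_eq fun a => ?_
  simp

theorem Primrec.list_find? {L : α → List β} {g : α → β → Bool} (hL : Primrec L)
    (hg : Primrec₂ g) : Primrec fun a => (L a).find? (g a) :=
  (Primrec.list_head?.comp (Primrec.list_filter hL hg)).of_eq fun _ => List.head?_filter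

theorem Primrec.option_elim {o : α → Option β} {f : α → σ} {g : α → β → σ} (ho : Primrec o)
    (hf : Primrec f) (hg : Primrec₂ g) : Primrec fun a => (o a).elim (f a) (g a) :=
  (Primrec.option_casesOn ho hf hg).of_eq fun a => by cases o a <;> rfl

theorem PrimrecPred.isPrefix {f g : α → List β} (hf : Primrec f) (hg : Primrec g) :
    PrimrecPred fun a => f a <+: g a :=
  (Primrec.eq.comp hf (Primrec.list_take.comp (Primrec.list_length.comp hf) hg)).of_eq
    fun _ => List.prefix_iff_eq_take.symm

theorem PrimrecPred.isSuffix {f g : α → List β} (hf : Primrec f) (hg : Primrec g) :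
    PrimrecPred fun a => f a <:+ g a :=
  (Primrec.eq.comp hf (Primrec.list_drop.comp (Primrec.nat_sub.comp (Primrec.list_length.comp hg)
    (Primrec.list_length.comp hf)) hg)).of_eq fun _ => List.suffix_iff_eq_drop.symm

theorem Primrec.list_sublists' : Primrec (List.sublists' : List β → List (List β)) := by
  have h : Primrec₂ fun (_ : List β) (x : β × List (List β)) => x.2 ++ x.2.map (List.cons x.1) :=
    Primrec.list_append.comp (Primrec.snd.comp Primrec.snd)
      (Primrec.list_map (Primrec.snd.comp Primrec.snd)
        (Primrec.list_cons.comp (Primrec.fst.comp (Primrec.snd.comp Primrec.fst)) Primrec.snd))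
  refine (Primrec.list_foldr Primrec.id (Primrec.const [[]]) h).of_eq fun l => ?_
  induction l with
  | nil => rfl
  | cons a l ih => rw [List.sublists'_cons, ← ih]; rfl

end PrimrecLists

namespace SemigroupPresentation

/-! ### Computability of the reduction -/

section

variable {D : Type*}

/-- Pieces are found by a bounded search: over two relation words and two places in them. -/
theorem isPiece_ofList_iff {s : List (List D × List D)} {p : List D} :
    (ofList s).IsPiece p ↔ ∃ w ∈ wordsOf s, ∃ w' ∈ wordsOf s, ∃ i ∈ List.range (w.length + 1),
      ∃ j ∈ List.range (w'.length + 1),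
        (p <+: w.drop i ∧ p <+: w'.drop j) ∧ (w ≠ w' ∨ i ≠ j) := by
  simp only [mem_wordsOf, List.mem_range]
  constructor
  · rintro ⟨a, b, a', b', h, h', hne⟩
    refine ⟨_, h, _, h', a.length, by simp, a'.length, by simp, ⟨?_, ?_⟩, hne⟩
    · rw [List.append_assoc, List.drop_left]
      exact List.prefix_append _ _
    · rw [List.append_assoc, List.drop_left]
      exact List.prefix_append _ _
  · rintro ⟨w, h, w', h', i, hi, j, hj, ⟨⟨b, hb⟩, b', hb'⟩, hne⟩
    refine isPiece_of_eq (a := w.take i) (b := b) (a' := w'.take j) (b' := b') h h' ?_ ?_ ?_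
    · rw [List.append_assoc, hb, List.take_append_drop]
    · rw [List.append_assoc, hb', List.take_append_drop]
    · rw [List.length_take_of_le (by omega), List.length_take_of_le (by omega)]
      exact hne

/-- Linkedness by a bounded search: `Q` belongs to every set of relation words which contains `R`
and is closed under adjacency. -/
theorem linked_iff_forall_mem_sublists' {P : SemigroupPresentation D} {W : List (List D)}
    (hW : ∀ w, w ∈ W ↔ P.IsRelationWord w) {R Q : List D} :
    P.Linked R Q ↔ ∀ C ∈ (R :: W).sublists', R ∈ C →
      (∀ x ∈ C, ∀ y ∈ W, P.Adj x y → y ∈ C) → Q ∈ C := by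
  classical
  constructor
  · intro h C _ hR hC
    induction h with
    | refl => exact hR
    | tail _ h ih => exact hC _ ih _ ((hW _).2 ⟨_, h.symm⟩) h
  · intro h
    have := h ((R :: W).filter fun x => P.Linked R x) (List.mem_sublists'.2 List.filter_sublist)
      (by simp [Linked.refl]) fun x hx y hy hxy => by
        simp only [List.mem_filter, decide_eq_true_eq] at hx ⊢
        exact ⟨List.mem_cons_of_mem _ hy, hx.2.tail hxy⟩
    simpa using (List.mem_filter.1 this).2

end

section

variable {α D : Type*} [Primcodable α] [Primcodable D]

theorem primrec_longestSuffix {p : α → List D → Prop} {x : α → List D}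
    (hp : PrimrecPred fun y : α × List D => p y.1 y.2) (hx : Primrec x) :
    Primrec fun a => longestSuffix (p a) (x a) := by
  classical
  have hlen := Primrec.list_length.comp hx
  have h : PrimrecRel fun a k => p a ((x a).drop ((x a).length - k)) :=
    hp.comp (Primrec.pair Primrec.fst (Primrec.list_drop.comp (Primrec.nat_sub.comp
      (hlen.comp Primrec.fst) Primrec.snd) (hx.comp Primrec.fst)))
  exact Primrec.list_drop.comp (Primrec.nat_sub.comp hlen (Primrec.nat_findGreatest hlen h)) hx

variable {r : α → List (List D × List D)}

theorem primrec_properRels (hr : Primrec r) : Primrec fun a => properRels (r a) := by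
  classical
  refine (Primrec.list_filter (g := fun _ q => decide (q.1 ≠ [] ∧ q.2 ≠ [])) hr ?_).of_eq
    fun a => List.filter_congr fun q _ => ?_
  · exact ((Primrec.eq.comp (Primrec.fst.comp Primrec.snd) (Primrec.const [])).not.and
      (Primrec.eq.comp (Primrec.snd.comp Primrec.snd) (Primrec.const [])).not).to_decide
  · rw [Bool.eq_iff_iff]
    simp

theorem primrec_wordsOf (hr : Primrec r) : Primrec fun a => wordsOf (r a) :=
  Primrec.list_append.comp
    (Primrec.list_map (primrec_properRels hr) (Primrec.fst.comp Primrec.snd))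
    (Primrec.list_map (primrec_properRels hr) (Primrec.snd.comp Primrec.snd))

theorem primrec_lengthBound (hr : Primrec r) : Primrec fun a => lengthBound (r a) :=
  Primrec.list_length.comp (Primrec.list_flatten.comp (primrec_wordsOf hr))

theorem primrecPred_isPiece {f : α → List D} (hr : Primrec r) (hf : Primrec f) :
    PrimrecPred fun a => (ofList (r a)).IsPiece (f a) := by
  have hW := primrec_wordsOf hr
  refine PrimrecPred.of_eq ?_ fun a => isPiece_ofList_iff.symm
  refine .exists_mem hW (.exists_mem (hW.comp .fst) (.exists_mem (Primrec.list_range.comp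
    (Primrec.succ.comp (Primrec.list_length.comp (Primrec.snd.comp .fst)))) (.exists_mem
      (Primrec.list_range.comp (Primrec.succ.comp (Primrec.list_length.comp
        (Primrec.snd.comp .fst)))) ?_)))
  -- The argument is `((((a, w), w'), i), j)`.
  have hj : Primrec fun x : (((α × List D) × List D) × ℕ) × ℕ => x.2 := .snd
  have hi : Primrec fun x : (((α × List D) × List D) × ℕ) × ℕ => x.1.2 := .comp .snd .fst
  have hw' : Primrec fun x : (((α × List D) × List D) × ℕ) × ℕ => x.1.1.2 :=
    .comp .snd (.comp .fst .fst)
  have hw : Primrec fun x : (((α × List D) × List D) × ℕ) × ℕ => x.1.1.1.2 :=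
    .comp .snd (.comp .fst (.comp .fst .fst))
  have ha : Primrec fun x : (((α × List D) × List D) × ℕ) × ℕ => f x.1.1.1.1 :=
    hf.comp (.comp .fst (.comp .fst (.comp .fst .fst)))
  exact ((PrimrecPred.isPrefix ha (Primrec.list_drop.comp hi hw)).and
    (.isPrefix ha (Primrec.list_drop.comp hj hw'))).and
      ((Primrec.eq.comp hw hw').not.or (Primrec.eq.comp hi hj).not)

theorem primrec_suf {R : α → List D} (hr : Primrec r) (hR : Primrec R) :
    Primrec fun a => (ofList (r a)).suf (R a) :=
  primrec_longestSuffix (primrecPred_isPiece (hr.comp .fst) .snd) hR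

theorem primrec_stem {R : α → List D} (hr : Primrec r) (hR : Primrec R) :
    Primrec fun a => (ofList (r a)).stem (R a) :=
  Primrec.list_take.comp (Primrec.nat_sub.comp (Primrec.list_length.comp hR)
    (Primrec.list_length.comp (primrec_suf hr hR))) hR

theorem primrecPred_linked {R Q : α → List D} (hr : Primrec r) (hR : Primrec R)
    (hQ : Primrec Q) : PrimrecPred fun a => (ofList (r a)).Linked (R a) (Q a) := by
  have hW := primrec_wordsOf hr
  refine PrimrecPred.of_eq ?_ fun a =>
    (linked_iff_forall_mem_sublists' fun _ => mem_wordsOf).symm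
  refine .forall_mem (Primrec.list_sublists'.comp (Primrec.list_cons.comp hR hW)) (.imp
    (.mem .snd (hR.comp .fst)) (.imp (.forall_mem .snd (.forall_mem (hW.comp (.comp .fst .fst))
      (.imp (.or ?_ ?_) (.mem (.comp .snd (.comp .fst .fst)) .snd)))) (.mem .snd (hQ.comp .fst))))
  -- The argument is `(((a, C), x), y)`.
  · exact .mem (primrec_properRels (hr.comp (.comp .fst (.comp .fst .fst))))
      (.pair (.comp .snd .fst) .snd)
  · exact .mem (primrec_properRels (hr.comp (.comp .fst (.comp .fst .fst))))
      (.pair .snd (.comp .snd .fst))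

theorem primrecPred_linkedPrefix {R p : α → List D} (hr : Primrec r) (hR : Primrec R)
    (hp : Primrec p) : PrimrecPred fun a => (ofList (r a)).LinkedPrefix (R a) (p a) := by
  refine PrimrecPred.of_eq (PrimrecPred.exists_mem (L := fun a => R a :: wordsOf (r a))
    (p := fun a Q => (ofList (r a)).Linked (R a) Q ∧ p a <+: Q)
    (Primrec.list_cons.comp hR (primrec_wordsOf hr))
    ((primrecPred_linked (hr.comp .fst) (hR.comp .fst) .snd).and
      (.isPrefix (hp.comp .fst) .snd))) fun a => ?_
  constructor
  · exact fun ⟨Q, _, h⟩ => ⟨Q, h⟩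
  · rintro ⟨Q, h, hp⟩
    refine ⟨Q, ?_, h, hp⟩
    rcases h.cases_tail with h | ⟨c, -, h⟩
    · exact h ▸ List.mem_cons_self
    · exact List.mem_cons_of_mem _ (mem_wordsOf.2 ⟨c, h.symm⟩)

theorem primrec_headWord {u : α → List D} (hr : Primrec r) (hu : Primrec u) :
    Primrec fun a => (ofList (r a)).headWord (wordsOf (r a)) (u a) :=
  Primrec.list_find? (primrec_wordsOf hr) (PrimrecPred.isPrefix
    (primrec_stem (hr.comp .fst) .snd) (hu.comp .fst)).to_decide

theorem primrec_linkedSuffixes {R : α → List D} (hr : Primrec r) (hR : Primrec R) :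
    Primrec fun a => (ofList (r a)).linkedSuffixes (wordsOf (r a)) (R a) := by
  refine Primrec.list_flatMap (Primrec.list_filter (primrec_wordsOf hr)
    (primrecPred_linked (hr.comp .fst) (hR.comp .fst) .snd).to_decide) ?_
  have h : Primrec fun x : α × List D => (ofList (r x.1)).suf x.2 :=
    primrec_suf (hr.comp .fst) .snd
  exact Primrec.list_map (Primrec.list_range.comp (Primrec.list_length.comp h))
    (Primrec.list_drop.comp .snd (h.comp .fst))

theorem primrec_activeSuffix {R s : α → List D} (hr : Primrec r) (hR : Primrec R)
    (hs : Primrec s) :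
    Primrec fun a => (ofList (r a)).activeSuffix (wordsOf (r a)) (R a) (s a) :=
  Primrec.option_getD.comp (Primrec.list_find? (primrec_linkedSuffixes hr hR)
    (Primrec.option_isSome.comp (primrec_headWord (hr.comp .fst)
      (Primrec.list_append.comp .snd (hs.comp .fst))))) (.const [])

theorem primrec_commonSuffix {x y : α → List D} (hx : Primrec x) (hy : Primrec y) :
    Primrec fun a => commonSuffix (x a) (y a) :=
  primrec_longestSuffix (.isSuffix .snd (hy.comp .fst)) hx

theorem primrec_cancelStep {u v p : α → List D} (hu : Primrec u) (hv : Primrec v)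
    (hp : Primrec p) : Primrec fun a => cancelStep (u a) (v a) (p a) := by
  have h (x : α → List D) (hx : Primrec x) : Primrec fun a => (x a).head? :=
    Primrec.list_head?.comp hx
  exact Primrec.ite_of_primrecPred ((Primrec.eq.comp (h u hu) (h v hv)).and
    ((Primrec.eq.comp hp (.const [])).or (Primrec.eq.comp (h p hp) (h u hu))))
    (Primrec.option_some.comp (.pair (Primrec.list_tail.comp hu)
      (.pair (Primrec.list_tail.comp hv) (Primrec.list_tail.comp hp)))) (.const none)

theorem primrec_stemStep {R S u v p : α → List D} (hr : Primrec r) (hR : Primrec R)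
    (hS : Primrec S) (hu : Primrec u) (hv : Primrec v) (hp : Primrec p) :
    Primrec fun a => (ofList (r a)).stemStep (wordsOf (r a)) (R a) (S a) (u a) (v a) (p a) := by
  have hRu := PrimrecPred.isPrefix hR hu
  have hSv := PrimrecPred.isPrefix hS hv
  have length {x : α → List D} (hx : Primrec x) : Primrec fun a => (x a).length :=
    Primrec.list_length.comp hx
  have drop {x : α → List D} {n : α → ℕ} (hx : Primrec x) (hn : Primrec n) :
      Primrec fun a => (x a).drop (n a) := Primrec.list_drop.comp hn hx
  have take {x : α → List D} {n : α → ℕ} (hx : Primrec x) (hn : Primrec n) :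
      Primrec fun a => (x a).take (n a) := Primrec.list_take.comp hn hx
  have append {x y : α → List D} (hx : Primrec x) (hy : Primrec y) :
      Primrec fun a => x a ++ y a := Primrec.list_append.comp hx hy
  have triple {x y z : α → List D} (hx : Primrec x) (hy : Primrec y) (hz : Primrec z) :
      Primrec fun a => some (x a, y a, z a) := Primrec.option_some.comp (.pair hx (.pair hy hz))
  have hact := primrec_activeSuffix hr hR (drop hu (length hR))
  have hcom := primrec_commonSuffix (primrec_suf hr hR) (primrec_suf hr hS)
  have hR' := Primrec.nat_sub.comp (length hR) (length hcom)
  have hS' := Primrec.nat_sub.comp (length hS) (length hcom)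
  refine .ite_of_primrecPred (hRu.not.and (hSv.not.and ((Primrec.eq.comp hR hS).and (.isPrefix hp hu))))
    (primrec_cancelStep hu hv hp) (.ite_of_primrecPred ((primrecPred_linked hr hR hS).and
      (primrecPred_linkedPrefix hr hR hp)) (.ite_of_primrecPred hRu (.ite_of_primrecPred hSv ?_ ?_)
        (.ite_of_primrecPred hSv ?_ (.ite_of_primrecPred (.and ?_ ?_) ?_ (.const none)))) (.const none))
  · exact triple (append hact (drop hu (length hR))) (append hact (drop hv (length hS))) (.const [])
  · exact triple (append (primrec_suf hr hS) (drop hu (length hR)))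
      (drop hv (length (primrec_stem hr hS))) (.const [])
  · exact triple (drop hu (length (primrec_stem hr hR)))
      (append (primrec_suf hr hR) (drop hv (length hS))) (.const [])
  · exact .isPrefix (take hR hR') hu
  · exact .isPrefix (take hS hS') hv
  · exact triple (drop hu hR') (drop hv hS') hcom

theorem primrec_reduceStep {q : α → List D × List D × List D} (hr : Primrec r)
    (hq : Primrec q) : Primrec fun a => (ofList (r a)).reduceStep (wordsOf (r a)) (q a) := by
  have h1 : Primrec fun a => (q a).1 := .comp .fst hq
  have h2 : Primrec fun a => (q a).2.1 := .comp .fst (.comp .snd hq)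
  have h3 : Primrec fun a => (q a).2.2 := .comp .snd (.comp .snd hq)
  exact .option_elim (.option_bind (primrec_headWord hr h1) (Primrec.option_map
    (primrec_headWord (hr.comp .fst) (h2.comp .fst)) (Primrec.pair (.comp .snd .fst) .snd)))
    (primrec_cancelStep h1 h2 h3) (primrec_stemStep (hr.comp .fst) (.comp .fst .snd)
      (.comp .snd .snd) (h1.comp .fst) (h2.comp .fst) (h3.comp .fst))

end

/-! ### Computability of the transition function -/

section

variable {α B : Type*} [Primcodable α] [Primcodable B]
  {r : α → List (List (Option B) × List (Option B))}

theorem primrecPred_isFull {L : α → ℕ} {x : α → List (Option B)} (hL : Primrec L)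
    (hx : Primrec x) : PrimrecPred fun a => IsFull (L a) (x a) :=
  (Primrec.nat_le.comp hL (Primrec.list_length.comp hx)).or (.mem hx (.const none))

theorem primrec_fullStep {L : α → ℕ} {q : α → Buffers B} (hr : Primrec r) (hL : Primrec L)
    (hq : Primrec q) :
    Primrec fun a => (ofList (r a)).fullStep (wordsOf (r a)) (L a) (q a) :=
  .ite_of_primrecPred ((primrecPred_isFull hL (.comp .fst hq)).and
    (primrecPred_isFull hL (.comp .fst (.comp .snd hq))))
    (primrec_reduceStep hr hq) (Primrec.option_some.comp hq)

theorem primrec_normalize {L N : α → ℕ} {q : α → Buffers B} (hr : Primrec r) (hL : Primrec L)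
    (hN : Primrec N) (hq : Primrec q) :
    Primrec fun a => (ofList (r a)).normalize (wordsOf (r a)) (L a) (N a) (q a) :=
  Primrec.nat_iterate hN (Primrec.option_some.comp hq) (Primrec.option_bind .snd
    (primrec_fullStep (hr.comp (.comp .fst .fst)) (hL.comp (.comp .fst .fst)) .snd))

theorem primrec_next {o : α → Option (Buffers B)} {b : α → Option B} (hr : Primrec r)
    (ho : Primrec o) (hb : Primrec b) : Primrec fun a =>
      (ofList (r a)).next (wordsOf (r a)) (lengthBound (r a)) (o a) (b a) := by
  have hK := primrec_lengthBound hr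
  have hL : Primrec fun a => 2 * lengthBound (r a) + 1 :=
    Primrec.succ.comp (Primrec.nat_double.comp hK)
  have hN : Primrec fun a => maxWeight (lengthBound (r a)) + 1 := Primrec.succ.comp
    (Primrec.nat_add.comp (Primrec.nat_mul.comp hL (Primrec.succ.comp hK)) hK)
  have hb' : Primrec fun a => [b a] := Primrec.list_cons.comp hb (.const [])
  refine Primrec.option_map (.option_elim ho (.ite_of_primrecPred (Primrec.eq.comp hb (.const none))
    (.const none) (primrec_normalize hr hL hN (.pair hb' (.const ([], []))))) (.ite_of_primrecPred
      (primrecPred_isFull (hL.comp .fst) (.comp .fst .snd)) ?_ ?_)) (Primrec.option_some.comp .snd)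
  · exact primrec_normalize (hr.comp .fst) (hL.comp .fst) (hN.comp .fst)
      (.pair (.comp .fst .snd) (.pair (Primrec.list_append.comp (.comp .fst (.comp .snd .snd))
        (hb'.comp .fst)) (.comp .snd (.comp .snd .snd))))
  · exact primrec_normalize (hr.comp .fst) (hL.comp .fst) (hN.comp .fst)
      (.pair (Primrec.list_append.comp (.comp .fst .snd) (hb'.comp .fst)) (.comp .snd .snd))

theorem primrecPred_readsFirst {o : α → Option (Buffers B)} (hr : Primrec r)
    (ho : Primrec o) : PrimrecPred fun a => ReadsFirst (lengthBound (r a)) (o a) := by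
  have hL : Primrec fun a => 2 * lengthBound (r a) + 1 :=
    Primrec.succ.comp (Primrec.nat_double.comp (primrec_lengthBound hr))
  refine PrimrecPred.of_eq (.forall_mem
    (p := fun a (q : Buffers B) => ¬ IsFull (2 * lengthBound (r a) + 1) q.1)
    (Primrec.optionToList.comp ho) (primrecPred_isFull (hL.comp .fst) (.comp .fst .snd)).not) fun a => ?_
  simp [ReadsFirst]

theorem primrec_positionCode {ℓ : α → List (Option (Buffers B))} {o : α → Option (Buffers B)}
    (hr : Primrec r) (hℓ : Primrec ℓ) (ho : Primrec o) :
    Primrec fun a => positionCode (ℓ a) (ReadsFirst (lengthBound (r a))) (o a) := by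
  let : DecidableEq (Option (Buffers B)) := fun _ _ => Classical.propDecidable _
  have h := Primrec.list_idxOf.comp ho hℓ
  unfold positionCode
  exact Primrec.ite_of_primrecPred (primrecPred_readsFirst hr ho) (Primrec.sumInl.comp h) (Primrec.sumInr.comp h)

end

end SemigroupPresentation

namespace SemigroupPresentation

/-! ### The reversed presentation -/

section Reverse

variable {A : Type*} {P : SemigroupPresentation A}

/-- The presentation whose relations are those of `P`, written backwards. -/
def reverse (P : SemigroupPresentation A) : SemigroupPresentation A where
  rels := (fun q => (q.1.reverse, q.2.reverse)) '' P.rels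
  finite_rels := P.finite_rels.image _
  ne_nil := by
    rintro _ ⟨q, hq, rfl⟩
    simpa using P.ne_nil q hq

theorem mem_rels_reverse {x y : List A} :
    (x, y) ∈ P.reverse.rels ↔ (x.reverse, y.reverse) ∈ P.rels := by
  constructor
  · rintro ⟨⟨x', y'⟩, h, he⟩
    obtain ⟨rfl, rfl⟩ := Prod.mk.inj he
    simpa using h
  · exact fun h => ⟨_, h, by simp⟩

theorem isRelationWord_reverse {w : List A} :
    P.reverse.IsRelationWord w ↔ P.IsRelationWord w.reverse := by
  simp only [IsRelationWord, mem_rels_reverse]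
  exact ⟨fun ⟨v, h⟩ => ⟨v.reverse, h⟩, fun ⟨v, h⟩ => ⟨v.reverse, by simpa using h⟩⟩

theorem IsPiece.of_reverse {p : List A} (h : P.reverse.IsPiece p) : P.IsPiece p.reverse := by
  obtain ⟨a, b, a', b', h1, h2, h3⟩ := h
  rw [isRelationWord_reverse] at h1 h2
  refine isPiece_of_eq (a := b.reverse) (b := a.reverse) (a' := b'.reverse) (b' := a'.reverse)
    h1 h2 (by simp) (by simp) ?_
  by_cases h : a ++ p ++ b = a' ++ p ++ b'
  · right
    have := congrArg List.length h
    rcases h3 with h3 | h3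
    · exact absurd h h3
    · simp only [List.length_append, List.length_reverse] at this ⊢
      omega
  · exact .inl fun h' => h (List.reverse_injective h')

theorem SmallOverlap.reverse {m : ℕ} (h : P.SmallOverlap m) : P.reverse.SmallOverlap m := by
  rintro w hw ⟨l, hl, hp, rfl⟩
  refine h _ (isRelationWord_reverse.1 hw) ⟨(l.map List.reverse).reverse, by simpa using hl, ?_,
    List.reverse_flatten.symm⟩
  intro p hp'
  obtain ⟨q, hq, rfl⟩ := List.mem_map.1 (List.mem_reverse.1 hp')
  exact (hp q hq).of_reverse

theorem equivalent_reverse {u v : List A} :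
    P.reverse.Equivalent u v ↔ P.Equivalent u.reverse v.reverse := by
  constructor
  · intro h
    induction h with
    | refl => exact .refl _
    | tail _ h ih =>
      obtain ⟨a, b, x, y, hr, rfl, rfl⟩ := h
      rw [mem_rels_reverse, mem_rels_reverse] at hr
      exact ih.trans (OneStep.equivalent
        ⟨b.reverse, a.reverse, x.reverse, y.reverse, hr, by simp, by simp⟩)
  · intro h
    suffices ∀ u v, P.Equivalent u v → P.reverse.Equivalent u.reverse v.reverse by
      simpa using this _ _ h
    clear h u v
    intro u v h
    induction h with
    | refl => exact .refl _
    | tail _ h ih =>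
      obtain ⟨a, b, x, y, hr, rfl, rfl⟩ := h
      refine ih.trans (OneStep.equivalent
        ⟨b.reverse, a.reverse, x.reverse, y.reverse, ?_, by simp, by simp⟩)
      rw [mem_rels_reverse, mem_rels_reverse]
      simpa using hr

theorem wordProblem_reverse : P.reverse.wordProblem = reverseRel P.wordProblem := by
  ext ⟨u, v⟩
  simp only [wordProblem, reverseRel, equivalent_reverse, Set.mem_image, Set.mem_ofPred_eq]
  constructor
  · exact fun h => ⟨(u.reverse, v.reverse), by simpa using h, by simp⟩
  · rintro ⟨⟨u', v'⟩, h, he⟩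
    obtain ⟨rfl, rfl⟩ := Prod.mk.inj he
    simpa using h

end Reverse

/-! ### Existence of the automata -/

/-- The list of relations over `Option B` obtained by renaming letters. -/
def renamed {A B : Type*} (f : A → B) (r : List (List A × List A)) :
    List (List (Option B) × List (Option B)) :=
  r.map fun q => (q.1.map fun a => some (f a), q.2.map fun a => some (f a))

theorem isImage_ofList_renamed {A B C : Type*} {P : SemigroupPresentation A} {g : A → C}
    {f : C → B} {r : List (List C × List C)}
    (hr : {q | q ∈ r} = (fun q => (q.1.map g, q.2.map g)) '' P.rels) :
    IsImage P (fun a => some (f (g a))) (ofList (renamed f r)) := by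
  have h : ∀ q, q ∈ r ↔ ∃ q' ∈ P.rels, (q'.1.map g, q'.2.map g) = q := fun q => Set.ext_iff.1 hr q
  ext ⟨x, y⟩
  simp only [ofList, Set.mem_ofPred_eq, mem_properRels, renamed, List.mem_map, h, Set.mem_image]
  constructor
  · rintro ⟨⟨_, ⟨q, hq, rfl⟩, he⟩, -⟩
    exact ⟨q, hq, by simpa [Function.comp_def] using he⟩
  · rintro ⟨q, hq, he⟩
    refine ⟨⟨_, ⟨q, hq, rfl⟩, by simpa [Function.comp_def] using he⟩, ?_⟩
    obtain ⟨rfl, rfl⟩ := Prod.mk.inj he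
    simpa using P.ne_nil q hq

/-- The word problem of a `C(4)` presentation is deterministic rational. -/
theorem SmallOverlap.isDetRational {A : Type*} [Finite A] {P : SemigroupPresentation A}
    (h4 : P.SmallOverlap 4) : IsDetRational P.wordProblem := by
  have hr : {q | q ∈ P.finite_rels.toFinset.toList} =
      (fun q => (q.1.map id, q.2.map id)) '' P.rels := by
    ext q
    simp
  have hQ := isImage_ofList_renamed (f := id) hr
  have hP := setting_ofList (ι := id) Function.injective_id h4 hQ
  obtain ⟨ℓ, hℓ⟩ := hP.exists_isClosed_of_isImage hQ
  exact ⟨_, _, automaton hℓ, hP.accepted_eq_wordProblem Function.injective_id hQ hℓ⟩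

/-! ### Computation of the automata -/

/-- The letters `0, …, n - 1` and the end-marker. -/
def letters (n : ℕ) : List (Option ℕ) :=
  none :: (List.range n).map some

theorem mem_letters {n : ℕ} {b : Option ℕ} :
    b ∈ letters n ↔ ∃ a : Option (Fin n), a.map Fin.val = b := by
  constructor
  · intro h
    rcases List.mem_cons.1 h with rfl | h
    · exact ⟨none, rfl⟩
    · obtain ⟨i, hi, rfl⟩ := List.mem_map.1 h
      exact ⟨some ⟨i, List.mem_range.1 hi⟩, rfl⟩
  · rintro ⟨_ | a, rfl⟩
    · exact List.mem_cons_self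
    · exact List.mem_cons_of_mem _ (List.mem_map.2 ⟨a, List.mem_range.2 a.2, rfl⟩)

theorem isClosed_iff {P : SemigroupPresentation (Option ℕ)} {W : List (List (Option ℕ))}
    {K n : ℕ} {ℓ : List (Option (Buffers ℕ))} :
    P.IsClosed W K (Fin.val : Fin n → ℕ) ℓ ↔ (none ∈ ℓ ∧ some ([], [], []) ∈ ℓ) ∧
      ∀ o ∈ ℓ, ∀ b ∈ letters n, ∀ o' ∈ (P.next W K o b).toList, o' ∈ ℓ := by
  simp only [mem_letters, Option.mem_toList]
  constructor
  · rintro ⟨h1, h2, h3⟩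
    refine ⟨⟨h1, h2⟩, ?_⟩
    rintro o ho _ ⟨a, rfl⟩ o' h
    exact h3 o ho a o' h
  · rintro ⟨⟨h1, h2⟩, h3⟩
    exact ⟨h1, h2, fun o ho a o' h => h3 o ho _ ⟨a, rfl⟩ o' h⟩

/-- The transition table of the automaton of a list of states. -/
noncomputable def transitionTable (r : List (List (Option ℕ) × List (Option ℕ))) (n : ℕ)
    (ℓ : List (Option (Buffers ℕ))) : List (ℕ × Option ℕ × (ℕ ⊕ ℕ)) :=
  (List.range ℓ.length).flatMap fun i => (letters n).filterMap fun b =>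
    (ℓ[i]?.bind fun o => (ofList r).next (wordsOf r) (lengthBound r) o b).map fun o =>
      (i, b, positionCode ℓ (ReadsFirst (lengthBound r)) o)

/-- The complete data of the automaton of a list of states. -/
noncomputable def automatonCode (r : List (List (Option ℕ) × List (Option ℕ))) (n : ℕ)
    (ℓ : List (Option (Buffers ℕ))) : AutomatonCode :=
  ((ℓ.length, ℓ.length), positionCode ℓ (ReadsFirst (lengthBound r)) none,
    [positionCode ℓ (ReadsFirst (lengthBound r)) (some ([], [], []))],
    transitionTable r n ℓ, transitionTable r n ℓ)

theorem stateCode_injective {k₁ k₂ : ℕ} :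
    Function.Injective (stateCode : Fin k₁ ⊕ Fin k₂ → ℕ ⊕ ℕ) :=
  Sum.map_injective.2 ⟨Fin.val_injective, Fin.val_injective⟩

theorem mem_transitionTable {r : List (List (Option ℕ) × List (Option ℕ))} {n : ℕ}
    {ℓ : List (Option (Buffers ℕ))} {p : Fin ℓ.length} {a : Option (Fin n)} {c : ℕ ⊕ ℕ} :
    (p.val, a.map Fin.val, c) ∈ transitionTable r n ℓ ↔
      ∃ o, (ofList r).next (wordsOf r) (lengthBound r) ℓ[p] (a.map Fin.val) = some o ∧
        positionCode ℓ (ReadsFirst (lengthBound r)) o = c := by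
  simp only [transitionTable, List.mem_flatMap, List.mem_range, List.mem_filterMap,
    Option.map_eq_some_iff, Option.bind_eq_some_iff, Prod.mk.injEq]
  constructor
  · rintro ⟨_, hi, _, -, o, ⟨o', ho', h⟩, rfl, rfl, rfl⟩
    obtain ⟨_, rfl⟩ := List.getElem?_eq_some_iff.1 ho'
    exact ⟨o, h, rfl⟩
  · rintro ⟨o, h, rfl⟩
    exact ⟨p, p.2, _, mem_letters.2 ⟨a, rfl⟩, o, ⟨_, List.getElem?_eq_getElem p.2, h⟩, rfl, rfl, rfl⟩

/-- The list of states determines the complete data of its automaton. Both transition tables are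
the same, because a transition depends only on the position of the state in the list. -/
theorem describes_automatonCode {r : List (List (Option ℕ) × List (Option ℕ))} {n : ℕ}
    {ℓ : List (Option (Buffers ℕ))}
    (hℓ : (ofList r).IsClosed (wordsOf r) (lengthBound r) (Fin.val : Fin n → ℕ) ℓ) :
    (automatonCode r n ℓ).Describes (automaton hℓ) := by
  have hδ (p : Fin ℓ.length) (a : Option (Fin n)) (q : Fin ℓ.length ⊕ Fin ℓ.length) :
      (p.val, a.map Fin.val, stateCode q) ∈ transitionTable r n ℓ ↔
        (automaton hℓ).δ₁ p a = some q := by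
    rw [mem_transitionTable]
    simp only [automaton, listAutomaton, Option.bind_eq_some_iff]
    refine exists_congr fun o => and_congr_right fun h => ?_
    have ho : o ∈ ℓ := hℓ.next _ (List.getElem_mem _) a o h
    rw [dif_pos ho, Option.some.injEq, ← stateCode_position _ _ _ ho, stateCode_injective.eq_iff]
  refine ⟨rfl, (stateCode_position _ _ _ hℓ.init).symm, fun q => ?_, hδ, hδ⟩
  simp only [automatonCode, List.mem_singleton, automaton, listAutomaton, Set.mem_singleton_iff]
  rw [← stateCode_position _ _ _ hℓ.terminal, stateCode_injective.eq_iff]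

theorem primrec_letters : Primrec letters :=
  Primrec.list_cons.comp (.const none)
    (Primrec.list_map Primrec.list_range (Primrec.option_some.comp .snd))

section

variable {α : Type*} [Primcodable α] {r : α → List (List (Option ℕ) × List (Option ℕ))}
  {n : α → ℕ} {ℓ : α → List (Option (Buffers ℕ))}

theorem primrecPred_isClosed (hr : Primrec r) (hn : Primrec n) (hℓ : Primrec ℓ) :
    PrimrecPred fun a => (ofList (r a)).IsClosed (wordsOf (r a)) (lengthBound (r a))
      (Fin.val : Fin (n a) → ℕ) (ℓ a) := by
  refine PrimrecPred.of_eq ?_ fun a => isClosed_iff.symm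
  exact .and (.and (.mem hℓ (.const none)) (.mem hℓ (.const (some ([], [], [])))))
    (.forall_mem hℓ (.forall_mem (primrec_letters.comp (hn.comp .fst)) (.forall_mem
      (Primrec.optionToList.comp (primrec_next (hr.comp (.comp .fst .fst)) (.comp .snd .fst) .snd))
      (.mem (hℓ.comp (.comp .fst (.comp .fst .fst))) .snd))))

theorem primrec_transitionTable (hr : Primrec r) (hn : Primrec n) (hℓ : Primrec ℓ) :
    Primrec fun a => transitionTable (r a) (n a) (ℓ a) := by
  refine Primrec.list_flatMap (Primrec.list_range.comp (Primrec.list_length.comp hℓ))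
    (Primrec.listFilterMap (primrec_letters.comp (hn.comp .fst)) (Primrec.option_map
      (Primrec.option_bind (Primrec.list_getElem?.comp (hℓ.comp (.comp .fst .fst))
        (.comp .snd .fst)) (primrec_next (hr.comp (.comp .fst (.comp .fst .fst))) .snd
          (.comp .snd .fst))) (Primrec.pair (.comp .snd (.comp .fst .fst)) (.pair (.comp .snd .fst) ?_))))
  exact primrec_positionCode (hr.comp (.comp .fst (.comp .fst .fst)))
    (hℓ.comp (.comp .fst (.comp .fst .fst))) .snd

theorem primrec_automatonCode (hr : Primrec r) (hn : Primrec n) (hℓ : Primrec ℓ) :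
    Primrec fun a => automatonCode (r a) (n a) (ℓ a) := by
  have h := primrec_transitionTable hr hn hℓ
  have hlen := Primrec.list_length.comp hℓ
  exact .pair (.pair hlen hlen) (.pair (primrec_positionCode hr hℓ (.const none)) (.pair
    (Primrec.list_cons.comp (primrec_positionCode hr hℓ (.const (some ([], [], [])))) (.const []))
    (.pair h h)))

end

open Classical in
/-- The number `k`, if it is the code of a list of states which is closed under transitions. -/
noncomputable def closedOfNat (c : PresentationCode) (k : ℕ) :
    Option (List (Option (Buffers ℕ))) :=
  (Encodable.decode k).bind fun ℓ =>
    if (ofList (renamed id c.2)).IsClosed (wordsOf (renamed id c.2)) (lengthBound (renamed id c.2))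
      (Fin.val : Fin c.1 → ℕ) ℓ then some ℓ else none

/-- The algorithm: a search for a closed list of states, of which the automaton is output. -/
noncomputable def computeAutomaton (c : PresentationCode) : Part AutomatonCode :=
  (Nat.rfindOpt (closedOfNat c)).map (automatonCode (renamed id c.2) c.1)

theorem primrec_renamed {α : Type*} [Primcodable α] {r : α → List (List ℕ × List ℕ)}
    (hr : Primrec r) : Primrec fun a => renamed id (r a) :=
  Primrec.list_map hr (Primrec.pair
    (Primrec.list_map (.comp .fst .snd) (Primrec.option_some.comp .snd))
    (Primrec.list_map (.comp .snd .snd) (Primrec.option_some.comp .snd)))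

theorem partrec_computeAutomaton : Partrec computeAutomaton := by
  have hr : Primrec fun c : PresentationCode => renamed id c.2 := primrec_renamed .snd
  have h : Primrec₂ closedOfNat := .option_bind (Primrec.decode.comp .snd)
    (.ite_of_primrecPred (primrecPred_isClosed (hr.comp (.comp .fst .fst))
      (.comp .fst (.comp .fst .fst)) .snd) (Primrec.option_some.comp .snd) (.const none))
  exact (Partrec.rfindOpt h.to_comp).map
    (primrec_automatonCode (hr.comp .fst) (.comp .fst .fst) .snd).to_comp

/-- The search terminates, since a closed list of states exists; and every closed list of states
gives an automaton for the word problem. -/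
theorem computesAutomata_computeAutomaton :
    ComputesAutomata computeAutomaton fun P => P.wordProblem := by
  rintro _ P ⟨n, r⟩ ⟨rfl, hr⟩ h4
  have hQ : IsImage P (fun a => some a.val) (ofList (renamed id r)) := isImage_ofList_renamed hr
  have hP := setting_ofList Fin.val_injective h4 hQ
  obtain ⟨ℓ, hℓ⟩ := hP.exists_isClosed_of_isImage hQ
  have hdom : (Nat.rfindOpt (closedOfNat (n, r))).Dom := by
    rw [Nat.rfindOpt_dom]
    exact ⟨Encodable.encode ℓ, ℓ, by simp [closedOfNat, hℓ]⟩
  obtain ⟨ℓ', hmem⟩ := Part.dom_iff_mem.1 hdom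
  obtain ⟨k, hk⟩ := Nat.rfindOpt_spec hmem
  obtain ⟨ℓ'', -, h⟩ := Option.bind_eq_some_iff.1 hk
  rw [Option.ite_none_right_eq_some, Option.some.injEq] at h
  obtain ⟨hℓ', rfl⟩ := h
  exact ⟨_, Part.mem_map _ hmem, _, _, automaton hℓ', describes_automatonCode hℓ',
    hP.accepted_eq_wordProblem Fin.val_injective hQ hℓ'⟩

/-- The code of the reversed presentation. -/
def reverseCode (c : PresentationCode) : PresentationCode :=
  (c.1, c.2.map fun q => (q.1.reverse, q.2.reverse))

theorem primrec_reverseCode : Primrec reverseCode :=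
  .pair .fst (Primrec.list_map .snd (Primrec.pair (Primrec.list_reverse.comp (.comp .fst .snd))
    (Primrec.list_reverse.comp (.comp .snd .snd))))

theorem describes_reverseCode {n : ℕ} {P : SemigroupPresentation (Fin n)} {c : PresentationCode}
    (h : c.Describes P) : (reverseCode c).Describes P.reverse := by
  refine ⟨h.1, ?_⟩
  have h' : ∀ q, q ∈ c.2 ↔ ∃ q' ∈ P.rels, (q'.1.map Fin.val, q'.2.map Fin.val) = q :=
    fun q => Set.ext_iff.1 h.2 q
  ext q
  simp only [reverseCode, Set.mem_ofPred_eq, List.mem_map, h', reverse, Set.mem_image]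
  simp

end SemigroupPresentation

theorem mainTheorem2 :
    (∀ (A : Type*) [Finite A] (P : SemigroupPresentation A), P.SmallOverlap 4 →
      IsDetRational P.wordProblem ∧ IsRevDetRational P.wordProblem) ∧
    (∃ F : PresentationCode →. AutomatonCode, Partrec F ∧
      ComputesAutomata F (fun P => P.wordProblem)) ∧
    (∃ G : PresentationCode →. AutomatonCode, Partrec G ∧
      ComputesAutomata G (fun P => reverseRel P.wordProblem)) := by
  open SemigroupPresentation in
  refine ⟨fun A _ P h4 => ⟨h4.isDetRational, ?_⟩,
    ⟨_, partrec_computeAutomaton, computesAutomata_computeAutomaton⟩,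
    ⟨_, partrec_computeAutomaton.comp primrec_reverseCode.to_comp, ?_⟩⟩
  · rw [IsRevDetRational, ← wordProblem_reverse]
    exact h4.reverse.isDetRational
  · intro n P c hc h4
    have := computesAutomata_computeAutomaton n P.reverse (reverseCode c)
      (describes_reverseCode hc) h4.reverse
    simpa only [wordProblem_reverse] using this
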